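/- **The meta-logic.** $FO\lambda^{\Delta\mathbb N}$ is an intuitionistic sequent calculus. Its terms are simply typed $\lambda$-terms, identified up to $\alpha\beta\eta$-conversion. Its formulas are built from atoms with $\bot,\top,\land,\lor,\supset$ and $\forall_\tau,\exists_\tau$, where $\tau$ is a simple type not containing the type $o$ of formulas. Its sequents are $\Gamma\longrightarrow B$ with $\Gamma$ a finite multiset of formulas. It has * the usual left and right rules for the connectives and quantifiers, contraction on the left, cut, and the initial rule $A,\Gamma\longrightarrow A$ for atomic $A$; * for the predicate $\mathit{nat}$ on the type $nt$ (with constants $z:nt$ and $s:nt\to nt$): $\Gamma\longrightarrow \mathit{nat}\,z$; from $\Gamma\longrightarrow\mathit{nat}\,I$ infer $\Gamma\longrightarrow \mathit{nat}\,(s\,I)$; and from $\longrightarrow B\,z$, $\;B\,j\longrightarrow B\,(s\,j)$ ($j$ a new eigenvariable) and $B\,I,\Gamma\longrightarrow C$ infer $\mathit{nat}\,I,\Gamma\longrightarrow C$; * for the other predicates, relative to a definition (a set of clauses $\forall\bar x[p\,\bar t\triangleq B]$ in which every free variable of $B$ is free in $p\,\bar t$, stratified by levels so that the level of $B$ is at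 most that of $p$): from $\Gamma\longrightarrow B\theta$ infer $\Gamma\longrightarrow p\,\bar u$ if $p\,\bar u=(p\,\bar t)\theta$ for some clause; and infer $p\,\bar u,\Gamma\longrightarrow C$ from all the premises $B\theta,\Gamma\theta\longrightarrow C\theta$, where $\forall\bar x[p\,\bar t\triangleq B]$ ranges over the clauses and $\theta$ over a complete set of unifiers of $p\,\bar u$ and $p\,\bar t$. **The definition $\mathcal D$.** Besides $nt$ the primitive types are $i$ (object-level terms and types), $atm$, $prp$ and $atmlst$. The constants are $\mathit{nil}:atmlst$ and $::$ of type $atm\to atmlst\to atmlst$; $\langle\cdot\rangle:atm\to prp$, $tt:prp$, $\&:prp\to prp\to prp$, $\Rightarrow:atm\to prp\to prp$, $\bigwedge:(i\to prp)\to prp$; $\mathit{abs}:(i\to i)\to i$, $\mathit{app},\mathit{arr}:i\to i\to i$, $\mathit{gnd}:i$; and $\mathit{typeof},\Downarrow,\leadsto,\leadsto^*:i\to i\to atm$. Capital letters are universally quantified, and a clause written without $\triangleq$ has body $\top$. The clauses of $\mathcal D$ are: * natural numbers: $I=I$; $\;\mathit{sum}\,z\,J\,J\triangleq \mathit{nat}\,J$;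 $\;\mathit{sum}\,(s\,I)\,J\,(s\,K)\triangleq\mathit{sum}\,I\,J\,K$; $\;z<s\,J\triangleq\mathit{nat}\,J$; $\;s\,I<s\,J\triangleq I<J$; $\;I\le I$; $\;I\le J\triangleq I<J$; * lists: $\mathit{length}\,\mathit{nil}\,z$; $\;\mathit{length}\,(X::L)\,(s\,I)\triangleq\mathit{length}\,L\,I$; $\;\mathit{list}\,L\triangleq\exists i(\mathit{nat}\,i\land\mathit{length}\,L\,i)$; $\;\mathit{element}\,X\,(X::L)$; $\;\mathit{element}\,X\,(Y::L)\triangleq\mathit{element}\,X\,L$; $\;\mathit{split}\,\mathit{nil}\,\mathit{nil}\,\mathit{nil}$; $\;\mathit{split}\,(X::L_1)\,(X::L_2)\,L_3\triangleq\mathit{split}\,L_1\,L_2\,L_3$; $\;\mathit{split}\,(X::L_1)\,L_2\,(X::L_3)\triangleq\mathit{split}\,L_1\,L_2\,L_3$; $\;\mathit{permute}\,\mathit{nil}\,\mathit{nil}$; $\;\mathit{permute}\,(X::L_1)\,L_2\triangleq\exists l(\mathit{split}\,L_2\,(X::\mathit{nil})\,l\land\mathit{permute}\,L_1\,l)$;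 * intuitionistic object logic: $\mathit{seq}\,I\,(A'::L)\,\langle A\rangle\triangleq\mathit{element}\,A\,(A'::L)$; $\;\mathit{seq}\,I\,L\,tt$; $\;\mathit{seq}\,(s\,I)\,L\,(B\,\&\,C)\triangleq\mathit{seq}\,I\,L\,B\land\mathit{seq}\,I\,L\,C$; $\;\mathit{seq}\,(s\,I)\,L\,(A\Rightarrow B)\triangleq\mathit{seq}\,I\,(A::L)\,B$; $\;\mathit{seq}\,(s\,I)\,L\,(\bigwedge B)\triangleq\forall x\,\mathit{seq}\,I\,L\,(B\,x)$; $\;\mathit{seq}\,(s\,I)\,L\,\langle A\rangle\triangleq\exists b(\mathit{prog}\,A\,b\land\mathit{seq}\,I\,L\,b)$; * untyped $\lambda$-calculus: $\mathit{prog}\,(\mathit{typeof}\,(\mathit{abs}\,R)\,(\mathit{arr}\,T\,U))\,(\bigwedge n(\mathit{typeof}\,n\,T\Rightarrow\langle\mathit{typeof}\,(R\,n)\,U\rangle))$; $\;\mathit{prog}\,(\mathit{typeof}\,(\mathit{app}\,M\,N)\,T)\,(\langle\mathit{typeof}\,M\,(\mathit{arr}\,U\,T)\rangle\,\&\,\langle\mathit{typeof}\,N\,U\rangle)$;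 $\;\mathit{prog}\,(\mathit{abs}\,R\Downarrow\mathit{abs}\,R)\,tt$; $\;\mathit{prog}\,(\mathit{app}\,M\,N\Downarrow V)\,(\langle M\Downarrow\mathit{abs}\,R\rangle\,\&\,\langle R\,N\Downarrow V\rangle)$; $\;\mathit{prog}\,(\mathit{app}\,(\mathit{abs}\,R)\,M\leadsto R\,M)\,tt$; $\;\mathit{prog}\,(\mathit{app}\,M\,N\leadsto\mathit{app}\,M'\,N)\,\langle M\leadsto M'\rangle$; $\;\mathit{prog}\,(M\leadsto^*M)\,tt$; $\;\mathit{prog}\,(M\leadsto^*N)\,(\langle M\leadsto M'\rangle\,\&\,\langle M'\leadsto^*N\rangle)$; * $X\equiv X$, for $\equiv$ on type $i$. Write $\rhd A$ for $\exists j(\mathit{nat}\,j\land\mathit{seq}\,j\,\mathit{nil}\,\langle A\rangle)$. **Theorem.** The following formulas are derivable in $FO\lambda^{\Delta\mathbb N}$ with the definition $\mathcal D$. Determinacy of semantics: $$\forall m\forall m_1\forall m_2(\rhd(m\Downarrow m_1)\supset\rhd(m\Downarrow m_2)\supset m_1\equiv m_2)$$ $$\forall m\forall m_1\forall m_2(\rhd(m\leadsto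 m_1)\supset\rhd(m\leadsto m_2)\supset m_1\equiv m_2)$$ $$\forall m\forall r_1\forall r_2(\rhd(m\leadsto^*\mathit{abs}\,r_1)\supset\rhd(m\leadsto^*\mathit{abs}\,r_2)\supset \mathit{abs}\,r_1\equiv\mathit{abs}\,r_2)$$ Equivalence of semantics: $$\forall m\forall r(\rhd(m\Downarrow\mathit{abs}\,r)\supset\rhd(m\leadsto^*\mathit{abs}\,r))$$ $$\forall m\forall r(\rhd(m\leadsto^*\mathit{abs}\,r)\supset\rhd(m\Downarrow\mathit{abs}\,r))$$ Subject reduction: $$\forall m\forall n(\rhd(m\Downarrow n)\supset\forall t(\rhd(\mathit{typeof}\,m\,t)\supset\rhd(\mathit{typeof}\,n\,t)))$$ $$\forall m\forall n(\rhd(m\leadsto n)\supset\forall t(\rhd(\mathit{typeof}\,m\,t)\supset\rhd(\mathit{typeof}\,n\,t)))$$ $$\forall m\forall n(\rhd(m\leadsto^* n)\supset\forall t(\rhd(\mathit{typeof}\,m\,t)\supset\rhd(\mathit{typeof}\,n\,t)))$$ -/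

import Mathlib

namespace FOLDN

/-! ## Types, variables and constants -/

/-- Primitive types (other than the type of formulas): natural numbers, terms of the object
logic, and atoms, propositions and lists of atoms of the object logic. -/
inductive Base : Type
  | nt | i | atm | prp | atmlst

/-- Simple types not containing the type of formulas. -/
inductive Ty : Type
  | base (b : Base)
  | fn (a b : Ty)

abbrev nt : Ty := .base .nt
abbrev ι : Ty := .base .i
abbrev atm : Ty := .base .atm
abbrev prp : Ty := .base .prp
abbrev atmlst : Ty := .base .atmlst

infixr:60 " →ₜ " => Ty.fn

/-- A context lists the types of the variables that may occur free. -/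
abbrev Ctx : Type := List Ty

/-- Typed de Bruijn variables: positions in a context. -/
inductive Var : Ctx → Ty → Type
  | z {Γ : Ctx} {a : Ty} : Var (a :: Γ) a
  | s {Γ : Ctx} {a b : Ty} (x : Var Γ a) : Var (b :: Γ) a

/-- The term constants with their types. -/
inductive Const : Ty → Type
  | zero : Const nt
  | succ : Const (nt →ₜ nt)
  | nil : Const atmlst
  | cons : Const (atm →ₜ atmlst →ₜ atmlst)
  /-- the coercion from atoms to propositions -/
  | atom : Const (atm →ₜ prp)
  | tt : Const prp
  | conj : Const (prp →ₜ prp →ₜ prp)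
  | impl : Const (atm →ₜ prp →ₜ prp)
  /-- object-level universal quantification at type `i` -/
  | forallI : Const ((ι →ₜ prp) →ₜ prp)
  | abs : Const ((ι →ₜ ι) →ₜ ι)
  | app : Const (ι →ₜ ι →ₜ ι)
  | gnd : Const ι
  | arr : Const (ι →ₜ ι →ₜ ι)
  | typeof : Const (ι →ₜ ι →ₜ atm)
  /-- big-step evaluation `⇓` -/
  | natsem : Const (ι →ₜ ι →ₜ atm)
  /-- one-step evaluation `⇝` -/
  | transone : Const (ι →ₜ ι →ₜ atm)
  /-- multi-step evaluation `⇝*` -/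
  | transsem : Const (ι →ₜ ι →ₜ atm)

/-! ## Simply typed λ-terms -/

/-- Simply typed λ-terms before βη-identification. -/
inductive Raw : Ctx → Ty → Type
  | var {Γ : Ctx} {a : Ty} (x : Var Γ a) : Raw Γ a
  | const {Γ : Ctx} {a : Ty} (c : Const a) : Raw Γ a
  | lam {Γ : Ctx} {a b : Ty} (t : Raw (a :: Γ) b) : Raw Γ (a →ₜ b)
  | app {Γ : Ctx} {a b : Ty} (t : Raw Γ (a →ₜ b)) (u : Raw Γ a) : Raw Γ b

abbrev Ren (Γ Δ : Ctx) : Type := ∀ a : Ty, Var Γ a → Var Δ a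

abbrev RawSubst (Γ Δ : Ctx) : Type := ∀ a : Ty, Var Γ a → Raw Δ a

def Ren.lift {Γ Δ : Ctx} (ρ : Ren Γ Δ) {b : Ty} : Ren (b :: Γ) (b :: Δ)
  | _, .z => .z
  | _, .s x => .s (ρ _ x)

def Ren.wk {Γ : Ctx} {b : Ty} : Ren Γ (b :: Γ) := fun _ x => .s x

def Raw.rename {Γ Δ : Ctx} {a : Ty} (ρ : Ren Γ Δ) : Raw Γ a → Raw Δ a
  | .var x => .var (ρ _ x)
  | .const c => .const c
  | .lam t => .lam (t.rename ρ.lift)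
  | .app t u => .app (t.rename ρ) (u.rename ρ)

def RawSubst.lift {Γ Δ : Ctx} (σ : RawSubst Γ Δ) {b : Ty} : RawSubst (b :: Γ) (b :: Δ)
  | _, .z => .var .z
  | _, .s x => (σ _ x).rename Ren.wk

/-- Simultaneous capture-avoiding substitution. -/
def Raw.subst {Γ Δ : Ctx} {a : Ty} (σ : RawSubst Γ Δ) : Raw Γ a → Raw Δ a
  | .var x => σ _ x
  | .const c => .const c
  | .lam t => .lam (t.subst σ.lift)
  | .app t u => .app (t.subst σ) (u.subst σ)

def RawSubst.single {Γ : Ctx} {b : Ty} (u : Raw Γ b) : RawSubst (b :: Γ) Γ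
  | _, .z => u
  | _, .s x => .var x

/-- βη-conversion. -/
inductive Conv : ∀ {Γ : Ctx} {a : Ty}, Raw Γ a → Raw Γ a → Prop
  | refl {Γ : Ctx} {a : Ty} (t : Raw Γ a) : Conv t t
  | symm {Γ : Ctx} {a : Ty} {t u : Raw Γ a} : Conv t u → Conv u t
  | trans {Γ : Ctx} {a : Ty} {t u v : Raw Γ a} : Conv t u → Conv u v → Conv t v
  | app {Γ : Ctx} {a b : Ty} {t t' : Raw Γ (a →ₜ b)} {u u' : Raw Γ a} :
      Conv t t' → Conv u u' → Conv (.app t u) (.app t' u')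
  | lam {Γ : Ctx} {a b : Ty} {t t' : Raw (a :: Γ) b} : Conv t t' → Conv (.lam t) (.lam t')
  | beta {Γ : Ctx} {a b : Ty} (t : Raw (a :: Γ) b) (u : Raw Γ a) :
      Conv (.app (.lam t) u) (t.subst (.single u))
  | eta {Γ : Ctx} {a b : Ty} (t : Raw Γ (a →ₜ b)) :
      Conv (.lam (.app (t.rename Ren.wk) (.var .z))) t

theorem Raw.rename_rename {Γ : Ctx} {a : Ty} (t : Raw Γ a) : ∀ {Δ Θ : Ctx}
    (ρ : Ren Γ Δ) (ρ' : Ren Δ Θ),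
    (t.rename ρ).rename ρ' = t.rename (fun b x => ρ' b (ρ b x)) := by
  induction t with
  | var x => intros; rfl
  | const c => intros; rfl
  | lam t ih =>
    intro Δ Θ ρ ρ'
    simp only [Raw.rename, ih]
    congr 2; funext b x; cases x <;> rfl
  | app t u iht ihu => intro Δ Θ ρ ρ'; simp only [Raw.rename, iht, ihu]

theorem Raw.subst_rename {Γ : Ctx} {a : Ty} (t : Raw Γ a) : ∀ {Δ Θ : Ctx}
    (ρ : Ren Γ Δ) (σ : RawSubst Δ Θ),
    (t.rename ρ).subst σ = t.subst (fun b x => σ b (ρ b x)) := by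
  induction t with
  | var x => intros; rfl
  | const c => intros; rfl
  | lam t ih =>
    intro Δ Θ ρ σ
    simp only [Raw.rename, Raw.subst, ih]
    congr 2; funext b x; cases x <;> rfl
  | app t u iht ihu => intro Δ Θ ρ σ; simp only [Raw.rename, Raw.subst, iht, ihu]

theorem Raw.rename_subst {Γ : Ctx} {a : Ty} (t : Raw Γ a) : ∀ {Δ Θ : Ctx}
    (σ : RawSubst Γ Δ) (ρ : Ren Δ Θ),
    (t.subst σ).rename ρ = t.subst (fun b x => (σ b x).rename ρ) := by
  induction t with
  | var x => intros; rfl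
  | const c => intros; rfl
  | lam t ih =>
    intro Δ Θ σ ρ
    simp only [Raw.rename, Raw.subst, ih]
    congr 2; funext b x
    cases x with
    | z => rfl
    | s x => simp only [RawSubst.lift, Raw.rename_rename]; rfl
  | app t u iht ihu => intro Δ Θ σ ρ; simp only [Raw.rename, Raw.subst, iht, ihu]

theorem Raw.subst_subst {Γ : Ctx} {a : Ty} (t : Raw Γ a) : ∀ {Δ Θ : Ctx}
    (σ : RawSubst Γ Δ) (σ' : RawSubst Δ Θ),
    (t.subst σ).subst σ' = t.subst (fun b x => (σ b x).subst σ') := by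
  induction t with
  | var x => intros; rfl
  | const c => intros; rfl
  | lam t ih =>
    intro Δ Θ σ σ'
    simp only [Raw.subst, ih]
    congr 2; funext b x
    cases x with
    | z => rfl
    | s x => simp only [RawSubst.lift, Raw.subst_rename, Raw.rename_subst]; rfl
  | app t u iht ihu => intro Δ Θ σ σ'; simp only [Raw.subst, iht, ihu]

theorem Raw.subst_var {Γ : Ctx} {a : Ty} (t : Raw Γ a) : t.subst (fun _ x => .var x) = t := by
  induction t with
  | var x => rfl
  | const c => rfl
  | @lam Γ a b t ih =>
    simp only [Raw.subst]
    congr 1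
    refine Eq.trans ?_ ih
    congr 1; funext b x; cases x <;> rfl
  | app t u iht ihu => simp only [Raw.subst, iht, ihu]

theorem Conv.rename {Γ : Ctx} {a : Ty} {t u : Raw Γ a} (h : Conv t u) :
    ∀ {Δ : Ctx} (ρ : Ren Γ Δ), Conv (t.rename ρ) (u.rename ρ) := by
  induction h with
  | refl t => exact fun ρ => .refl _
  | symm _ ih => exact fun ρ => .symm (ih ρ)
  | trans _ _ ih ih' => exact fun ρ => .trans (ih ρ) (ih' ρ)
  | app _ _ ih ih' => exact fun ρ => .app (ih ρ) (ih' ρ)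
  | lam _ ih => exact fun ρ => .lam (ih _)
  | beta t u =>
    intro Δ ρ
    have h := Conv.beta (t.rename ρ.lift) (u.rename ρ)
    rw [Raw.subst_rename] at h
    rw [Raw.rename_subst]
    refine cast (congrArg (Conv _) (congrArg (fun τ => Raw.subst τ t) ?_)) h
    funext b x; cases x <;> rfl
  | eta t =>
    intro Δ ρ
    have h := Conv.eta (t.rename ρ)
    rw [Raw.rename_rename] at h
    simp only [Raw.rename, Raw.rename_rename]
    exact h

theorem Conv.subst {Γ : Ctx} {a : Ty} {t u : Raw Γ a} (h : Conv t u) :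
    ∀ {Δ : Ctx} (σ : RawSubst Γ Δ), Conv (t.subst σ) (u.subst σ) := by
  induction h with
  | refl t => exact fun σ => .refl _
  | symm _ ih => exact fun σ => .symm (ih σ)
  | trans _ _ ih ih' => exact fun σ => .trans (ih σ) (ih' σ)
  | app _ _ ih ih' => exact fun σ => .app (ih σ) (ih' σ)
  | lam _ ih => exact fun σ => .lam (ih _)
  | beta t u =>
    intro Δ σ
    have h := Conv.beta (t.subst σ.lift) (u.subst σ)
    rw [Raw.subst_subst] at h
    rw [Raw.subst_subst]
    refine cast (congrArg (Conv _) (congrArg (fun τ => Raw.subst τ t) ?_)) h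
    funext b x
    cases x with
    | z => rfl
    | s x =>
      simp only [RawSubst.lift, RawSubst.single, Raw.subst_rename, Raw.subst]
      exact Raw.subst_var _
  | eta t =>
    intro Δ σ
    have h := Conv.eta (t.subst σ)
    rw [Raw.rename_subst] at h
    simp only [Raw.subst, Raw.subst_rename]
    exact h

theorem Conv.subst_congr {Γ : Ctx} {a : Ty} (t : Raw Γ a) : ∀ {Δ : Ctx} {σ σ' : RawSubst Γ Δ},
    (∀ b x, Conv (σ b x) (σ' b x)) → Conv (t.subst σ) (t.subst σ') := by
  induction t with
  | var x => exact fun h => h _ x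
  | const c => exact fun _ => .refl _
  | lam t ih =>
    intro Δ σ σ' h
    refine .lam (ih fun b x => ?_)
    cases x with
    | z => exact .refl _
    | s x => exact (h _ x).rename _
  | app t u iht ihu => exact fun h => .app (iht h) (ihu h)

instance Raw.setoid (Γ : Ctx) (a : Ty) : Setoid (Raw Γ a) :=
  ⟨Conv, Conv.refl, Conv.symm, Conv.trans⟩

/-- Terms: simply typed λ-terms, identified up to α-, β- and η-conversion. -/
def Tm (Γ : Ctx) (a : Ty) : Type := Quotient (Raw.setoid Γ a)

namespace Tm

def mk {Γ : Ctx} {a : Ty} (t : Raw Γ a) : Tm Γ a := Quotient.mk _ t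

def var {Γ : Ctx} {a : Ty} (x : Var Γ a) : Tm Γ a := mk (.var x)

def const {Γ : Ctx} {a : Ty} (c : Const a) : Tm Γ a := mk (.const c)

def lam {Γ : Ctx} {a b : Ty} : Tm (a :: Γ) b → Tm Γ (a →ₜ b) :=
  Quotient.map Raw.lam fun _ _ h => Conv.lam h

def app {Γ : Ctx} {a b : Ty} : Tm Γ (a →ₜ b) → Tm Γ a → Tm Γ b :=
  Quotient.map₂ Raw.app fun _ _ h _ _ h' => Conv.app h h'

def rename {Γ Δ : Ctx} {a : Ty} (ρ : Ren Γ Δ) : Tm Γ a → Tm Δ a :=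
  Quotient.map (Raw.rename ρ) fun _ _ h => Conv.rename h ρ

/-- Weakening by one variable. -/
def wk {Γ : Ctx} {a b : Ty} (t : Tm Γ a) : Tm (b :: Γ) a := t.rename Ren.wk

end Tm

/-- Substitutions of terms for variables. -/
abbrev Subst (Γ Δ : Ctx) : Type := ∀ a : Ty, Var Γ a → Tm Δ a

/-- Application of a substitution to a term. The result does not depend on the chosen
representatives, see `Tm.subst_mk`. -/
noncomputable def Tm.subst {Γ Δ : Ctx} {a : Ty} (θ : Subst Γ Δ) : Tm Γ a → Tm Δ a :=
  Quotient.map (Raw.subst fun b x => Quotient.out (θ b x)) fun _ _ h => Conv.subst h _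

theorem Tm.subst_mk {Γ Δ : Ctx} {a : Ty} (σ : RawSubst Γ Δ) (t : Raw Γ a) :
    (Tm.mk t).subst (fun b x => Tm.mk (σ b x)) = Tm.mk (t.subst σ) :=
  Quotient.sound (Conv.subst_congr t fun b x => Quotient.mk_out (σ b x))

namespace Subst

def lift {Γ Δ : Ctx} (θ : Subst Γ Δ) {b : Ty} : Subst (b :: Γ) (b :: Δ)
  | _, .z => .var .z
  | _, .s x => (θ _ x).wk

/-- `θ.comp σ` applies first `θ`, then `σ`. -/
noncomputable def comp {Γ Δ Θ : Ctx} (θ : Subst Γ Δ) (σ : Subst Δ Θ) : Subst Γ Θ :=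
  fun a x => (θ a x).subst σ

/-- The weakening substitution. -/
def weak {Γ : Ctx} {b : Ty} : Subst Γ (b :: Γ) := fun _ x => .var (.s x)

/-- Replace the most recent variable by `t`. -/
def single {Γ : Ctx} {b : Ty} (t : Tm Γ b) : Subst (b :: Γ) Γ
  | _, .z => t
  | _, .s x => .var x

/-- Replace the most recent variable `j` by `s j`. -/
def succ {Γ : Ctx} : Subst (nt :: Γ) (nt :: Γ)
  | _, .z => .app (.const .succ) (.var .z)
  | _, .s x => .var (.s x)

end Subst

/-! ## Predicates and formulas -/

/-- The predicate constants with their argument types; `nat` is not among them, since it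
is not a defined predicate and has its own inference rules. -/
inductive Pred : List Ty → Type
  | eq : Pred [nt, nt]
  | sum : Pred [nt, nt, nt]
  | lt : Pred [nt, nt]
  | le : Pred [nt, nt]
  | length : Pred [atmlst, nt]
  | list : Pred [atmlst]
  | element : Pred [atm, atmlst]
  | split : Pred [atmlst, atmlst, atmlst]
  | permute : Pred [atmlst, atmlst]
  | seq : Pred [nt, atmlst, prp]
  | prog : Pred [atm, prp]
  /-- the predicate `≡` -/
  | same : Pred [ι, ι]

/-- Lists of arguments. -/
inductive Args (Γ : Ctx) : List Ty → Type
  | nil : Args Γ []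
  | cons {a : Ty} {as : List Ty} (t : Tm Γ a) (ts : Args Γ as) : Args Γ (a :: as)

noncomputable def Args.subst {Γ Δ : Ctx} (θ : Subst Γ Δ) : ∀ {as : List Ty}, Args Γ as → Args Δ as
  | _, .nil => .nil
  | _, .cons t ts => .cons (t.subst θ) (ts.subst θ)

/-- Formulas of the meta-logic with free variables in a context. -/
inductive Form : Ctx → Type
  | bot {Γ : Ctx} : Form Γ
  | top {Γ : Ctx} : Form Γ
  | and {Γ : Ctx} (B C : Form Γ) : Form Γ
  | or {Γ : Ctx} (B C : Form Γ) : Form Γ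
  | imp {Γ : Ctx} (B C : Form Γ) : Form Γ
  | all {Γ : Ctx} (a : Ty) (B : Form (a :: Γ)) : Form Γ
  | ex {Γ : Ctx} (a : Ty) (B : Form (a :: Γ)) : Form Γ
  | nat {Γ : Ctx} (t : Tm Γ nt) : Form Γ
  | pred {Γ : Ctx} {as : List Ty} (p : Pred as) (ts : Args Γ as) : Form Γ

infixr:35 " ∧ₘ " => Form.and
infixr:25 " ⊃ₘ " => Form.imp

namespace Form

noncomputable def subst : ∀ {Γ Δ : Ctx}, Subst Γ Δ → Form Γ → Form Δ
  | _, _, _, .bot => .bot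
  | _, _, _, .top => .top
  | _, _, θ, .and B C => .and (B.subst θ) (C.subst θ)
  | _, _, θ, .or B C => .or (B.subst θ) (C.subst θ)
  | _, _, θ, .imp B C => .imp (B.subst θ) (C.subst θ)
  | _, _, θ, .all a B => .all a (B.subst θ.lift)
  | _, _, θ, .ex a B => .ex a (B.subst θ.lift)
  | _, _, θ, .nat t => .nat (t.subst θ)
  | _, _, θ, .pred p ts => .pred p (ts.subst θ)

/-- Weakening by one variable. -/
noncomputable def wk {Γ : Ctx} {b : Ty} (B : Form Γ) : Form (b :: Γ) := B.subst Subst.weak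

/-- `B[t/x]` for the most recent variable `x`. -/
noncomputable def inst {Γ : Ctx} {b : Ty} (B : Form (b :: Γ)) (t : Tm Γ b) : Form Γ :=
  B.subst (Subst.single t)

/-- Atomic formulas. -/
def IsAtomic {Γ : Ctx} : Form Γ → Prop
  | .nat _ => True
  | .pred _ _ => True
  | _ => False

end Form

/-! ## Definitions -/

/-- The variable `x` occurs free in a λ-term. -/
def Raw.Occurs : ∀ {Γ : Ctx} {a b : Ty}, Var Γ b → Raw Γ a → Prop
  | Γ, a, b, x, .var y => (⟨b, x⟩ : Σ c, Var Γ c) = ⟨a, y⟩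
  | _, _, _, _, .const _ => False
  | _, _, _, x, .lam t => t.Occurs (.s x)
  | _, _, _, x, .app t u => t.Occurs x ∨ u.Occurs x

/-- The variable `x` is free in the term `t`: it occurs free in every representative of `t`
(equivalently, in its normal form). -/
def Tm.Free {Γ : Ctx} {a b : Ty} (x : Var Γ b) (t : Tm Γ a) : Prop :=
  ∀ r : Raw Γ a, Tm.mk r = t → r.Occurs x

def Args.Free {Γ : Ctx} {b : Ty} (x : Var Γ b) : ∀ {as : List Ty}, Args Γ as → Prop
  | _, .nil => False
  | _, .cons t ts => t.Free x ∨ ts.Free x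

def Form.Free : ∀ {Γ : Ctx} {b : Ty}, Var Γ b → Form Γ → Prop
  | _, _, _, .bot => False
  | _, _, _, .top => False
  | _, _, x, .and B C => B.Free x ∨ C.Free x
  | _, _, x, .or B C => B.Free x ∨ C.Free x
  | _, _, x, .imp B C => B.Free x ∨ C.Free x
  | _, _, x, .all _ B => B.Free (.s x)
  | _, _, x, .ex _ B => B.Free (.s x)
  | _, _, x, .nat t => t.Free x
  | _, _, x, .pred _ ts => ts.Free x

/-- An assignment of levels to the predicates. -/
structure Levels where
  nat : ℕ
  pred : ∀ {as : List Ty}, Pred as → ℕ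

/-- The level of a formula. -/
def Form.level (ℓ : Levels) : ∀ {Γ : Ctx}, Form Γ → ℕ
  | _, .bot => 0
  | _, .top => 0
  | _, .and B C => max (B.level ℓ) (C.level ℓ)
  | _, .or B C => max (B.level ℓ) (C.level ℓ)
  | _, .imp B C => max (B.level ℓ + 1) (C.level ℓ)
  | _, .all _ B => B.level ℓ
  | _, .ex _ B => B.level ℓ
  | _, .nat _ => ℓ.nat
  | _, .pred p _ => ℓ.pred p

/-- Definitional clauses `∀ x̄ [p t̄ ≜ B]`; `vars` lists the types of the variables `x̄`. -/
structure Clause where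
  vars : Ctx
  {arity : List Ty}
  pred : Pred arity
  args : Args vars arity
  body : Form vars

/-- The head of a clause. -/
def Clause.head (c : Clause) : Form c.vars := .pred c.pred c.args

/-- A set of clauses is a definition if free variables of bodies are free in the heads, and
levels can be assigned to the predicates so that no body has a higher level than its head. -/
structure Definition where
  clauses : Set Clause
  free_head : ∀ c ∈ clauses, ∀ (a : Ty) (x : Var c.vars a), c.body.Free x → c.head.Free x
  stratified : ∃ ℓ : Levels, ∀ c ∈ clauses, c.body.level ℓ ≤ c.head.level ℓ

/-! ## The derivation rules -/

/-- Unifiers of two formulas whose free variables are taken to be disjoint: a substitution for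
the variables of either formula, with a common range, that makes the formulas equal. -/
structure Unifier {Γ Δ : Ctx} (A : Form Γ) (H : Form Δ) where
  cod : Ctx
  left : Subst Γ cod
  right : Subst Δ cod
  eq : A.subst left = H.subst right

/-- Complete sets of unifiers: every unifier is an instance of one in the set. -/
def IsCSU {Γ Δ : Ctx} {A : Form Γ} {H : Form Δ} (S : Set (Unifier A H)) : Prop :=
  ∀ ρ : Unifier A H, ∃ θ ∈ S, ∃ σ : Subst θ.cod ρ.cod,
    ρ.left = θ.left.comp σ ∧ ρ.right = θ.right.comp σ

/-- `Der D V Γ B`: the sequent `Γ ⟶ B`, whose free variables are in the context `V`, is derivable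
with the definition `D`. A new eigenvariable extends the context by one variable, and
the formulas of the lower sequent are weakened accordingly. -/
inductive Der (D : Definition) : ∀ V : Ctx, Multiset (Form V) → Form V → Prop
  | botL {V : Ctx} {Γ : Multiset (Form V)} {B : Form V} : Der D V (.bot ::ₘ Γ) B
  | topR {V : Ctx} {Γ : Multiset (Form V)} : Der D V Γ .top
  | andL₁ {V : Ctx} {Γ : Multiset (Form V)} {B C E : Form V} :
      Der D V (B ::ₘ Γ) E → Der D V (.and B C ::ₘ Γ) E
  | andL₂ {V : Ctx} {Γ : Multiset (Form V)} {B C E : Form V} :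
      Der D V (C ::ₘ Γ) E → Der D V (.and B C ::ₘ Γ) E
  | andR {V : Ctx} {Γ : Multiset (Form V)} {B C : Form V} :
      Der D V Γ B → Der D V Γ C → Der D V Γ (.and B C)
  | orL {V : Ctx} {Γ : Multiset (Form V)} {B C E : Form V} :
      Der D V (B ::ₘ Γ) E → Der D V (C ::ₘ Γ) E → Der D V (.or B C ::ₘ Γ) E
  | orR₁ {V : Ctx} {Γ : Multiset (Form V)} {B C : Form V} :
      Der D V Γ B → Der D V Γ (.or B C)
  | orR₂ {V : Ctx} {Γ : Multiset (Form V)} {B C : Form V} :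
      Der D V Γ C → Der D V Γ (.or B C)
  | impL {V : Ctx} {Γ : Multiset (Form V)} {B C E : Form V} :
      Der D V Γ B → Der D V (C ::ₘ Γ) E → Der D V (.imp B C ::ₘ Γ) E
  | impR {V : Ctx} {Γ : Multiset (Form V)} {B C : Form V} :
      Der D V (B ::ₘ Γ) C → Der D V Γ (.imp B C)
  | allL {V : Ctx} {Γ : Multiset (Form V)} {a : Ty} {B : Form (a :: V)} {C : Form V} (t : Tm V a) :
      Der D V (B.inst t ::ₘ Γ) C → Der D V (.all a B ::ₘ Γ) C
  | allR {V : Ctx} {Γ : Multiset (Form V)} {a : Ty} {B : Form (a :: V)} :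
      Der D (a :: V) (Γ.map Form.wk) B → Der D V Γ (.all a B)
  | exL {V : Ctx} {Γ : Multiset (Form V)} {a : Ty} {B : Form (a :: V)} {C : Form V} :
      Der D (a :: V) (B ::ₘ Γ.map Form.wk) C.wk → Der D V (.ex a B ::ₘ Γ) C
  | exR {V : Ctx} {Γ : Multiset (Form V)} {a : Ty} {B : Form (a :: V)} (t : Tm V a) :
      Der D V Γ (B.inst t) → Der D V Γ (.ex a B)
  | init {V : Ctx} {Γ : Multiset (Form V)} {A : Form V} : A.IsAtomic → Der D V (A ::ₘ Γ) A
  | contr {V : Ctx} {Γ : Multiset (Form V)} {B C : Form V} :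
      Der D V (B ::ₘ B ::ₘ Γ) C → Der D V (B ::ₘ Γ) C
  | cut {V : Ctx} {Δ Γ : Multiset (Form V)} {B C : Form V} :
      Der D V Δ B → Der D V (B ::ₘ Γ) C → Der D V (Δ + Γ) C
  | natR_zero {V : Ctx} {Γ : Multiset (Form V)} : Der D V Γ (.nat (.const .zero))
  | natR_succ {V : Ctx} {Γ : Multiset (Form V)} {t : Tm V nt} :
      Der D V Γ (.nat t) → Der D V Γ (.nat (.app (.const .succ) t))
  /-- induction with the invariant `B`; in the second premise the most recent variable is the
  eigenvariable `j`, and the right-hand side is `B (s j)` -/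
  | natL {V : Ctx} {Γ : Multiset (Form V)} {C : Form V} {t : Tm V nt} (B : Form (nt :: V)) :
      Der D V 0 (B.inst (.const .zero)) →
      Der D (nt :: V) {B} (B.subst Subst.succ) →
      Der D V (B.inst t ::ₘ Γ) C → Der D V (.nat t ::ₘ Γ) C
  | defR {V : Ctx} {Γ : Multiset (Form V)} {as : List Ty} {p : Pred as} {us : Args V as}
      (c : Clause) (_ : c ∈ D.clauses) (θ : Subst c.vars V) :
      Form.pred p us = c.head.subst θ → Der D V Γ (c.body.subst θ) → Der D V Γ (.pred p us)
  /-- definitional reflection: one premise for every clause and every element of some complete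
  set of unifiers of the atom with the head of the clause -/
  | defL {V : Ctx} {Γ : Multiset (Form V)} {C : Form V} {as : List Ty} {p : Pred as} {us : Args V as}
      (S : ∀ c : Clause, Set (Unifier (Form.pred p us) c.head)) :
      (∀ c ∈ D.clauses, IsCSU (S c)) →
      (∀ c ∈ D.clauses, ∀ θ ∈ S c,
        Der D θ.cod (c.body.subst θ.right ::ₘ Γ.map (Form.subst θ.left)) (C.subst θ.left)) →
      Der D V (.pred p us ::ₘ Γ) C

/-- A closed formula is derivable with the definition `D`. -/
def Derivable (D : Definition) (B : Form []) : Prop := Der D [] 0 B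

/-! ## Notation for terms and atomic formulas -/

section
variable {Γ : Ctx}

def zero : Tm Γ nt := .const .zero
def succ (t : Tm Γ nt) : Tm Γ nt := .app (.const .succ) t
def nil : Tm Γ atmlst := .const .nil
def cons (x : Tm Γ atm) (l : Tm Γ atmlst) : Tm Γ atmlst := .app (.app (.const .cons) x) l
def atom (x : Tm Γ atm) : Tm Γ prp := .app (.const .atom) x
def tt : Tm Γ prp := .const .tt
def conj (b c : Tm Γ prp) : Tm Γ prp := .app (.app (.const .conj) b) c
def impl (x : Tm Γ atm) (b : Tm Γ prp) : Tm Γ prp := .app (.app (.const .impl) x) b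
def forallI (b : Tm Γ (ι →ₜ prp)) : Tm Γ prp := .app (.const .forallI) b
def abs (r : Tm Γ (ι →ₜ ι)) : Tm Γ ι := .app (.const .abs) r
def app (m n : Tm Γ ι) : Tm Γ ι := .app (.app (.const .app) m) n
def gnd : Tm Γ ι := .const .gnd
def arr (t u : Tm Γ ι) : Tm Γ ι := .app (.app (.const .arr) t) u
def typeof (m t : Tm Γ ι) : Tm Γ atm := .app (.app (.const .typeof) m) t
def natsem (m n : Tm Γ ι) : Tm Γ atm := .app (.app (.const .natsem) m) n
def transone (m n : Tm Γ ι) : Tm Γ atm := .app (.app (.const .transone) m) n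
def transsem (m n : Tm Γ ι) : Tm Γ atm := .app (.app (.const .transsem) m) n

abbrev Args.one {a : Ty} (t : Tm Γ a) : Args Γ [a] := .cons t .nil
abbrev Args.two {a b : Ty} (t : Tm Γ a) (u : Tm Γ b) : Args Γ [a, b] := .cons t (.one u)
abbrev Args.three {a b c : Ty} (t : Tm Γ a) (u : Tm Γ b) (v : Tm Γ c) : Args Γ [a, b, c] :=
  .cons t (.two u v)

def lt (t u : Tm Γ nt) : Form Γ := .pred .lt (.two t u)
def sum (t u v : Tm Γ nt) : Form Γ := .pred .sum (.three t u v)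
def length (l : Tm Γ atmlst) (t : Tm Γ nt) : Form Γ := .pred .length (.two l t)
def element (x : Tm Γ atm) (l : Tm Γ atmlst) : Form Γ := .pred .element (.two x l)
def split (l l₁ l₂ : Tm Γ atmlst) : Form Γ := .pred .split (.three l l₁ l₂)
def permute (l₁ l₂ : Tm Γ atmlst) : Form Γ := .pred .permute (.two l₁ l₂)
def seq (t : Tm Γ nt) (l : Tm Γ atmlst) (b : Tm Γ prp) : Form Γ := .pred .seq (.three t l b)
def prog (x : Tm Γ atm) (b : Tm Γ prp) : Form Γ := .pred .prog (.two x b)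
def same (m n : Tm Γ ι) : Form Γ := .pred .same (.two m n)

/-- `L ⊳ B`, that is, `∃ i (nat i ∧ seq i L B)`. -/
def prvv (l : Tm Γ atmlst) (b : Tm Γ prp) : Form Γ :=
  .ex nt (.nat (.var .z) ∧ₘ seq (.var .z) l.wk b.wk)

/-- `⊳ ⟨A⟩`: the object-level atom `A` is provable from no assumptions. -/
def prv (x : Tm Γ atm) : Form Γ := prvv nil (atom x)

end

/-- The variables of a context, counted from the most recent one. -/
abbrev v0 {Γ : Ctx} {a : Ty} : Tm (a :: Γ) a := .var .z
abbrev v1 {Γ : Ctx} {a b : Ty} : Tm (b :: a :: Γ) a := .var (.s .z)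
abbrev v2 {Γ : Ctx} {a b c : Ty} : Tm (c :: b :: a :: Γ) a := .var (.s (.s .z))
abbrev v3 {Γ : Ctx} {a b c d : Ty} : Tm (d :: c :: b :: a :: Γ) a := .var (.s (.s (.s .z)))

/-! ## The clauses -/

/-- Clauses for predicates over natural numbers. -/
def clausesNat : List Clause :=
  [ -- I = I
    ⟨[nt], .eq, .two v0 v0, .top⟩,
    -- variables: J
    ⟨[nt], .sum, .three zero v0 v0, .nat v0⟩,
    -- variables: K, J, I
    ⟨[nt, nt, nt], .sum, .three (succ v2) v1 (succ v0), sum v2 v1 v0⟩,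
    -- variables: J
    ⟨[nt], .lt, .two zero (succ v0), .nat v0⟩,
    -- variables: J, I
    ⟨[nt, nt], .lt, .two (succ v1) (succ v0), lt v1 v0⟩,
    ⟨[nt], .le, .two v0 v0, .top⟩,
    -- variables: J, I
    ⟨[nt, nt], .le, .two v1 v0, lt v1 v0⟩ ]

/-- Clauses for predicates over lists of atoms. -/
def clausesList : List Clause :=
  [ ⟨[], .length, .two nil zero, .top⟩,
    -- variables: I, L, X
    ⟨[nt, atmlst, atm], .length, .two (cons v2 v1) (succ v0), length v1 v0⟩,
    -- variables: L
    ⟨[atmlst], .list, .one v0, .ex nt (.nat v0 ∧ₘ length v1 v0)⟩,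
    -- variables: L, X
    ⟨[atmlst, atm], .element, .two v1 (cons v1 v0), .top⟩,
    -- variables: L, Y, X
    ⟨[atmlst, atm, atm], .element, .two v2 (cons v1 v0), element v2 v0⟩,
    ⟨[], .split, .three nil nil nil, .top⟩,
    -- variables: L₃, L₂, L₁, X
    ⟨[atmlst, atmlst, atmlst, atm], .split, .three (cons v3 v2) (cons v3 v1) v0, split v2 v1 v0⟩,
    ⟨[atmlst, atmlst, atmlst, atm], .split, .three (cons v3 v2) v1 (cons v3 v0), split v2 v1 v0⟩,
    ⟨[], .permute, .two nil nil, .top⟩,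
    -- variables: L₂, L₁, X; the bound variable of the body is `v0` there
    ⟨[atmlst, atmlst, atm], .permute, .two (cons v2 v1) v0,
      .ex atmlst (split v1 (cons v3 nil) v0 ∧ₘ permute v2 v0)⟩ ]

/-- Clauses for the intuitionistic object logic. -/
def clausesIntuit : List Clause :=
  [ -- variables: A, L, A', I
    ⟨[atm, atmlst, atm, nt], .seq, .three v3 (cons v2 v1) (atom v0), element v0 (cons v2 v1)⟩,
    -- variables: L, I
    ⟨[atmlst, nt], .seq, .three v1 v0 tt, .top⟩,
    -- variables: C, B, L, I
    ⟨[prp, prp, atmlst, nt], .seq, .three (succ v3) v2 (conj v1 v0), seq v3 v2 v1 ∧ₘ seq v3 v2 v0⟩,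
    -- variables: B, A, L, I
    ⟨[prp, atm, atmlst, nt], .seq, .three (succ v3) v2 (impl v1 v0), seq v3 (cons v1 v2) v0⟩,
    -- variables: B, L, I; the bound variable of the body is `v0` there
    ⟨[ι →ₜ prp, atmlst, nt], .seq, .three (succ v2) v1 (forallI v0),
      .all ι (seq v3 v2 (.app v1 v0))⟩,
    -- variables: A, L, I; the bound variable of the body is `v0` there
    ⟨[atm, atmlst, nt], .seq, .three (succ v2) v1 (atom v0),
      .ex prp (prog v1 v0 ∧ₘ seq v3 v2 v0)⟩ ]

/-- Clauses `prog A G ≜ ⊤` for typing and call-by-name evaluation of untyped λ-terms. -/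
def clausesLambda : List Clause :=
  [ -- variables: U, T, R; the bound variable of the goal is `v0` there
    ⟨[ι, ι, ι →ₜ ι], .prog, .two (typeof (abs v2) (arr v1 v0))
      (forallI (.lam (impl (typeof v0 v2) (atom (typeof (.app v3 v0) v1))))), .top⟩,
    -- variables: U, T, N, M
    ⟨[ι, ι, ι, ι], .prog, .two (typeof (app v3 v2) v1)
      (conj (atom (typeof v3 (arr v0 v1))) (atom (typeof v2 v0))), .top⟩,
    -- variables: R
    ⟨[ι →ₜ ι], .prog, .two (natsem (abs v0) (abs v0)) tt, .top⟩,
    -- variables: R, V, N, M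
    ⟨[ι →ₜ ι, ι, ι, ι], .prog, .two (natsem (app v3 v2) v1)
      (conj (atom (natsem v3 (abs v0))) (atom (natsem (.app v0 v2) v1))), .top⟩,
    -- variables: M, R
    ⟨[ι, ι →ₜ ι], .prog, .two (transone (app (abs v1) v0) (.app v1 v0)) tt, .top⟩,
    -- variables: M', N, M
    ⟨[ι, ι, ι], .prog, .two (transone (app v2 v1) (app v0 v1)) (atom (transone v2 v0)), .top⟩,
    -- variables: M
    ⟨[ι], .prog, .two (transsem v0 v0) tt, .top⟩,
    -- variables: M', N, M
    ⟨[ι, ι, ι], .prog, .two (transsem v2 v1)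
      (conj (atom (transone v2 v0)) (atom (transsem v0 v1))), .top⟩ ]

/-- The clause `X ≡ X ≜ ⊤`. -/
def clauseSame : Clause := ⟨[ι], .same, .two v0 v0, .top⟩

/-- All the clauses together. -/
def clausesAll : List Clause :=
  clausesNat ++ clausesList ++ clausesIntuit ++ clausesLambda ++ [clauseSame]

/-! ## The clauses form a definition

Free occurrences in the heads are detected by an interpretation of terms in the full type
structure over `ℕ`, which is invariant under conversion. -/

def Ty.Sem : Ty → Type
  | .base _ => ℕ
  | .fn a b => a.Sem → b.Sem

def Const.sem : ∀ {a : Ty}, Const a → a.Sem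
  | _, .zero => (0 : ℕ)
  | _, .succ => fun n : ℕ => n
  | _, .nil => (0 : ℕ)
  | _, .cons => fun m n : ℕ => m + n
  | _, .atom => fun n : ℕ => n
  | _, .tt => (0 : ℕ)
  | _, .conj => fun m n : ℕ => m + n
  | _, .impl => fun m n : ℕ => m + n
  | _, .forallI => fun f : ℕ → ℕ => f 0
  | _, .abs => fun f : ℕ → ℕ => f 0
  | _, .app => fun m n : ℕ => m + n
  | _, .gnd => (0 : ℕ)
  | _, .arr => fun m n : ℕ => m + n
  | _, .typeof => fun m n : ℕ => m + n
  | _, .natsem => fun m n : ℕ => m + n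
  | _, .transone => fun m n : ℕ => m + n
  | _, .transsem => fun m n : ℕ => m + n

abbrev Env (Γ : Ctx) : Type := ∀ a : Ty, Var Γ a → a.Sem

def Env.cons {Γ : Ctx} {b : Ty} (d : b.Sem) (e : Env Γ) : Env (b :: Γ)
  | _, .z => d
  | _, .s x => e _ x

def Raw.sem : ∀ {Γ : Ctx} {a : Ty}, Raw Γ a → Env Γ → a.Sem
  | _, _, .var x, e => e _ x
  | _, _, .const c, _ => c.sem
  | _, _, .lam t, e => fun d => t.sem (e.cons d)
  | _, _, .app t u, e => (t.sem e) (u.sem e)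

theorem Raw.sem_rename {Γ : Ctx} {a : Ty} (t : Raw Γ a) : ∀ {Δ : Ctx} (ρ : Ren Γ Δ) (e : Env Δ),
    (t.rename ρ).sem e = t.sem fun b x => e b (ρ b x) := by
  induction t with
  | var x => intros; rfl
  | const c => intros; rfl
  | lam t ih =>
    intro Δ ρ e
    simp only [Raw.rename, Raw.sem, ih]
    funext d; congr 1; funext b x; cases x <;> rfl
  | app t u iht ihu => intro Δ ρ e; simp only [Raw.rename, Raw.sem, iht, ihu]

theorem Raw.sem_subst {Γ : Ctx} {a : Ty} (t : Raw Γ a) :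
    ∀ {Δ : Ctx} (σ : RawSubst Γ Δ) (e : Env Δ),
    (t.subst σ).sem e = t.sem fun b x => (σ b x).sem e := by
  induction t with
  | var x => intros; rfl
  | const c => intros; rfl
  | lam t ih =>
    intro Δ σ e
    simp only [Raw.subst, Raw.sem, ih]
    funext d; congr 1; funext b x
    cases x with
    | z => rfl
    | s x => simp only [RawSubst.lift, Raw.sem_rename]; rfl
  | app t u iht ihu => intro Δ σ e; simp only [Raw.subst, Raw.sem, iht, ihu]

theorem Conv.sem_eq {Γ : Ctx} {a : Ty} {t u : Raw Γ a} (h : Conv t u) : t.sem = u.sem := by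
  induction h with
  | refl t => rfl
  | symm _ ih => exact ih.symm
  | trans _ _ ih ih' => exact ih.trans ih'
  | app _ _ ih ih' => funext e; simp only [Raw.sem, ih, ih']
  | lam _ ih => funext e d; exact congrFun ih _
  | beta t u =>
    funext e
    simp only [Raw.sem, Raw.sem_subst]
    congr 1; funext b x; cases x <;> rfl
  | eta t => funext e d; simp only [Raw.sem, Raw.sem_rename]; rfl

def Tm.sem {Γ : Ctx} {a : Ty} (t : Tm Γ a) : Env Γ → a.Sem :=
  Quotient.lift Raw.sem (fun _ _ h => Conv.sem_eq h) t

theorem Raw.sem_congr {Γ : Ctx} {a : Ty} (t : Raw Γ a) : ∀ {b : Ty} (x : Var Γ b),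
    ¬ t.Occurs x → ∀ e e' : Env Γ,
    (∀ c y, (⟨b, x⟩ : Σ c, Var Γ c) ≠ ⟨c, y⟩ → e c y = e' c y) → t.sem e = t.sem e' := by
  induction t with
  | var y => intro b x hx e e' h; exact h _ y hx
  | const c => intros; rfl
  | lam t ih =>
    intro b x hx e e' h
    funext d
    refine ih (.s x) hx _ _ fun c y hy => ?_
    cases y with
    | z => rfl
    | s y =>
      refine h c y fun hxy => hy ?_
      cases hxy; rfl
  | app t u iht ihu =>
    intro b x hx e e' h
    simp only [Raw.Occurs, not_or] at hx
    simp only [Raw.sem, iht x hx.1 e e' h, ihu x hx.2 e e' h]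

def Ty.dflt (n : ℕ) : ∀ a : Ty, a.Sem
  | .base _ => n
  | .fn _ b => fun _ => b.dflt n

/-- The environment that is `1` at `x` and `0` elsewhere. -/
def Env.ind {Γ : Ctx} {b : Ty} : Var Γ b → Env Γ
  | .z => Env.cons (Ty.dflt 1 _) fun c _ => c.dflt 0
  | .s x => Env.cons (Ty.dflt 0 _) (Env.ind x)

theorem Env.ind_ne {Γ : Ctx} {b : Ty} (x : Var Γ b) : ∀ (c : Ty) (y : Var Γ c),
    (⟨b, x⟩ : Σ c, Var Γ c) ≠ ⟨c, y⟩ → Env.ind x c y = c.dflt 0 := by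
  induction x with
  | z =>
    intro c y h
    cases y with
    | z => exact absurd rfl h
    | s y => rfl
  | s x ih =>
    intro c y h
    cases y with
    | z => rfl
    | s y =>
      refine ih c y fun hxy => h ?_
      cases hxy; rfl

theorem Tm.free_of_sem {Γ : Ctx} {a b : Ty} (x : Var Γ b) (t : Tm Γ a)
    (h : t.sem (Env.ind x) ≠ t.sem fun c _ => c.dflt 0) : t.Free x := by
  intro r hr
  by_contra hx
  subst hr
  exact h (r.sem_congr x hx _ _ (Env.ind_ne x))

theorem free_head_all : ∀ c ∈ clausesAll, ∀ (a : Ty) (x : Var c.vars a),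
    c.body.Free x → c.head.Free x := by
  simp only [clausesAll, clausesNat, clausesList, clausesIntuit, clausesLambda, clauseSame,
    List.cons_append, List.nil_append, List.forall_mem_cons, List.not_mem_nil]
  repeat' refine And.intro ?_ ?_
  all_goals intro c x h
  all_goals first
    | exact h.elim
    | (rcases x with _ | _ | _ | _ | x <;> first
        | exact Or.inl (Tm.free_of_sem _ _ fun h => Nat.one_ne_zero h)
        | exact Or.inr (Or.inl (Tm.free_of_sem _ _ fun h => Nat.one_ne_zero h))
        | exact Or.inr (Or.inr (Or.inl (Tm.free_of_sem _ _ fun h => Nat.one_ne_zero h)))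
        | cases x)

theorem level_all : ∀ c ∈ clausesAll,
    c.body.level ⟨0, fun _ => 0⟩ ≤ c.head.level ⟨0, fun _ => 0⟩ := by
  simp [clausesAll, clausesNat, clausesList, clausesIntuit, clausesLambda, clauseSame,
    Form.level, Clause.head, lt, sum, length, element, split, permute, seq, prog]

/-- The definition that accumulates the clauses above. -/
def lambdaDefinition : Definition where
  clauses := {c | c ∈ clausesAll}
  free_head := free_head_all
  stratified := ⟨⟨0, fun _ => 0⟩, level_all⟩

/-! ## The properties of the untyped λ-calculus

In each formula the variables bound by the outer quantifiers are, from left to right,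
`v2`, `v1`, `v0` (three quantifiers) or `v1`, `v0` (two quantifiers). -/

/-- `∀ m m₁ m₂ (⊳⟨m ⇓ m₁⟩ ⊃ ⊳⟨m ⇓ m₂⟩ ⊃ m₁ ≡ m₂)` -/
def natsemDet : Form [] :=
  .all ι (.all ι (.all ι
    (prv (natsem v2 v1) ⊃ₘ prv (natsem v2 v0) ⊃ₘ same v1 v0)))

/-- `∀ m m₁ m₂ (⊳⟨m ⇝ m₁⟩ ⊃ ⊳⟨m ⇝ m₂⟩ ⊃ m₁ ≡ m₂)` -/
def transoneDet : Form [] :=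
  .all ι (.all ι (.all ι
    (prv (transone v2 v1) ⊃ₘ prv (transone v2 v0) ⊃ₘ same v1 v0)))

/-- `∀ m r₁ r₂ (⊳⟨m ⇝* abs r₁⟩ ⊃ ⊳⟨m ⇝* abs r₂⟩ ⊃ abs r₁ ≡ abs r₂)` -/
def transsemDet : Form [] :=
  .all ι (.all (ι →ₜ ι) (.all (ι →ₜ ι)
    (prv (transsem v2 (abs v1)) ⊃ₘ prv (transsem v2 (abs v0)) ⊃ₘ same (abs v1) (abs v0))))

/-- `∀ m r (⊳⟨m ⇓ abs r⟩ ⊃ ⊳⟨m ⇝* abs r⟩)` -/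
def natsemToTranssem : Form [] :=
  .all ι (.all (ι →ₜ ι) (prv (natsem v1 (abs v0)) ⊃ₘ prv (transsem v1 (abs v0))))

/-- `∀ m r (⊳⟨m ⇝* abs r⟩ ⊃ ⊳⟨m ⇓ abs r⟩)` -/
def transsemToNatsem : Form [] :=
  .all ι (.all (ι →ₜ ι) (prv (transsem v1 (abs v0)) ⊃ₘ prv (natsem v1 (abs v0))))

/-- `∀ m n (⊳⟨m ⇓ n⟩ ⊃ ∀ t (⊳⟨typeof m t⟩ ⊃ ⊳⟨typeof n t⟩))` -/
def natsemSubjRed : Form [] :=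
  .all ι (.all ι
    (prv (natsem v1 v0) ⊃ₘ .all ι (prv (typeof v2 v0) ⊃ₘ prv (typeof v1 v0))))

/-- `∀ m n (⊳⟨m ⇝ n⟩ ⊃ ∀ t (⊳⟨typeof m t⟩ ⊃ ⊳⟨typeof n t⟩))` -/
def transoneSubjRed : Form [] :=
  .all ι (.all ι
    (prv (transone v1 v0) ⊃ₘ .all ι (prv (typeof v2 v0) ⊃ₘ prv (typeof v1 v0))))

/-- `∀ m n (⊳⟨m ⇝* n⟩ ⊃ ∀ t (⊳⟨typeof m t⟩ ⊃ ⊳⟨typeof n t⟩))` -/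
def transsemSubjRed : Form [] :=
  .all ι (.all ι
    (prv (transsem v1 v0) ⊃ₘ .all ι (prv (typeof v2 v0) ⊃ₘ prv (typeof v1 v0))))

end FOLDN

/-! Derivability is treated as forcing. A world is a context of eigenvariables together with
hypotheses, an extension is a substitution under which the hypotheses become derivable, and a
formula is forced where it is derivable. Closure under substitution, weakening and cut makes forcing
monotone (`Forces.mono`). By `Forces.of_sat`, implications and universal quantifiers may be argued
for in the ambient logic, provided the argument works at every extension. Existential quantifiers
and definitional reflection cannot be opened in place: their elimination rules pass to an extension
and prove the goal there. With these tools the usual informal proofs can be carried out as they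
stand, and `derivable_of_sat` turns the outcome into derivations.

If all unifiers are taken as the complete set in definitional reflection, a case analysis only
requires that constructors be injective and distinct up to βη-conversion. Both facts come from
normalisation by evaluation: on neutral terms of base type, evaluation in a presheaf model is a left
inverse of the embedding into terms (`Ne.toTm_injective`).

The number in `seq` bounds the height of an object-level derivation, and all inductions are on it.
Since an atom whose clause body is a conjunction costs two levels, one for the clause and one for
the conjunction, the induction principle `Sat.nat_induction₂` reaches two steps back. It yields
monotonicity in the height (`seq_succ`) and weakening (`seq_weaken`). A plain induction yields cut
in the form of a bound on the resulting height (`ex_cutBound`). That bound serves twice: it brings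
two derivations to a common height (`prvv_conj`), and it replaces the typing assumption in the body
of an abstraction by a derivation (`prv_cut`), which gives `prv_typeof_beta`.

Determinacy holds because abstractions make no step and therefore the clauses do not overlap. From
`⇓` to `⇝*`, an application first runs its function part (`prv_transsem_app`). Conversely,
evaluation is closed under expansion by one step (`natsem_of_transone`). Subject reduction rests on
inversion of typing and on `prv_typeof_beta`. -/

namespace FOLDN

/-! ## Substitution in terms up to conversion -/

theorem Raw.rename_eq_subst {Γ : Ctx} {a : Ty} (t : Raw Γ a) : ∀ {Δ : Ctx} (ρ : Ren Γ Δ),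
    t.rename ρ = t.subst (fun b x => .var (ρ b x)) := by
  induction t with
  | var x => intros; rfl
  | const c => intros; rfl
  | lam t ih =>
    intro Δ ρ
    simp only [Raw.rename, Raw.subst, ih]
    congr 2; funext b x; cases x <;> rfl
  | app t u iht ihu => intro Δ ρ; simp only [Raw.rename, Raw.subst, iht, ihu]

/-- The identity substitution. -/
def Subst.id {Γ : Ctx} : Subst Γ Γ := fun _ x => .var x

/-- Extend a substitution by a term for a new variable. -/
def Subst.cons {Γ Δ : Ctx} {b : Ty} (t : Tm Δ b) (θ : Subst Γ Δ) : Subst (b :: Γ) Δ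
  | _, .z => t
  | _, .s x => θ _ x

/-- The substitution for the variables of the empty context. -/
def Subst.empty {Δ : Ctx} : Subst [] Δ := fun _ x => nomatch x

theorem Subst.exists_rep {Γ Δ : Ctx} (θ : Subst Γ Δ) :
    ∃ σ : RawSubst Γ Δ, θ = fun b x => Tm.mk (σ b x) :=
  ⟨fun b x => (θ b x).out, by funext b x; exact (Quotient.out_eq _).symm⟩

theorem Tm.exists_rep {Γ : Ctx} {a : Ty} (t : Tm Γ a) : ∃ r : Raw Γ a, t = Tm.mk r := by
  obtain ⟨r, hr⟩ := Quotient.exists_rep t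
  exact ⟨r, hr.symm⟩

namespace Tm

variable {Γ Δ Θ : Ctx} {a b : Ty}

@[simp] theorem subst_var (θ : Subst Γ Δ) (x : Var Γ a) : (Tm.var x).subst θ = θ a x :=
  Quotient.out_eq _

@[simp] theorem subst_const (θ : Subst Γ Δ) (c : Const a) :
    (Tm.const c : Tm Γ a).subst θ = Tm.const c := rfl

@[simp] theorem subst_app (θ : Subst Γ Δ) (t : Tm Γ (a →ₜ b)) (u : Tm Γ a) :
    (Tm.app t u).subst θ = Tm.app (t.subst θ) (u.subst θ) := by
  obtain ⟨t, rfl⟩ := t.exists_rep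
  obtain ⟨u, rfl⟩ := u.exists_rep
  rfl

theorem rename_eq_subst (ρ : Ren Γ Δ) (t : Tm Γ a) :
    t.rename ρ = t.subst (fun b x => .var (ρ b x)) := by
  obtain ⟨t, rfl⟩ := t.exists_rep
  exact (congrArg Tm.mk (t.rename_eq_subst ρ)).trans
    (Tm.subst_mk (fun b x => Raw.var (ρ b x)) t).symm

theorem wk_eq_subst (t : Tm Γ a) : (t.wk : Tm (b :: Γ) a) = t.subst Subst.weak :=
  rename_eq_subst _ t

@[simp] theorem subst_lam (θ : Subst Γ Δ) (t : Tm (a :: Γ) b) :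
    (Tm.lam t).subst θ = Tm.lam (t.subst θ.lift) := by
  obtain ⟨t, rfl⟩ := t.exists_rep
  obtain ⟨σ, rfl⟩ := θ.exists_rep
  have h : (Subst.lift (fun b x => Tm.mk (σ b x)) : Subst (a :: Γ) (a :: Δ))
      = fun b x => Tm.mk (σ.lift b x) := by
    funext b x; cases x <;> rfl
  rw [h, Tm.subst_mk]
  exact Tm.subst_mk σ (.lam t)

theorem subst_subst (t : Tm Γ a) (θ : Subst Γ Δ) (σ : Subst Δ Θ) :
    (t.subst θ).subst σ = t.subst (θ.comp σ) := by
  obtain ⟨t, rfl⟩ := t.exists_rep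
  obtain ⟨θ, rfl⟩ := θ.exists_rep
  obtain ⟨σ, rfl⟩ := σ.exists_rep
  have h : Subst.comp (fun b x => Tm.mk (θ b x)) (fun b x => Tm.mk (σ b x))
      = fun b x => Tm.mk ((θ b x).subst σ) := by
    funext b x; exact Tm.subst_mk _ _
  rw [h, Tm.subst_mk, Tm.subst_mk, Tm.subst_mk, Raw.subst_subst]

@[simp] theorem subst_id (t : Tm Γ a) : t.subst Subst.id = t := by
  obtain ⟨t, rfl⟩ := t.exists_rep
  exact (Tm.subst_mk (fun b x => Raw.var x) t).trans (congrArg Tm.mk t.subst_var)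

@[simp] theorem app_lam (t : Tm (a :: Γ) b) (u : Tm Γ a) :
    Tm.app (Tm.lam t) u = t.subst (Subst.cons u Subst.id) := by
  obtain ⟨t, rfl⟩ := t.exists_rep
  obtain ⟨u, rfl⟩ := u.exists_rep
  have h : Subst.cons (Tm.mk u) Subst.id = fun b x => Tm.mk (RawSubst.single u b x) := by
    funext b x; cases x <;> rfl
  rw [h, Tm.subst_mk]
  exact Quotient.sound (Conv.beta t u)

theorem lam_app_wk (t : Tm Γ (a →ₜ b)) : Tm.lam (Tm.app t.wk (.var .z)) = t := by
  obtain ⟨t, rfl⟩ := t.exists_rep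
  exact Quotient.sound (Conv.eta t)

end Tm

namespace Subst

variable {Γ Δ Θ Ξ : Ctx} {b : Ty}

theorem single_eq_cons (t : Tm Γ b) : Subst.single t = Subst.cons t Subst.id := by
  funext a x; cases x <;> rfl

theorem succ_eq_cons : (Subst.succ : Subst (nt :: Γ) (nt :: Γ)) =
    Subst.cons (FOLDN.succ (.var .z)) Subst.weak := by
  funext a x; cases x <;> rfl

theorem lift_eq_cons (θ : Subst Γ Δ) :
    (θ.lift : Subst (b :: Γ) (b :: Δ)) = Subst.cons (.var .z) (θ.comp Subst.weak) := by
  funext a x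
  cases x with
  | z => rfl
  | s x => exact Tm.wk_eq_subst _

@[simp] theorem cons_z (t : Tm Δ b) (θ : Subst Γ Δ) : Subst.cons t θ b .z = t := rfl

@[simp] theorem cons_s {a : Ty} (t : Tm Δ b) (θ : Subst Γ Δ) (x : Var Γ a) :
    Subst.cons t θ a (.s x) = θ a x := rfl

@[simp] theorem cons_comp (t : Tm Δ b) (θ : Subst Γ Δ) (σ : Subst Δ Θ) :
    (Subst.cons t θ).comp σ = Subst.cons (t.subst σ) (θ.comp σ) := by
  funext a x; cases x <;> rfl

@[simp] theorem id_comp (θ : Subst Γ Δ) : Subst.id.comp θ = θ := by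
  funext a x; exact Tm.subst_var _ _

@[simp] theorem comp_id (θ : Subst Γ Δ) : θ.comp Subst.id = θ := by
  funext a x; exact Tm.subst_id _

theorem comp_assoc (θ : Subst Γ Δ) (σ : Subst Δ Θ) (τ : Subst Θ Ξ) :
    (θ.comp σ).comp τ = θ.comp (σ.comp τ) := by
  funext a x; exact Tm.subst_subst _ _ _

@[simp] theorem weak_comp_cons (t : Tm Δ b) (θ : Subst Γ Δ) :
    Subst.weak.comp (Subst.cons t θ) = θ := by
  funext a x; exact Tm.subst_var _ _

@[simp] theorem empty_comp (θ : Subst Γ Δ) : Subst.empty.comp θ = Subst.empty := by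
  funext a x; cases x

theorem eq_empty (θ : Subst [] Δ) : θ = Subst.empty := by
  funext a x; cases x

@[simp] theorem lift_comp_cons (θ : Subst Γ Δ) (t : Tm Θ b) (σ : Subst Δ Θ) :
    θ.lift.comp (Subst.cons t σ) = Subst.cons t (θ.comp σ) := by
  rw [lift_eq_cons, cons_comp, comp_assoc, weak_comp_cons, Tm.subst_var]; rfl

theorem lift_comp_lift (θ : Subst Γ Δ) (σ : Subst Δ Θ) :
    (θ.lift : Subst (b :: Γ) (b :: Δ)).comp σ.lift = (θ.comp σ).lift := by
  rw [lift_eq_cons σ, lift_comp_cons, lift_eq_cons, comp_assoc]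

@[simp] theorem lift_id : (Subst.id.lift : Subst (b :: Γ) (b :: Γ)) = Subst.id := by
  funext a x; cases x <;> rfl

theorem weak_comp_lift (θ : Subst Γ Δ) :
    (Subst.weak : Subst Γ (b :: Γ)).comp θ.lift = θ.comp Subst.weak := by
  rw [lift_eq_cons, weak_comp_cons]

end Subst

theorem Args.subst_subst {Γ Δ Θ : Ctx} (θ : Subst Γ Δ) (σ : Subst Δ Θ) {as : List Ty}
    (ts : Args Γ as) : (ts.subst θ).subst σ = ts.subst (θ.comp σ) := by
  induction ts with
  | nil => rfl
  | cons t ts ih => simp only [Args.subst, ih, Tm.subst_subst]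

theorem Args.subst_id {Γ : Ctx} {as : List Ty} (ts : Args Γ as) : ts.subst Subst.id = ts := by
  induction ts with
  | nil => rfl
  | cons t ts ih => simp only [Args.subst, ih, Tm.subst_id]

namespace Form

theorem subst_subst {Γ : Ctx} (B : Form Γ) : ∀ {Δ Θ : Ctx} (θ : Subst Γ Δ) (σ : Subst Δ Θ),
    (B.subst θ).subst σ = B.subst (θ.comp σ) := by
  induction B with
  | bot => intros; rfl
  | top => intros; rfl
  | and B C ihB ihC => intros; simp only [Form.subst, ihB, ihC]
  | or B C ihB ihC => intros; simp only [Form.subst, ihB, ihC]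
  | imp B C ihB ihC => intros; simp only [Form.subst, ihB, ihC]
  | all a B ih => intros; simp only [Form.subst, ih, Subst.lift_comp_lift]
  | ex a B ih => intros; simp only [Form.subst, ih, Subst.lift_comp_lift]
  | nat t => intros; simp only [Form.subst, Tm.subst_subst]
  | pred p ts => intros; simp only [Form.subst, Args.subst_subst]

@[simp] theorem subst_id {Γ : Ctx} (B : Form Γ) : B.subst Subst.id = B := by
  induction B with
  | bot => rfl
  | top => rfl
  | and B C ihB ihC => simp only [Form.subst, ihB, ihC]
  | or B C ihB ihC => simp only [Form.subst, ihB, ihC]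
  | imp B C ihB ihC => simp only [Form.subst, ihB, ihC]
  | all a B ih => simp only [Form.subst, Subst.lift_id, ih]
  | ex a B ih => simp only [Form.subst, Subst.lift_id, ih]
  | nat t => simp only [Form.subst, Tm.subst_id]
  | pred p ts => simp only [Form.subst, Args.subst_id]

end Form

/-! ## Constructors are injective up to conversion

Terms are evaluated in a presheaf model over contexts and renamings, in which the
elements of base type are neutral terms with arguments taken up to conversion. -/

/-- A presheaf over contexts and renamings. -/
structure Psh where
  obj : Ctx → Type
  ren : ∀ {Γ Δ : Ctx}, Ren Γ Δ → obj Γ → obj Δ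
  ren_id : ∀ {Γ : Ctx} (x : obj Γ), ren (fun _ y => y) x = x
  ren_ren : ∀ {Γ Δ Θ : Ctx} (ρ : Ren Γ Δ) (ρ' : Ren Δ Θ) (x : obj Γ),
    ren ρ' (ren ρ x) = ren (fun b y => ρ' b (ρ b y)) x

/-- The exponential of presheaves. -/
def Psh.exp (A B : Psh) : Psh where
  obj Γ := {f : ∀ Δ : Ctx, Ren Γ Δ → A.obj Δ → B.obj Δ //
    ∀ (Δ Θ : Ctx) (ρ : Ren Γ Δ) (ρ' : Ren Δ Θ) (x : A.obj Δ),
      B.ren ρ' (f Δ ρ x) = f Θ (fun b y => ρ' b (ρ b y)) (A.ren ρ' x)}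
  ren ρ f := ⟨fun Δ ρ' x => f.1 Δ (fun b y => ρ' b (ρ b y)) x, fun _ _ _ _ _ => f.2 _ _ _ _ _⟩
  ren_id _ := rfl
  ren_ren _ _ _ := rfl

/-- Neutral terms. -/
inductive Ne (Γ : Ctx) : Ty → Type
  | var {a : Ty} (x : Var Γ a) : Ne Γ a
  | const {a : Ty} (c : Const a) : Ne Γ a
  | app {a b : Ty} (n : Ne Γ (a →ₜ b)) (t : Tm Γ a) : Ne Γ b

namespace Ne

def rename {Γ Δ : Ctx} (ρ : Ren Γ Δ) : ∀ {a : Ty}, Ne Γ a → Ne Δ a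
  | _, .var x => .var (ρ _ x)
  | _, .const c => .const c
  | _, .app n t => .app (n.rename ρ) (t.rename ρ)

def toTm {Γ : Ctx} : ∀ {a : Ty}, Ne Γ a → Tm Γ a
  | _, .var x => .var x
  | _, .const c => .const c
  | _, .app n t => .app n.toTm t

end Ne

theorem Tm.rename_id {Γ : Ctx} {a : Ty} (t : Tm Γ a) : t.rename (fun _ x => x) = t := by
  rw [Tm.rename_eq_subst]; exact t.subst_id

theorem Tm.rename_rename {Γ Δ Θ : Ctx} {a : Ty} (ρ : Ren Γ Δ) (ρ' : Ren Δ Θ) (t : Tm Γ a) :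
    (t.rename ρ).rename ρ' = t.rename (fun b x => ρ' b (ρ b x)) := by
  obtain ⟨t, rfl⟩ := t.exists_rep
  exact congrArg Tm.mk (t.rename_rename ρ ρ')

theorem Tm.rename_lam {Γ Δ : Ctx} {a b : Ty} (ρ : Ren Γ Δ) (t : Tm (a :: Γ) b) :
    (Tm.lam t).rename ρ = Tm.lam (t.rename ρ.lift) := by
  obtain ⟨t, rfl⟩ := t.exists_rep; rfl

theorem Tm.rename_app {Γ Δ : Ctx} {a b : Ty} (ρ : Ren Γ Δ) (t : Tm Γ (a →ₜ b)) (u : Tm Γ a) :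
    (Tm.app t u).rename ρ = Tm.app (t.rename ρ) (u.rename ρ) := by
  obtain ⟨t, rfl⟩ := t.exists_rep
  obtain ⟨u, rfl⟩ := u.exists_rep
  rfl

namespace Ne

theorem rename_id {Γ : Ctx} {a : Ty} (n : Ne Γ a) : n.rename (fun _ x => x) = n := by
  induction n with
  | var x => rfl
  | const c => rfl
  | app n t ih => simp only [rename, ih, Tm.rename_id]

theorem rename_rename {Γ Δ Θ : Ctx} {a : Ty} (ρ : Ren Γ Δ) (ρ' : Ren Δ Θ) (n : Ne Γ a) :
    (n.rename ρ).rename ρ' = n.rename (fun b x => ρ' b (ρ b x)) := by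
  induction n with
  | var x => rfl
  | const c => rfl
  | app n t ih => simp only [rename, ih, Tm.rename_rename]

theorem toTm_rename {Γ Δ : Ctx} {a : Ty} (ρ : Ren Γ Δ) (n : Ne Γ a) :
    n.toTm.rename ρ = (n.rename ρ).toTm := by
  induction n with
  | var x => rfl
  | const c => rfl
  | app n t ih => simp only [rename, toTm, Tm.rename_app, ih]

/-- The presheaf of neutral terms of a given type. -/
def psh (a : Ty) : Psh where
  obj Γ := Ne Γ a
  ren ρ n := n.rename ρ
  ren_id := rename_id
  ren_ren ρ ρ' n := rename_rename ρ ρ' n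

end Ne

/-- The presheaf that interprets a type. -/
def Ty.psh : Ty → Psh
  | .base b => Ne.psh (.base b)
  | .fn a b => a.psh.exp b.psh

/-- Natural maps from neutral terms to the model and from the model to terms. -/
structure ReifyReflect (a : Ty) where
  reflect : ∀ {Γ : Ctx}, Ne Γ a → a.psh.obj Γ
  reify : ∀ {Γ : Ctx}, a.psh.obj Γ → Tm Γ a
  ren_reflect : ∀ {Γ Δ : Ctx} (ρ : Ren Γ Δ) (n : Ne Γ a),
    a.psh.ren ρ (reflect n) = reflect (n.rename ρ)
  rename_reify : ∀ {Γ Δ : Ctx} (ρ : Ren Γ Δ) (x : a.psh.obj Γ),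
    (reify x).rename ρ = reify (a.psh.ren ρ x)

/-- At a function type `reflect` applies the neutral term to the reified argument, and `reify`
η-expands with a fresh variable. The naturality laws belong to the same recursion: elements of an
exponential are natural by definition, and for a reflected term this needs the laws at the smaller
types. -/
def Ty.reifyReflect : ∀ a : Ty, ReifyReflect a
  | .base _ =>
    { reflect := fun n => n
      reify := fun n => Ne.toTm n
      ren_reflect := fun _ _ => rfl
      rename_reify := fun ρ n => Ne.toTm_rename ρ n }
  | .fn a b =>
    { reflect := fun n => ⟨fun _ ρ x => b.reifyReflect.reflect
        (.app (n.rename ρ) (a.reifyReflect.reify x)), fun Δ Θ ρ ρ' x => by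
          rw [b.reifyReflect.ren_reflect, Ne.rename, Ne.rename_rename,
            a.reifyReflect.rename_reify]⟩
      reify := fun f => .lam (b.reifyReflect.reify
        (f.1 _ Ren.wk (a.reifyReflect.reflect (.var .z))))
      ren_reflect := fun ρ n => by
        refine Subtype.ext ?_
        funext Δ ρ' x
        show _ = b.reifyReflect.reflect (.app ((n.rename ρ).rename ρ') _)
        rw [Ne.rename_rename]; rfl
      rename_reify := fun ρ f => by
        rw [Tm.rename_lam, b.reifyReflect.rename_reify, f.2, a.reifyReflect.ren_reflect]
        rfl }

/-- Environments in the model. -/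
abbrev PshEnv (Γ Δ : Ctx) : Type := ∀ a : Ty, Var Γ a → a.psh.obj Δ

def PshEnv.ren {Γ Δ Θ : Ctx} (ρ : Ren Δ Θ) (e : PshEnv Γ Δ) : PshEnv Γ Θ :=
  fun a x => a.psh.ren ρ (e a x)

def PshEnv.cons {Γ Δ : Ctx} {b : Ty} (d : b.psh.obj Δ) (e : PshEnv Γ Δ) : PshEnv (b :: Γ) Δ
  | _, .z => d
  | _, .s x => e _ x

theorem PshEnv.ren_ren {Γ Δ Θ Ξ : Ctx} (ρ : Ren Δ Θ) (ρ' : Ren Θ Ξ) (e : PshEnv Γ Δ) :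
    (e.ren ρ).ren ρ' = e.ren (fun b x => ρ' b (ρ b x)) := by
  funext a x; exact a.psh.ren_ren _ _ _

theorem PshEnv.ren_id {Γ Δ : Ctx} (e : PshEnv Γ Δ) : e.ren (fun _ x => x) = e := by
  funext a x; exact a.psh.ren_id _

theorem PshEnv.ren_cons {Γ Δ Θ : Ctx} {b : Ty} (ρ : Ren Δ Θ) (d : b.psh.obj Δ) (e : PshEnv Γ Δ) :
    (PshEnv.cons d e).ren ρ = PshEnv.cons (b.psh.ren ρ d) (e.ren ρ) := by
  funext a x; cases x <;> rfl

/-- Evaluation of terms in the model, together with its naturality. -/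
def Raw.eval : ∀ {Γ : Ctx} {a : Ty}, Raw Γ a → {f : ∀ {Δ : Ctx}, PshEnv Γ Δ → a.psh.obj Δ //
    ∀ {Δ Θ : Ctx} (ρ : Ren Δ Θ) (e : PshEnv Γ Δ), a.psh.ren ρ (f e) = f (e.ren ρ)}
  | _, _, .var x => ⟨fun e => e _ x, fun _ _ => rfl⟩
  | _, a, .const c => ⟨fun _ => a.reifyReflect.reflect (.const c),
      fun _ _ => a.reifyReflect.ren_reflect _ _⟩
  | _, _, .lam t => ⟨fun e => ⟨fun _ ρ d => t.eval.1 (PshEnv.cons d (e.ren ρ)),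
        fun _ _ _ _ _ => by rw [t.eval.2, PshEnv.ren_cons, PshEnv.ren_ren]⟩,
      fun ρ e => by
        refine Subtype.ext ?_
        funext Δ ρ' d
        show t.eval.1 _ = t.eval.1 _
        rw [PshEnv.ren_ren]⟩
  | _, _, .app t u => ⟨fun e => (t.eval.1 e).1 _ (fun _ x => x) (u.eval.1 e), fun ρ e => by
        refine ((t.eval.1 e).2 _ _ _ _ _).trans ?_
        rw [u.eval.2]
        exact congrArg (fun f => f.1 _ (fun _ x => x) (u.eval.1 (e.ren ρ))) (t.eval.2 ρ e)⟩

theorem Raw.eval_rename {Γ : Ctx} {a : Ty} (t : Raw Γ a) : ∀ {Δ Θ : Ctx} (ρ : Ren Γ Δ)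
    (e : PshEnv Δ Θ), (t.rename ρ).eval.1 e = t.eval.1 (fun b x => e b (ρ b x)) := by
  induction t with
  | var x => intros; rfl
  | const c => intros; rfl
  | lam t ih =>
    intro Δ Θ ρ e
    refine Subtype.ext ?_
    funext Ξ ρ' d
    show (t.rename ρ.lift).eval.1 _ = t.eval.1 _
    rw [ih]
    refine congrArg (fun e => t.eval.1 e) ?_
    funext b x; cases x <;> rfl
  | app t u iht ihu => intro Δ Θ ρ e; simp only [Raw.rename, Raw.eval, iht, ihu]

theorem Raw.eval_subst {Γ : Ctx} {a : Ty} (t : Raw Γ a) : ∀ {Δ Θ : Ctx} (σ : RawSubst Γ Δ)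
    (e : PshEnv Δ Θ), (t.subst σ).eval.1 e = t.eval.1 (fun b x => (σ b x).eval.1 e) := by
  induction t with
  | var x => intros; rfl
  | const c => intros; rfl
  | lam t ih =>
    intro Δ Θ σ e
    refine Subtype.ext ?_
    funext Ξ ρ' d
    show (t.subst σ.lift).eval.1 _ = t.eval.1 _
    rw [ih]
    refine congrArg (fun e => t.eval.1 e) ?_
    funext b x
    cases x with
    | z => rfl
    | s x => exact (Raw.eval_rename _ _ _).trans ((σ b x).eval.2 ρ' e).symm
  | app t u iht ihu => intro Δ Θ σ e; simp only [Raw.subst, Raw.eval, iht, ihu]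

theorem Conv.eval_eq {Γ : Ctx} {a : Ty} {t u : Raw Γ a} (h : Conv t u) :
    ∀ {Δ : Ctx} (e : PshEnv Γ Δ), t.eval.1 e = u.eval.1 e := by
  induction h with
  | refl t => intros; rfl
  | symm _ ih => exact fun e => (ih e).symm
  | trans _ _ ih ih' => exact fun e => (ih e).trans (ih' e)
  | app _ _ ih ih' => intro Δ e; simp only [Raw.eval, ih, ih']
  | lam _ ih =>
    intro Δ e
    refine Subtype.ext ?_
    funext Ξ ρ d
    exact ih _
  | beta t u =>
    intro Δ e
    rw [Raw.eval_subst]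
    show t.eval.1 (PshEnv.cons _ (e.ren fun _ x => x)) = _
    rw [PshEnv.ren_id]
    refine congrArg (fun e => t.eval.1 e) ?_
    funext b x; cases x <;> rfl
  | eta t =>
    intro Δ e
    refine Subtype.ext ?_
    funext Ξ ρ d
    show ((t.rename Ren.wk).eval.1 (PshEnv.cons d (e.ren ρ))).1 _ _ d = _
    rw [Raw.eval_rename]
    show (t.eval.1 (e.ren ρ)).1 _ _ d = _
    -- By naturality the value in the renamed environment is the renamed value, and its action at
    -- the identity is the original action along `ρ`.
    rw [← t.eval.2]; rfl

/-- The logical relation between terms and elements of the model. -/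
def Ty.Rel : ∀ (a : Ty) {Γ : Ctx}, Tm Γ a → a.psh.obj Γ → Prop
  | .base _, _, t, n => t = Ne.toTm n
  | .fn a b, Γ, t, f => ∀ (Δ : Ctx) (ρ : Ren Γ Δ) (u : Tm Δ a) (x : a.psh.obj Δ),
      a.Rel u x → b.Rel (.app (t.rename ρ) u) (f.1 Δ ρ x)

theorem Ty.Rel.ren {a : Ty} : ∀ {Γ Δ : Ctx} {t : Tm Γ a} {x : a.psh.obj Γ} (ρ : Ren Γ Δ),
    a.Rel t x → a.Rel (t.rename ρ) (a.psh.ren ρ x) := by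
  cases a with
  | base b =>
    intro Γ Δ t x ρ h
    cases h
    exact Ne.toTm_rename ρ x
  | fn a b =>
    intro Γ Δ t x ρ h Θ ρ' u y hy
    rw [Tm.rename_rename]
    exact h Θ _ u y hy

/-- The two halves need each other at the domain of a function type: reifying a function applies it
to a reflected variable, and reflecting a neutral term reifies its argument. -/
theorem Ty.rel_reify_reflect (a : Ty) :
    (∀ {Γ : Ctx} {t : Tm Γ a} {x : a.psh.obj Γ}, a.Rel t x → a.reifyReflect.reify x = t) ∧
    (∀ {Γ : Ctx} (n : Ne Γ a), a.Rel n.toTm (a.reifyReflect.reflect n)) := by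
  induction a with
  | base b => exact ⟨fun h => h.symm, fun n => rfl⟩
  | fn a b iha ihb =>
    constructor
    · intro Γ t f h
      have h' := ihb.1 (h _ Ren.wk _ _ (iha.2 (.var .z)))
      exact (congrArg Tm.lam h').trans t.lam_app_wk
    · intro Γ n Δ ρ u x hx
      have h := ihb.2 (.app (n.rename ρ) (a.reifyReflect.reify x))
      rw [iha.1 hx] at h
      rw [Ne.toTm_rename]
      show b.Rel _ (b.reifyReflect.reflect (.app (n.rename ρ) (a.reifyReflect.reify x)))
      rw [iha.1 hx]
      exact h

/-- The fundamental lemma of the logical relation. For an abstraction the substitution and the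
environment are first renamed, which preserves relatedness, and then extended; β-conversion
identifies the applied abstraction with the extended instance. -/
theorem Raw.rel_eval {Γ : Ctx} {a : Ty} (t : Raw Γ a) : ∀ {Δ : Ctx} (θ : Subst Γ Δ)
    (e : PshEnv Γ Δ), (∀ (b : Ty) (x : Var Γ b), b.Rel (θ b x) (e b x)) → a.Rel ((Tm.mk t).subst θ) (t.eval.1 e) := by
  induction t with
  | var x =>
    intro Δ θ e h
    exact cast (congrArg (fun s => Ty.Rel _ s _) (Tm.subst_var θ x).symm) (h _ x)
  | const c => exact fun θ e _ => (Ty.rel_reify_reflect _).2 (.const c)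
  | @lam Γ a b t ih =>
    intro Δ θ e h Θ ρ u x hx
    have h' := ih (Subst.cons u fun c y => (θ c y).rename ρ) (PshEnv.cons x (e.ren ρ)) (by
      intro c y
      cases y with
      | z => exact hx
      | s y => exact (h c y).ren ρ)
    refine cast (congrArg (fun s => b.Rel s _) ?_) h'
    show _ = Tm.app (((Tm.lam (Tm.mk t)).subst θ).rename ρ) u
    rw [Tm.rename_eq_subst, Tm.subst_lam, Tm.subst_lam, Tm.app_lam, Tm.subst_subst,
      Tm.subst_subst, Subst.lift_comp_cons, Subst.lift_comp_cons, Subst.comp_id]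
    congr 2; funext c y; exact Tm.rename_eq_subst _ _
  | app t u iht ihu =>
    intro Δ θ e h
    have happ := iht θ e h _ (fun _ x => x) _ _ (ihu θ e h)
    rw [Tm.rename_id] at happ
    exact happ

/-- The environment that interprets every variable by itself. -/
def PshEnv.id {Γ : Ctx} : PshEnv Γ Γ := fun a x => a.reifyReflect.reflect (.var x)

def Tm.eval {Γ : Ctx} {a : Ty} (t : Tm Γ a) : a.psh.obj Γ :=
  Quotient.lift (fun r : Raw Γ a => r.eval.1 PshEnv.id) (fun _ _ h => Conv.eval_eq h _) t

/-- The identity substitution and the identity environment are related, so the fundamental lemma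
relates a term to its value, and reification recovers a term from anything related to it. -/
theorem Tm.reify_eval {Γ : Ctx} {a : Ty} (t : Tm Γ a) : a.reifyReflect.reify t.eval = t := by
  obtain ⟨t, rfl⟩ := t.exists_rep
  have h := t.rel_eval Subst.id PshEnv.id fun b x => (Ty.rel_reify_reflect b).2 (.var x)
  rw [Tm.subst_id] at h
  exact (Ty.rel_reify_reflect a).1 h

theorem Tm.eval_app {Γ : Ctx} {a b : Ty} (t : Tm Γ (a →ₜ b)) (u : Tm Γ a) :
    (Tm.app t u).eval = t.eval.1 _ (fun _ x => x) u.eval := by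
  obtain ⟨t, rfl⟩ := t.exists_rep
  obtain ⟨u, rfl⟩ := u.exists_rep
  rfl

theorem Ne.eval_toTm {Γ : Ctx} {a : Ty} (n : Ne Γ a) :
    n.toTm.eval = a.reifyReflect.reflect n := by
  induction n with
  | var x => rfl
  | const c => rfl
  | @app a b n t ih =>
    rw [Ne.toTm, Tm.eval_app, ih]
    show b.reifyReflect.reflect (.app (n.rename _) (a.reifyReflect.reify t.eval)) = _
    rw [Ne.rename_id, Tm.reify_eval]

/-- At base type reflection is the identity, so by `Ne.eval_toTm` evaluation undoes the embedding.
Injectivity of all constructors modulo βη follows from this. -/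
theorem Ne.toTm_injective {Γ : Ctx} {b : Base} {n n' : Ne Γ (.base b)} (h : n.toTm = n'.toTm) :
    n = n' := by
  have heval := congrArg Tm.eval h
  rwa [Ne.eval_toTm, Ne.eval_toTm] at heval

/-! ## Admissible rules -/

theorem Subst.cons_z_weak {Γ : Ctx} {b : Ty} :
    (Subst.cons (.var .z) Subst.weak : Subst (b :: Γ) (b :: Γ)) = Subst.id := by
  funext a x; cases x <;> rfl

theorem Form.inst_eq_subst {Γ : Ctx} {b : Ty} (B : Form (b :: Γ)) (t : Tm Γ b) :
    B.inst t = B.subst (Subst.cons t Subst.id) := by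
  rw [Form.inst, Subst.single_eq_cons]

theorem Form.subst_lift_inst {Γ Δ : Ctx} {b : Ty} (B : Form (b :: Γ)) (θ : Subst Γ Δ)
    (t : Tm Δ b) : (B.subst θ.lift).inst t = B.subst (Subst.cons t θ) := by
  rw [Form.inst_eq_subst, Form.subst_subst, Subst.lift_comp_cons, Subst.comp_id]

theorem Form.inst_subst {Γ Δ : Ctx} {b : Ty} (B : Form (b :: Γ)) (θ : Subst Γ Δ)
    (t : Tm Γ b) : (B.inst t).subst θ = (B.subst θ.lift).inst (t.subst θ) := by
  rw [Form.subst_lift_inst, Form.inst_eq_subst, Form.subst_subst, Subst.cons_comp, Subst.id_comp]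

theorem Form.wk_subst_lift {Γ Δ : Ctx} {b : Ty} (B : Form Γ) (θ : Subst Γ Δ) :
    (B.wk : Form (b :: Γ)).subst θ.lift = (B.subst θ).wk := by
  rw [Form.wk, Form.wk, Form.subst_subst, Form.subst_subst, Subst.weak_comp_lift]

theorem Form.map_wk_subst_lift {Γ Δ : Ctx} {b : Ty} (M : Multiset (Form Γ)) (θ : Subst Γ Δ) :
    (M.map (Form.wk (b := b))).map (Form.subst θ.lift) = (M.map (Form.subst θ)).map Form.wk := by
  rw [Multiset.map_map, Multiset.map_map]
  exact Multiset.map_congr rfl fun B _ => B.wk_subst_lift θ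

theorem Form.IsAtomic.subst {Γ Δ : Ctx} {A : Form Γ} (h : A.IsAtomic) (θ : Subst Γ Δ) :
    (A.subst θ).IsAtomic := by
  cases A <;> first | exact h.elim | trivial

/-- Derivability is closed under substitution and weakening. -/
theorem Der.subst_add {D : Definition} {V : Ctx} {Γ : Multiset (Form V)} {C : Form V}
    (h : Der D V Γ C) : ∀ {V' : Ctx} (θ : Subst V V') (Δ : Multiset (Form V')),
    Der D V' (Γ.map (Form.subst θ) + Δ) (C.subst θ) := by
  induction h with
  | botL => intro V' θ Δ; rw [Multiset.map_cons, Multiset.cons_add]; exact .botL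
  | topR => intro V' θ Δ; exact .topR
  | andL₁ _ ih =>
    intro V' θ Δ
    have := ih θ Δ
    rw [Multiset.map_cons, Multiset.cons_add] at *
    exact .andL₁ this
  | andL₂ _ ih =>
    intro V' θ Δ
    have := ih θ Δ
    rw [Multiset.map_cons, Multiset.cons_add] at *
    exact .andL₂ this
  | andR _ _ ih ih' => exact fun θ Δ => .andR (ih θ Δ) (ih' θ Δ)
  | orL _ _ ih ih' =>
    intro V' θ Δ
    have h := ih θ Δ
    have h' := ih' θ Δ
    rw [Multiset.map_cons, Multiset.cons_add] at *
    exact .orL h h'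
  | orR₁ _ ih => exact fun θ Δ => .orR₁ (ih θ Δ)
  | orR₂ _ ih => exact fun θ Δ => .orR₂ (ih θ Δ)
  | impL _ _ ih ih' =>
    intro V' θ Δ
    have h := ih θ Δ
    have h' := ih' θ Δ
    rw [Multiset.map_cons, Multiset.cons_add] at *
    exact .impL h h'
  | impR _ ih =>
    intro V' θ Δ
    have h := ih θ Δ
    rw [Multiset.map_cons, Multiset.cons_add] at h
    exact .impR h
  | allL t _ ih =>
    intro V' θ Δ
    have h := ih θ Δ
    rw [Multiset.map_cons, Multiset.cons_add] at *
    rw [Form.inst_subst] at h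
    exact .allL _ h
  | allR _ ih =>
    intro V' θ Δ
    -- The added hypotheses are weakened so that the eigenvariable remains fresh for them.
    have h := ih θ.lift (Δ.map Form.wk)
    rw [Form.map_wk_subst_lift, ← Multiset.map_add] at h
    exact .allR h
  | exL _ ih =>
    intro V' θ Δ
    have h := ih θ.lift (Δ.map Form.wk)
    rw [Multiset.map_cons, Multiset.cons_add, Form.map_wk_subst_lift, ← Multiset.map_add,
      Form.wk_subst_lift] at h
    rw [Multiset.map_cons, Multiset.cons_add]
    exact .exL h
  | exR t _ ih =>
    intro V' θ Δ
    have h := ih θ Δ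
    rw [Form.inst_subst] at h
    exact .exR _ h
  | init hA =>
    intro V' θ Δ
    rw [Multiset.map_cons, Multiset.cons_add]
    exact .init (hA.subst θ)
  | contr _ ih =>
    intro V' θ Δ
    have h := ih θ Δ
    simp only [Multiset.map_cons, Multiset.cons_add] at *
    exact .contr h
  | cut _ _ ih ih' =>
    intro V' θ Δ
    -- The cut rule adds the contexts of its premises, so the extra hypotheses go to the right
    -- premise only.
    have h := ih θ 0
    have h' := ih' θ Δ
    rw [Multiset.map_cons, Multiset.cons_add] at h'
    rw [add_zero] at h
    rw [Multiset.map_add, add_assoc]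
    exact .cut h h'
  | natR_zero => intro V' θ Δ; exact .natR_zero
  | natR_succ _ ih =>
    intro V' θ Δ
    have h := Der.natR_succ (ih θ Δ)
    rw [Form.subst, Tm.subst_app]
    exact h
  | natL B _ _ _ ih₀ ih₁ ih₂ =>
    intro V' θ Δ
    have h₀ := ih₀ θ 0
    have h₁ := ih₁ θ.lift 0
    have h₂ := ih₂ θ Δ
    rw [Multiset.map_cons, Multiset.cons_add] at *
    rw [Form.inst_subst] at h₀ h₂
    rw [Multiset.map_zero, add_zero] at h₀
    rw [Multiset.map_singleton, add_zero] at h₁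
    refine .natL (B.subst θ.lift) h₀ ?_ h₂
    refine cast (congrArg (Der D _ _) ?_) h₁
    rw [Form.subst_subst, Form.subst_subst, Subst.succ_eq_cons, Subst.succ_eq_cons,
      Subst.cons_comp, Subst.lift_comp_cons, Subst.weak_comp_lift]
    simp only [FOLDN.succ, Tm.subst_app, Tm.subst_const, Tm.subst_var]
    rfl
  | defR c hc σ heq _ ih =>
    intro V' θ Δ
    have h := ih θ Δ
    rw [Form.subst_subst] at h
    refine .defR c hc (σ.comp θ) ?_ h
    rw [← Form.subst_subst, ← heq]; rfl
  | defL S hS _ ih =>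
    intro V' θ Δ
    rw [Multiset.map_cons, Multiset.cons_add]
    -- All unifiers form a complete set. A unifier of the substituted atom with a clause head,
    -- composed with `θ`, unifies the original atom. It therefore factors through some member of `S
    -- c`, and an instance of the premise for that member is the premise required.
    refine .defL (fun c => Set.univ) (fun c _ ρ => ⟨ρ, trivial, Subst.id, ?_, ?_⟩) ?_
    · rw [Subst.comp_id]
    · rw [Subst.comp_id]
    · intro c hc ρ _
      obtain ⟨τ, hτ, σ, hl, hr⟩ := hS c hc ⟨ρ.cod, θ.comp ρ.left, ρ.right, by
        rw [← ρ.eq, ← Form.subst_subst]; rfl⟩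
      have h := ih c hc τ hτ σ (Δ.map (Form.subst ρ.left))
      rw [Multiset.map_cons, Multiset.cons_add, Multiset.map_map] at h
      simp only [Function.comp_def, Form.subst_subst] at h
      simp only at hl hr
      rw [← hl, ← hr] at h
      rw [Multiset.map_add, Multiset.map_map]
      simp only [Function.comp_def, Form.subst_subst]
      exact h

/-- The initial rule for arbitrary formulas. -/
theorem Der.refl {D : Definition} {V : Ctx} (A : Form V) :
    ∀ Γ : Multiset (Form V), Der D V (A ::ₘ Γ) A := by
  induction A with
  | bot => exact fun Γ => .botL
  | top => exact fun Γ => .topR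
  | and B C ihB ihC => exact fun Γ => .andR (.andL₁ (ihB Γ)) (.andL₂ (ihC Γ))
  | or B C ihB ihC => exact fun Γ => .orL (.orR₁ (ihB Γ)) (.orR₂ (ihC Γ))
  | imp B C ihB ihC =>
    intro Γ
    refine .impR ?_
    rw [Multiset.cons_swap]
    exact .impL (ihB Γ) (ihC _)
  | all a B ih =>
    intro Γ
    refine .allR ?_
    rw [Multiset.map_cons]
    refine .allL (.var .z) ?_
    rw [Form.subst_lift_inst, Subst.cons_z_weak, Form.subst_id]
    exact ih _
  | ex a B ih =>
    intro Γ
    refine .exL (.exR (.var .z) ?_)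
    rw [Form.subst_lift_inst, Subst.cons_z_weak, Form.subst_id]
    exact ih _
  | nat t => exact fun Γ => .init trivial
  | pred p ts => exact fun Γ => .init trivial

theorem Der.of_mem {D : Definition} {V : Ctx} {Γ : Multiset (Form V)} {A : Form V} (h : A ∈ Γ) :
    Der D V Γ A := by
  obtain ⟨Δ, rfl⟩ := Multiset.exists_cons_of_mem h
  exact .refl A Δ

theorem Der.contr_add {D : Definition} {V : Ctx} {C : Form V} (Δ : Multiset (Form V)) :
    ∀ Γ : Multiset (Form V), Der D V (Δ + (Γ + Δ)) C → Der D V (Γ + Δ) C := by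
  induction Δ using Multiset.induction_on with
  | empty => intro Γ h; simpa using h
  | cons A Δ ih =>
    intro Γ h
    have h' : Der D V (A ::ₘ A ::ₘ (Δ + (Γ + Δ))) C := by
      simpa only [Multiset.cons_add, Multiset.add_cons] using h
    have hc := ih (A ::ₘ Γ) (by
      simpa only [Multiset.cons_add, Multiset.add_cons] using Der.contr h')
    simpa only [Multiset.cons_add, Multiset.add_cons] using hc

/-- Simultaneous cut. -/
theorem Der.cut_all {D : Definition} {V : Ctx} {C : Form V} {Δ : Multiset (Form V)}
    (Γ : Multiset (Form V)) (hΓ : ∀ A ∈ Γ, Der D V Δ A) (h : Der D V (Γ + Δ) C) : Der D V Δ C := by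
  induction Γ using Multiset.induction_on with
  | empty => simpa using h
  | cons A Γ ih =>
    -- Cutting against `Δ` leaves a second copy of `Δ`, which contraction absorbs.
    refine ih (fun B hB => hΓ B (Multiset.mem_cons_of_mem hB)) (Der.contr_add Δ Γ ?_)
    rw [Multiset.cons_add] at h
    exact .cut (hΓ A (Multiset.mem_cons_self A Γ)) h

/-! ## Forcing

A world consists of the eigenvariables and hypotheses that are available at some point of a
derivation; a formula is forced at a world if it is derivable there. -/

structure World where
  ctx : Ctx
  hyps : Multiset (Form ctx)

/-- Derivability of a formula from the hypotheses of a world. -/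
def Forces (w : World) (A : Form w.ctx) : Prop := Der lambdaDefinition w.ctx w.hyps A

infix:30 " ⊩ " => Forces

/-- Extensions of worlds: substitutions that make all the hypotheses derivable. -/
structure Hom (w w' : World) where
  θ : Subst w.ctx w'.ctx
  forces : ∀ A ∈ w.hyps, w' ⊩ A.subst θ

/-- The substituted derivation uses the images of the old hypotheses; these are derivable at the new
world and are cut away together. -/
theorem Forces.mono {w w' : World} {A : Form w.ctx} (h : w ⊩ A) (e : Hom w w') :
    w' ⊩ A.subst e.θ := by
  refine Der.cut_all (w.hyps.map (Form.subst e.θ)) (fun B hB => ?_) (h.subst_add e.θ _)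
  obtain ⟨A, hA, rfl⟩ := Multiset.mem_map.1 hB
  exact e.forces A hA

namespace Hom

def id (w : World) : Hom w w := ⟨Subst.id, fun A hA => by
  rw [Form.subst_id]; exact Der.of_mem hA⟩

noncomputable def comp {w w' w'' : World} (e : Hom w w') (e' : Hom w' w'') : Hom w w'' :=
  ⟨e.θ.comp e'.θ, fun A hA => by rw [← Form.subst_subst]; exact Forces.mono (e.forces A hA) e'⟩

@[simp] theorem id_θ (w : World) : (Hom.id w).θ = Subst.id := rfl

@[simp] theorem comp_θ {w w' w'' : World} (e : Hom w w') (e' : Hom w' w'') :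
    (e.comp e').θ = e.θ.comp e'.θ := rfl

end Hom

/-- Add a hypothesis to a world. -/
abbrev World.assume (w : World) (A : Form w.ctx) : World := ⟨w.ctx, A ::ₘ w.hyps⟩

def Hom.assume (w : World) (A : Form w.ctx) : Hom w (w.assume A) := ⟨Subst.id, fun B hB => by
  rw [Form.subst_id]; exact Der.of_mem (Multiset.mem_cons_of_mem hB)⟩

/-- Add an eigenvariable to a world. -/
noncomputable abbrev World.extend (w : World) (a : Ty) : World := ⟨a :: w.ctx, w.hyps.map Form.wk⟩

noncomputable def Hom.extend (w : World) (a : Ty) : Hom w (w.extend a) :=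
  ⟨Subst.weak, fun _ hB => Der.of_mem (Multiset.mem_map_of_mem _ hB)⟩

namespace Forces

variable {w : World}

theorem cut {A C : Form w.ctx} (h : w ⊩ A) (h' : w.assume A ⊩ C) : w ⊩ C := by
  refine Der.cut_all {A} (fun B hB => ?_) h'
  rw [Multiset.mem_singleton.1 hB]; exact h

theorem assume (A : Form w.ctx) : w.assume A ⊩ A := Der.refl A _

theorem and_intro {A B : Form w.ctx} (h : w ⊩ A) (h' : w ⊩ B) : w ⊩ A ∧ₘ B := Der.andR h h'

theorem and_left {A B : Form w.ctx} (h : w ⊩ A ∧ₘ B) : w ⊩ A := h.cut (.andL₁ (.refl _ _))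

theorem and_right {A B : Form w.ctx} (h : w ⊩ A ∧ₘ B) : w ⊩ B := h.cut (.andL₂ (.refl _ _))

theorem imp_elim {A B : Form w.ctx} (h : w ⊩ (A ⊃ₘ B)) (h' : w ⊩ A) : w ⊩ B :=
  h.cut (.impL h' (.refl _ _))

theorem all_elim {Δ : Ctx} {θ : Subst Δ w.ctx} {a : Ty} {B : Form (a :: Δ)}
    (h : w ⊩ (Form.all a B).subst θ) (t : Tm w.ctx a) : w ⊩ B.subst (Subst.cons t θ) := by
  refine h.cut (.allL t ?_)
  rw [Form.subst_lift_inst]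
  exact .refl _ _

theorem ex_intro {Δ : Ctx} {θ : Subst Δ w.ctx} {a : Ty} {B : Form (a :: Δ)} (t : Tm w.ctx a)
    (h : w ⊩ B.subst (Subst.cons t θ)) : w ⊩ (Form.ex a B).subst θ := by
  rw [← Form.subst_lift_inst] at h
  exact Der.exR t h

/-- A forced existential need not have a witness at the world itself, so the rule is stated with a
goal and a continuation. The continuation is used only at the generic extension, by a fresh
eigenvariable and the corresponding hypothesis; quantifying over all extensions hides that choice.
-/
theorem ex_elim {a : Ty} {B : Form (a :: w.ctx)} {C : Form w.ctx} (h : w ⊩ Form.ex a B)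
    (k : ∀ (w' : World) (e : Hom w w') (t : Tm w'.ctx a), w' ⊩ B.subst (Subst.cons t e.θ) →
      w' ⊩ C.subst e.θ) : w ⊩ C := by
  have h' := k ((w.extend a).assume B) ((Hom.extend w a).comp (Hom.assume (w.extend a) B)) (.var .z)
  simp only [Hom.comp_θ, Hom.extend, Hom.assume, Subst.comp_id, Subst.cons_z_weak,
    Form.subst_id] at h'
  exact h.cut (Der.exL (h' (Forces.assume (w := w.extend a) B)))

/-- Definitional reflection. -/
theorem def_elim {as : List Ty} {p : Pred as} {us : Args w.ctx as} {C : Form w.ctx}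
    (h : w ⊩ Form.pred p us)
    (k : ∀ (w' : World) (e : Hom w w'), ∀ c ∈ clausesAll, ∀ ρ : Subst c.vars w'.ctx,
      Form.pred p (us.subst e.θ) = Form.pred c.pred (c.args.subst ρ) → w' ⊩ c.body.subst ρ →
      w' ⊩ C.subst e.θ) : w ⊩ C := by
  -- With all unifiers as the complete set, each unifier becomes an extension whose context is the
  -- range of the unifier and whose new hypothesis is the body of the clause.
  refine h.cut (Der.defL (fun c => Set.univ) (fun c _ ρ => ⟨ρ, trivial, Subst.id, ?_, ?_⟩) ?_)
  · rw [Subst.comp_id]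
  · rw [Subst.comp_id]
  · intro c hc θ _
    exact k ⟨θ.cod, c.body.subst θ.right ::ₘ w.hyps.map (Form.subst θ.left)⟩
      ⟨θ.left, fun A hA => Der.of_mem (Multiset.mem_cons_of_mem (Multiset.mem_map_of_mem _ hA))⟩
      c hc θ.right θ.eq (Der.refl _ _)

theorem def_intro {c : Clause} (hc : c ∈ clausesAll) (ρ : Subst c.vars w.ctx)
    (h : w ⊩ c.body.subst ρ) : w ⊩ Form.pred c.pred (c.args.subst ρ) :=
  Der.defR c hc ρ rfl h

end Forces

/-- The content of a formula at a world, with universal quantifiers, implications and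
conjunctions in positive positions expressed by those of the ambient logic. -/
def Sat : ∀ {Δ : Ctx}, Form Δ → ∀ w : World, Subst Δ w.ctx → Prop
  | _, .imp A B, w, θ => (w ⊩ A.subst θ) → Sat B w θ
  | _, .all a B, w, θ => ∀ t : Tm w.ctx a, Sat B w (Subst.cons t θ)
  | _, .and A B, w, θ => Sat A w θ ∧ Sat B w θ
  | _, .bot, w, _ => w ⊩ .bot
  | _, .top, w, _ => w ⊩ .top
  | _, .or A B, w, θ => w ⊩ (Form.or A B).subst θ
  | _, .ex a B, w, θ => w ⊩ (Form.ex a B).subst θ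
  | _, .nat t, w, θ => w ⊩ (Form.nat t).subst θ
  | _, .pred p ts, w, θ => w ⊩ (Form.pred p ts).subst θ

theorem Forces.sat {Δ : Ctx} {A : Form Δ} : ∀ {w : World} {θ : Subst Δ w.ctx},
    w ⊩ A.subst θ → Sat A w θ := by
  induction A with
  | imp A B _ ih => exact fun h h' => ih (h.imp_elim h')
  | all a B ih => exact fun h t => ih (h.all_elim t)
  | and A B ihA ihB => exact fun h => ⟨ihA h.and_left, ihB h.and_right⟩
  | _ => exact fun h => h

/-- The premise ranges over all extensions because the right rules for implication and universal
quantification work at a world with a new hypothesis or a new eigenvariable. -/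
theorem Forces.of_sat {Δ : Ctx} {A : Form Δ} : ∀ {w : World} {θ : Subst Δ w.ctx},
    (∀ (w' : World) (e : Hom w w'), Sat A w' (θ.comp e.θ)) → w ⊩ A.subst θ := by
  have key : ∀ {Δ : Ctx} {A : Form Δ} {w : World} {θ : Subst Δ w.ctx},
      (∀ w' (e : Hom w w'), w' ⊩ A.subst (θ.comp e.θ)) → w ⊩ A.subst θ := by
    intro Δ A w θ h
    have := h w (Hom.id w)
    rwa [Hom.id_θ, Subst.comp_id] at this
  induction A with
  | imp A B _ ih =>
    intro w θ h
    refine Der.impR (ih (w := w.assume (A.subst θ)) fun w' e => ?_)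
    have h' := h w' ((Hom.assume w (A.subst θ)).comp e)
    simp only [Hom.comp_θ, Hom.assume, Subst.id_comp] at h'
    refine h' ?_
    rw [← Form.subst_subst]
    exact (Forces.assume (A.subst θ)).mono e
  | all a B ih =>
    intro w θ h
    refine Der.allR (ih (w := w.extend a) fun w' e => ?_)
    -- The instance needed is the image of the new eigenvariable under the extension.
    have h' := h w' ((Hom.extend w a).comp e) (e.θ _ .z)
    refine cast (congrArg (Sat B w') ?_) h'
    rw [Subst.lift_eq_cons, Subst.cons_comp, Tm.subst_var, Subst.comp_assoc]
    rfl
  | and A B ihA ihB =>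
    exact fun h => Forces.and_intro (ihA fun w' e => (h w' e).1) (ihB fun w' e => (h w' e).2)
  | bot => exact fun h => key (A := .bot) h
  | top => exact fun h => .topR
  | or A B => exact fun h => key h
  | ex a B => exact fun h => key h
  | nat t => exact fun h => key h
  | pred p ts => exact fun h => key h

theorem derivable_of_sat {A : Form []} (h : ∀ w : World, Sat A w Subst.empty) :
    Derivable lambdaDefinition A := by
  have hA : (⟨[], 0⟩ : World) ⊩ A.subst Subst.empty :=
    Forces.of_sat fun w' e => by rw [Subst.empty_comp]; exact h w'
  rwa [← Subst.eq_empty Subst.id, Form.subst_id] at hA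

/-- The induction rule. -/
theorem Forces.nat_induction (B : Form [nt])
    (h₀ : ∀ w : World, w ⊩ B.subst (Subst.cons zero Subst.empty))
    (h₁ : ∀ (w : World) (j : Tm w.ctx nt), w ⊩ B.subst (Subst.cons j Subst.empty) →
      w ⊩ B.subst (Subst.cons (succ j) Subst.empty))
    {w : World} {t : Tm w.ctx nt} (h : w ⊩ .nat t) :
    w ⊩ B.subst (Subst.cons t Subst.empty) := by
  have key : ∀ {Θ : Ctx} (σ : Subst (nt :: w.ctx) Θ),
      (B.subst (Subst.cons (.var .z) Subst.empty)).subst σ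
        = B.subst (Subst.cons (σ _ .z) Subst.empty) := by
    intro Θ σ
    rw [Form.subst_subst, Subst.cons_comp, Tm.subst_var, Subst.empty_comp]
  -- The first two premises carry no side hypotheses. They are obtained from `h₀` at a world without
  -- hypotheses and from `h₁` at a world whose only hypothesis is the invariant.
  refine h.cut (Der.natL (B.subst (Subst.cons (.var .z) Subst.empty)) ?_ ?_ ?_)
  · rw [Form.inst, key]; exact h₀ ⟨w.ctx, 0⟩
  · rw [key]; exact h₁ ⟨_, _⟩ _ (Der.refl _ 0)
  · rw [Form.inst, key]; exact Der.refl _ _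

/-! ## Equations between terms of the object logic -/

/-- Both sides are neutral of base type, and such terms are convertible only if they are equal as
neutral terms. -/
theorem Tm.app_const_inj {Γ : Ctx} {a : Ty} {b : Base} {c : Const (a →ₜ .base b)}
    {t t' : Tm Γ a} : Tm.app (.const c) t = Tm.app (.const c) t' ↔ t = t' := by
  refine ⟨fun h => ?_, fun h => by rw [h]⟩
  have h' := Ne.toTm_injective (n := .app (.const c) t) (n' := .app (.const c) t') h
  cases h'; rfl

theorem Tm.app_app_const_inj {Γ : Ctx} {a a' : Ty} {b : Base} {c : Const (a →ₜ a' →ₜ .base b)}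
    {t t' : Tm Γ a} {u u' : Tm Γ a'} :
    Tm.app (.app (.const c) t) u = Tm.app (.app (.const c) t') u' ↔ t = t' ∧ u = u' := by
  refine ⟨fun h => ?_, fun h => by rw [h.1, h.2]⟩
  have h' := Ne.toTm_injective (n := .app (.app (.const c) t) u)
    (n' := .app (.app (.const c) t') u') h
  cases h'; exact ⟨rfl, rfl⟩

/-- Numbers the constants, so that terms with different head constants are told apart by a
conversion-invariant value. -/
def Const.code : ∀ {a : Ty}, Const a → ℕ
  | _, .zero => 0
  | _, .succ => 1
  | _, .nil => 2
  | _, .cons => 3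
  | _, .atom => 4
  | _, .tt => 5
  | _, .conj => 6
  | _, .impl => 7
  | _, .forallI => 8
  | _, .abs => 9
  | _, .app => 10
  | _, .gnd => 11
  | _, .arr => 12
  | _, .typeof => 13
  | _, .natsem => 14
  | _, .transone => 15
  | _, .transsem => 16

def Ne.code {Γ : Ctx} : ∀ {a : Ty}, Ne Γ a → Option ℕ
  | _, .var _ => none
  | _, .const c => some c.code
  | _, .app n _ => n.code

/-- A code for the constant at the head of the normal form of a term of base type. -/
def Tm.code {Γ : Ctx} {b : Base} (t : Tm Γ (.base b)) : Option ℕ := Ne.code t.eval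

theorem Ne.code_toTm {Γ : Ctx} {b : Base} (n : Ne Γ (.base b)) : n.toTm.code = n.code :=
  congrArg Ne.code n.eval_toTm

section
variable {Γ Δ : Ctx}

@[simp] theorem code_zero : (zero : Tm Γ nt).code = some 0 := Ne.code_toTm (.const .zero)
@[simp] theorem code_succ (t : Tm Γ nt) : (succ t).code = some 1 :=
  Ne.code_toTm (.app (.const .succ) t)
@[simp] theorem code_nil : (nil : Tm Γ atmlst).code = some 2 := Ne.code_toTm (.const .nil)
@[simp] theorem code_cons (x : Tm Γ atm) (l : Tm Γ atmlst) : (cons x l).code = some 3 :=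
  Ne.code_toTm (.app (.app (.const .cons) x) l)
@[simp] theorem code_atom (x : Tm Γ atm) : (atom x).code = some 4 :=
  Ne.code_toTm (.app (.const .atom) x)
@[simp] theorem code_tt : (tt : Tm Γ prp).code = some 5 := Ne.code_toTm (.const .tt)
@[simp] theorem code_conj (b c : Tm Γ prp) : (conj b c).code = some 6 :=
  Ne.code_toTm (.app (.app (.const .conj) b) c)
@[simp] theorem code_impl (x : Tm Γ atm) (b : Tm Γ prp) : (impl x b).code = some 7 :=
  Ne.code_toTm (.app (.app (.const .impl) x) b)
@[simp] theorem code_forallI (b : Tm Γ (ι →ₜ prp)) : (forallI b).code = some 8 :=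
  Ne.code_toTm (.app (.const .forallI) b)
@[simp] theorem code_abs (r : Tm Γ (ι →ₜ ι)) : (abs r).code = some 9 :=
  Ne.code_toTm (.app (.const .abs) r)
@[simp] theorem code_app (m n : Tm Γ ι) : (app m n).code = some 10 :=
  Ne.code_toTm (.app (.app (.const .app) m) n)
@[simp] theorem code_typeof (m n : Tm Γ ι) : (typeof m n).code = some 13 :=
  Ne.code_toTm (.app (.app (.const .typeof) m) n)
@[simp] theorem code_natsem (m n : Tm Γ ι) : (natsem m n).code = some 14 :=
  Ne.code_toTm (.app (.app (.const .natsem) m) n)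
@[simp] theorem code_transone (m n : Tm Γ ι) : (transone m n).code = some 15 :=
  Ne.code_toTm (.app (.app (.const .transone) m) n)
@[simp] theorem code_transsem (m n : Tm Γ ι) : (transsem m n).code = some 16 :=
  Ne.code_toTm (.app (.app (.const .transsem) m) n)

@[simp] theorem succ_inj {t u : Tm Γ nt} : succ t = succ u ↔ t = u := Tm.app_const_inj
@[simp] theorem cons_inj {x y : Tm Γ atm} {l k : Tm Γ atmlst} :
    cons x l = cons y k ↔ x = y ∧ l = k := Tm.app_app_const_inj
@[simp] theorem atom_inj {x y : Tm Γ atm} : atom x = atom y ↔ x = y := Tm.app_const_inj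
@[simp] theorem conj_inj {b c b' c' : Tm Γ prp} : conj b c = conj b' c' ↔ b = b' ∧ c = c' :=
  Tm.app_app_const_inj
@[simp] theorem impl_inj {x y : Tm Γ atm} {b c : Tm Γ prp} :
    impl x b = impl y c ↔ x = y ∧ b = c := Tm.app_app_const_inj
@[simp] theorem forallI_inj {b c : Tm Γ (ι →ₜ prp)} : forallI b = forallI c ↔ b = c :=
  Tm.app_const_inj
@[simp] theorem abs_inj {r r' : Tm Γ (ι →ₜ ι)} : abs r = abs r' ↔ r = r' := Tm.app_const_inj
@[simp] theorem app_inj {m n m' n' : Tm Γ ι} : app m n = app m' n' ↔ m = m' ∧ n = n' :=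
  Tm.app_app_const_inj
@[simp] theorem arr_inj {m n m' n' : Tm Γ ι} : arr m n = arr m' n' ↔ m = m' ∧ n = n' :=
  Tm.app_app_const_inj
@[simp] theorem typeof_inj {m n m' n' : Tm Γ ι} : typeof m n = typeof m' n' ↔ m = m' ∧ n = n' :=
  Tm.app_app_const_inj
@[simp] theorem natsem_inj {m n m' n' : Tm Γ ι} : natsem m n = natsem m' n' ↔ m = m' ∧ n = n' :=
  Tm.app_app_const_inj
@[simp] theorem transone_inj {m n m' n' : Tm Γ ι} :
    transone m n = transone m' n' ↔ m = m' ∧ n = n' := Tm.app_app_const_inj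
@[simp] theorem transsem_inj {m n m' n' : Tm Γ ι} :
    transsem m n = transsem m' n' ↔ m = m' ∧ n = n' := Tm.app_app_const_inj

theorem succ_ne_zero (t : Tm Γ nt) : succ t ≠ zero := fun h => by
  simpa using congrArg Tm.code h

theorem app_ne_abs (m n : Tm Γ ι) (r : Tm Γ (ι →ₜ ι)) : app m n ≠ abs r := fun h => by
  simpa using congrArg Tm.code h

theorem cons_ne_nil (x : Tm Γ atm) (l : Tm Γ atmlst) : cons x l ≠ nil := fun h => by
  simpa using congrArg Tm.code h

/-! ## Substitution in terms and formulas of the object logic -/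

variable (θ : Subst Γ Δ)

@[simp] theorem subst_zero : (zero : Tm Γ nt).subst θ = zero := rfl
@[simp] theorem subst_succ (t : Tm Γ nt) : (succ t).subst θ = succ (t.subst θ) := by simp [succ]
@[simp] theorem subst_nil : (nil : Tm Γ atmlst).subst θ = nil := rfl
@[simp] theorem subst_cons (x : Tm Γ atm) (l : Tm Γ atmlst) :
    (cons x l).subst θ = cons (x.subst θ) (l.subst θ) := by simp [cons]
@[simp] theorem subst_atom (x : Tm Γ atm) : (atom x).subst θ = atom (x.subst θ) := by simp [atom]
@[simp] theorem subst_tt : (tt : Tm Γ prp).subst θ = tt := rfl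
@[simp] theorem subst_conj (b c : Tm Γ prp) :
    (conj b c).subst θ = conj (b.subst θ) (c.subst θ) := by simp [conj]
@[simp] theorem subst_impl (x : Tm Γ atm) (b : Tm Γ prp) :
    (impl x b).subst θ = impl (x.subst θ) (b.subst θ) := by simp [impl]
@[simp] theorem subst_forallI (b : Tm Γ (ι →ₜ prp)) :
    (forallI b).subst θ = forallI (b.subst θ) := by simp [forallI]
@[simp] theorem subst_abs (r : Tm Γ (ι →ₜ ι)) : (abs r).subst θ = abs (r.subst θ) := by simp [abs]
@[simp] theorem subst_app (m n : Tm Γ ι) :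
    (app m n).subst θ = app (m.subst θ) (n.subst θ) := by simp [app]
@[simp] theorem subst_arr (m n : Tm Γ ι) :
    (arr m n).subst θ = arr (m.subst θ) (n.subst θ) := by simp [arr]
@[simp] theorem subst_typeof (m n : Tm Γ ι) :
    (typeof m n).subst θ = typeof (m.subst θ) (n.subst θ) := by simp [typeof]
@[simp] theorem subst_natsem (m n : Tm Γ ι) :
    (natsem m n).subst θ = natsem (m.subst θ) (n.subst θ) := by simp [natsem]
@[simp] theorem subst_transone (m n : Tm Γ ι) :
    (transone m n).subst θ = transone (m.subst θ) (n.subst θ) := by simp [transone]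
@[simp] theorem subst_transsem (m n : Tm Γ ι) :
    (transsem m n).subst θ = transsem (m.subst θ) (n.subst θ) := by simp [transsem]

@[simp] theorem wk_subst_cons {a b : Ty} (t : Tm Γ a) (u : Tm Δ b) :
    (t.wk).subst (Subst.cons u θ) = t.subst θ := by
  rw [Tm.wk_eq_subst, Tm.subst_subst, Subst.weak_comp_cons]

theorem wk_subst_lift {a b : Ty} (t : Tm Γ a) :
    (t.wk : Tm (b :: Γ) a).subst θ.lift = (t.subst θ).wk := by
  rw [Tm.wk_eq_subst, Tm.wk_eq_subst, Tm.subst_subst, Tm.subst_subst, Subst.weak_comp_lift]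

@[simp] theorem lift_z {b : Ty} : (θ.lift : Subst (b :: Γ) (b :: Δ)) b .z = .var .z := rfl

@[simp] theorem lift_s {a b : Ty} (x : Var Γ a) :
    (θ.lift : Subst (b :: Γ) (b :: Δ)) a (.s x) = (θ a x).wk := rfl

@[simp] theorem subst_nat (t : Tm Γ nt) : (Form.nat t).subst θ = .nat (t.subst θ) := rfl
@[simp] theorem subst_element (x : Tm Γ atm) (l : Tm Γ atmlst) :
    (element x l).subst θ = element (x.subst θ) (l.subst θ) := rfl
@[simp] theorem subst_seq (t : Tm Γ nt) (l : Tm Γ atmlst) (b : Tm Γ prp) :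
    (seq t l b).subst θ = seq (t.subst θ) (l.subst θ) (b.subst θ) := rfl
@[simp] theorem subst_prog (x : Tm Γ atm) (b : Tm Γ prp) :
    (prog x b).subst θ = prog (x.subst θ) (b.subst θ) := rfl
@[simp] theorem subst_same (m n : Tm Γ ι) : (same m n).subst θ = same (m.subst θ) (n.subst θ) := rfl
@[simp] theorem subst_prvv (l : Tm Γ atmlst) (b : Tm Γ prp) :
    (prvv l b).subst θ = prvv (l.subst θ) (b.subst θ) := by
  simp only [prvv, Form.subst, subst_seq, wk_subst_lift, Tm.subst_var, lift_z]
@[simp] theorem subst_prv (x : Tm Γ atm) : (prv x).subst θ = prv (x.subst θ) := by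
  simp only [prv, subst_prvv, subst_nil, subst_atom]

end

/-! ### Content of the formulas that serve as invariants -/

section
variable {Δ : Ctx} (w : World) (θ : Subst Δ w.ctx)

@[simp] theorem sat_imp (A B : Form Δ) : Sat (A ⊃ₘ B) w θ ↔ ((w ⊩ A.subst θ) → Sat B w θ) := Iff.rfl
@[simp] theorem sat_all (a : Ty) (B : Form (a :: Δ)) :
    Sat (.all a B) w θ ↔ ∀ t : Tm w.ctx a, Sat B w (Subst.cons t θ) := Iff.rfl
@[simp] theorem sat_and (A B : Form Δ) : Sat (A ∧ₘ B) w θ ↔ Sat A w θ ∧ Sat B w θ := Iff.rfl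
@[simp] theorem sat_ex (a : Ty) (B : Form (a :: Δ)) :
    Sat (.ex a B) w θ ↔ w ⊩ (Form.ex a B).subst θ := Iff.rfl
@[simp] theorem sat_nat (t : Tm Δ nt) : Sat (.nat t) w θ ↔ w ⊩ .nat (t.subst θ) := Iff.rfl
@[simp] theorem sat_element (x : Tm Δ atm) (l : Tm Δ atmlst) :
    Sat (element x l) w θ ↔ w ⊩ element (x.subst θ) (l.subst θ) := Iff.rfl
@[simp] theorem sat_seq (t : Tm Δ nt) (l : Tm Δ atmlst) (b : Tm Δ prp) :
    Sat (seq t l b) w θ ↔ w ⊩ seq (t.subst θ) (l.subst θ) (b.subst θ) := Iff.rfl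
@[simp] theorem sat_same (m n : Tm Δ ι) :
    Sat (same m n) w θ ↔ w ⊩ same (m.subst θ) (n.subst θ) := Iff.rfl
@[simp] theorem sat_prv (x : Tm Δ atm) : Sat (prv x) w θ ↔ w ⊩ prv (x.subst θ) := by
  rw [← subst_prv]; exact Iff.rfl

end

theorem sat_subst {Δ : Ctx} (A : Form Δ) : ∀ {Θ : Ctx} (w : World) (σ : Subst Δ Θ)
    (θ : Subst Θ w.ctx), Sat (A.subst σ) w θ ↔ Sat A w (σ.comp θ) := by
  induction A with
  | imp A B _ ih => intro Θ w σ θ; simp only [Form.subst, sat_imp, ih, Form.subst_subst]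
  | all a B ih => intro Θ w σ θ; simp only [Form.subst, sat_all, ih, Subst.lift_comp_cons]
  | and A B ihA ihB => intro Θ w σ θ; simp only [Form.subst, sat_and, ihA, ihB]
  | bot => intros; rfl
  | top => intros; rfl
  | _ =>
    intro Θ w σ θ
    simp only [Sat, Form.subst, Tm.subst_subst, Args.subst_subst, Form.subst_subst,
      Subst.lift_comp_lift]

/-! ## Induction -/

/-- The hypothesis of the step is given at all extensions, as is needed to recover the forced
invariant from its content. -/
theorem Sat.nat_induction (B : Form [nt])
    (h₀ : ∀ w : World, Sat B w (Subst.cons zero Subst.empty))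
    (h₁ : ∀ (w : World) (j : Tm w.ctx nt),
      (∀ (w' : World) (e : Hom w w'), Sat B w' (Subst.cons (j.subst e.θ) Subst.empty)) →
      Sat B w (Subst.cons (succ j) Subst.empty))
    {w : World} {t : Tm w.ctx nt} (h : w ⊩ .nat t) : Sat B w (Subst.cons t Subst.empty) := by
  refine Forces.sat (Forces.nat_induction B (fun w => ?_) (fun w j hj => ?_) h)
  · exact Forces.of_sat fun w' e => by simpa using h₀ w'
  · refine Forces.of_sat fun w' e => ?_
    simp only [Subst.cons_comp, subst_succ, Subst.empty_comp]
    refine h₁ w' _ fun w'' e' => Forces.sat ?_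
    have := (hj.mono e).mono e'
    simpa [Form.subst_subst, Subst.comp_assoc, Tm.subst_subst] using this

/-- Induction with the hypothesis for the two preceding numbers. -/
theorem Sat.nat_induction₂ (B : Form [nt])
    (step : ∀ (w : World) (j : Tm w.ctx nt),
      (∀ (w' : World) (e : Hom w w') (k : Tm w'.ctx nt),
        j.subst e.θ = succ k ∨ j.subst e.θ = succ (succ k) →
        (w' ⊩ .nat k) ∧ Sat B w' (Subst.cons k Subst.empty)) →
      Sat B w (Subst.cons j Subst.empty))
    {w : World} {t : Tm w.ctx nt} (h : w ⊩ .nat t) : Sat B w (Subst.cons t Subst.empty) := by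
  have h₀ : ∀ w : World, Sat B w (Subst.cons zero Subst.empty) := fun w =>
    step w zero fun w' e k hk => by
      rcases hk with hk | hk
      · exact absurd hk.symm (succ_ne_zero _)
      · exact absurd hk.symm (succ_ne_zero _)
  have key : ∀ (w : World) (j : Tm w.ctx nt),
      Sat (B.subst (Subst.cons (succ v0) Subst.empty)) w (Subst.cons j Subst.empty) ↔
        Sat B w (Subst.cons (succ j) Subst.empty) := by
    intro w j
    rw [sat_subst]; simp
  -- The invariant carries its own successor instance, which gives access to two preceding numbers,
  -- and also `nat`, so that the predecessors handed to `step` are known to be natural numbers.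
  have h' := Sat.nat_induction (.nat v0 ∧ₘ B ∧ₘ B.subst (Subst.cons (succ v0) Subst.empty))
    (fun w => ?_) (fun w j ih => ?_) h
  · exact h'.2.1
  · refine ⟨by rw [sat_nat, Tm.subst_var]; exact Der.natR_zero, h₀ w, (key w _).2 (step w _ fun w' e k hk => ?_)⟩
    simp only [subst_succ, subst_zero, succ_inj] at hk
    rcases hk with rfl | hk
    · exact ⟨Der.natR_zero, h₀ w'⟩
    · exact absurd hk.symm (succ_ne_zero _)
  · simp only [sat_and, key, sat_nat, Tm.subst_var, Subst.cons_z] at ih ⊢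
    have hid := ih w (Hom.id w)
    simp only [Hom.id_θ, Tm.subst_id] at hid
    refine ⟨Der.natR_succ hid.1, hid.2.2, step w _ fun w' e k hk => ?_⟩
    have he := ih w' e
    simp only [subst_succ, succ_inj] at hk
    rcases hk with rfl | hk
    · exact ⟨Der.natR_succ he.1, he.2.2⟩
    · exact hk ▸ ⟨he.1, he.2.1⟩

/-! ## Inversion of the definition -/

theorem Forces.iff_sat {w : World} {A : Form w.ctx} :
    (w ⊩ A) ↔ ∀ (w' : World) (e : Hom w w'), Sat A w' e.θ := by
  refine ⟨fun h w' e => (h.mono e).sat, fun h => ?_⟩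
  have := Forces.of_sat (A := A) (w := w) (θ := Subst.id) fun w' e => by
    rw [Subst.id_comp]; exact h w' e
  rwa [Form.subst_id] at this

theorem Forces.prvv_intro {w : World} {j : Tm w.ctx nt} {l : Tm w.ctx atmlst} {b : Tm w.ctx prp}
    (hj : w ⊩ .nat j) (h : w ⊩ seq j l b) : w ⊩ prvv l b := by
  have h' := Forces.ex_intro (w := w) (θ := Subst.id) (a := nt)
    (B := .nat v0 ∧ₘ seq v0 l.wk b.wk) j (by
      simp only [Form.subst, subst_seq, Tm.subst_var, Subst.cons_z, wk_subst_cons, Tm.subst_id]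
      exact hj.and_intro h)
  rwa [Form.subst_id] at h'

theorem Forces.prvv_elim {w : World} {l : Tm w.ctx atmlst} {b : Tm w.ctx prp} {C : Form w.ctx}
    (h : w ⊩ prvv l b)
    (k : ∀ (w' : World) (e : Hom w w') (j : Tm w'.ctx nt), (w' ⊩ .nat j) →
      (w' ⊩ seq j (l.subst e.θ) (b.subst e.θ)) → w' ⊩ C.subst e.θ) : w ⊩ C := by
  refine Forces.ex_elim h fun w' e t ht => ?_
  simp only [Form.subst, subst_seq, Tm.subst_var, Subst.cons_z, wk_subst_cons] at ht
  exact k w' e t ht.and_left ht.and_right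

theorem Forces.prv_intro {w : World} {j : Tm w.ctx nt} {x : Tm w.ctx atm}
    (hj : w ⊩ .nat j) (h : w ⊩ seq j nil (atom x)) : w ⊩ prv x :=
  Forces.prvv_intro hj h

theorem Forces.prv_elim {w : World} {x : Tm w.ctx atm} {C : Form w.ctx} (h : w ⊩ prv x)
    (k : ∀ (w' : World) (e : Hom w w') (j : Tm w'.ctx nt), (w' ⊩ .nat j) →
      (w' ⊩ seq j nil (atom (x.subst e.θ))) → w' ⊩ C.subst e.θ) : w ⊩ C :=
  Forces.prvv_elim h fun w' e j hj hs => k w' e j hj (by simpa using hs)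

theorem Forces.same_refl {w : World} (m : Tm w.ctx ι) : w ⊩ same m m := by
  have h := Forces.def_intro (w := w) (c := clauseSame) (by simp [clausesAll])
    (Subst.cons m Subst.empty) .topR
  simpa [clauseSame, Args.subst, same] using h

theorem Forces.same_elim {w : World} {m n : Tm w.ctx ι} {C : Form w.ctx} (h : w ⊩ same m n)
    (k : ∀ (w' : World) (e : Hom w w'), m.subst e.θ = n.subst e.θ → w' ⊩ C.subst e.θ) :
    w ⊩ C := by
  refine Forces.def_elim h fun w' e c hc ρ heq _ => k w' e ?_
  simp only [clausesAll, clausesNat, clausesList, clausesIntuit, clausesLambda, clauseSame,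
    List.cons_append, List.nil_append, List.mem_cons, List.not_mem_nil, or_false] at hc
  -- Clauses for other predicates are refuted by the equation between the heads; a single clause
  -- remains.
  rcases hc with rfl | rfl | rfl | rfl | rfl | rfl | rfl | rfl | rfl | rfl | rfl | rfl | rfl |
    rfl | rfl | rfl | rfl | rfl | rfl | rfl | rfl | rfl | rfl | rfl | rfl | rfl | rfl | rfl |
    rfl | rfl | rfl | rfl <;> simp [Args.subst] at heq
  exact heq.1.trans heq.2.symm

theorem Forces.element_elim {w : World} {x : Tm w.ctx atm} {l : Tm w.ctx atmlst} {C : Form w.ctx}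
    (h : w ⊩ element x l)
    (k : ∀ (w' : World) (e : Hom w w'), (∃ (y : Tm w'.ctx atm) (l' : Tm w'.ctx atmlst),
      l.subst e.θ = cons y l' ∧ (x.subst e.θ = y ∨ w' ⊩ element (x.subst e.θ) l')) →
      w' ⊩ C.subst e.θ) : w ⊩ C := by
  refine Forces.def_elim h fun w' e c hc ρ heq hb => k w' e ?_
  simp only [clausesAll, clausesNat, clausesList, clausesIntuit, clausesLambda, clauseSame,
    List.cons_append, List.nil_append, List.mem_cons, List.not_mem_nil, or_false] at hc
  rcases hc with rfl | rfl | rfl | rfl | rfl | rfl | rfl | rfl | rfl | rfl | rfl | rfl | rfl |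
    rfl | rfl | rfl | rfl | rfl | rfl | rfl | rfl | rfl | rfl | rfl | rfl | rfl | rfl | rfl |
    rfl | rfl | rfl | rfl <;> simp [Args.subst] at heq
  · exact ⟨_, _, heq.2, Or.inl heq.1⟩
  · simp at hb
    rw [← heq.1] at hb
    exact ⟨_, _, heq.2, Or.inr hb⟩

theorem Forces.element_head {w : World} (x : Tm w.ctx atm) (l : Tm w.ctx atmlst) :
    w ⊩ element x (cons x l) := by
  have h := Forces.def_intro (w := w)
    (c := ⟨[atmlst, atm], .element, .two v1 (cons v1 v0), .top⟩)
    (by simp [clausesAll, clausesList])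
    (Subst.cons l (Subst.cons x Subst.empty)) .topR
  simpa [Args.subst, element] using h

theorem Forces.element_tail {w : World} {x : Tm w.ctx atm} {l : Tm w.ctx atmlst}
    (y : Tm w.ctx atm) (h : w ⊩ element x l) : w ⊩ element x (cons y l) := by
  have h := Forces.def_intro (w := w)
    (c := ⟨[atmlst, atm, atm], .element, .two v2 (cons v1 v0), element v2 v0⟩)
    (by simp [clausesAll, clausesList])
    (Subst.cons l (Subst.cons y (Subst.cons x Subst.empty))) (by simpa using h)
  simpa [Args.subst, element] using h

/-- The possible derivations of sequents of the object logic. -/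
inductive SeqView (w : World) : Tm w.ctx nt → Tm w.ctx atmlst → Tm w.ctx prp → Prop
  | init (i : Tm w.ctx nt) (x' : Tm w.ctx atm) (l : Tm w.ctx atmlst) (x : Tm w.ctx atm) :
      w ⊩ element x (cons x' l) → SeqView w i (cons x' l) (atom x)
  | tt (i : Tm w.ctx nt) (l : Tm w.ctx atmlst) : SeqView w i l tt
  | conj {i : Tm w.ctx nt} {l : Tm w.ctx atmlst} {b c : Tm w.ctx prp} :
      w ⊩ seq i l b → w ⊩ seq i l c → SeqView w (succ i) l (conj b c)
  | impl {i : Tm w.ctx nt} {l : Tm w.ctx atmlst} {x : Tm w.ctx atm} {b : Tm w.ctx prp} :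
      w ⊩ seq i (cons x l) b → SeqView w (succ i) l (impl x b)
  | forallI {i : Tm w.ctx nt} {l : Tm w.ctx atmlst} {b : Tm w.ctx (ι →ₜ prp)} :
      (∀ (w' : World) (e : Hom w w') (x : Tm w'.ctx ι),
        w' ⊩ seq (i.subst e.θ) (l.subst e.θ) (.app (b.subst e.θ) x)) →
      SeqView w (succ i) l (forallI b)
  | prog {i : Tm w.ctx nt} {l : Tm w.ctx atmlst} {x : Tm w.ctx atm} {b : Tm w.ctx prp} :
      w ⊩ prog x b → w ⊩ seq i l b → SeqView w (succ i) l (atom x)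

theorem Forces.seq_elim {w : World} {j : Tm w.ctx nt} {l : Tm w.ctx atmlst} {b : Tm w.ctx prp}
    {C : Form w.ctx} (h : w ⊩ seq j l b)
    (k : ∀ (w' : World) (e : Hom w w'),
      SeqView w' (j.subst e.θ) (l.subst e.θ) (b.subst e.θ) → w' ⊩ C.subst e.θ) : w ⊩ C := by
  refine Forces.def_elim h fun w' e c hc ρ heq hb => ?_
  simp only [clausesAll, clausesNat, clausesList, clausesIntuit, clausesLambda, clauseSame,
    List.cons_append, List.nil_append, List.mem_cons, List.not_mem_nil, or_false] at hc
  rcases hc with rfl | rfl | rfl | rfl | rfl | rfl | rfl | rfl | rfl | rfl | rfl | rfl | rfl |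
    rfl | rfl | rfl | rfl | rfl | rfl | rfl | rfl | rfl | rfl | rfl | rfl | rfl | rfl | rfl |
    rfl | rfl | rfl | rfl <;> simp [Args.subst] at heq
  · refine k w' e ?_
    rw [heq.2.1, heq.2.2]
    exact .init _ _ _ _ (by simpa using hb)
  · refine k w' e ?_
    rw [heq.2.2]
    exact .tt _ _
  · refine k w' e ?_
    rw [heq.1, heq.2.1, heq.2.2]
    exact .conj (by simpa using hb.and_left) (by simpa using hb.and_right)
  · refine k w' e ?_
    rw [heq.1, heq.2.1, heq.2.2]
    exact .impl (by simpa using hb)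
  · refine k w' e ?_
    rw [heq.1, heq.2.1, heq.2.2]
    refine .forallI fun w'' e' x => ?_
    have h' := (hb.mono e')
    rw [Form.subst_subst] at h'
    have h'' := h'.all_elim x
    simpa [Subst.comp] using h''
  -- Of the clauses for `seq` only this one has an existential body, so the goal is reached one
  -- extension later, at `e.comp e'`.
  · refine Forces.ex_elim hb fun w'' e' b hb => ?_
    rw [Form.subst_subst] at hb ⊢
    refine k w'' (e.comp e') ?_
    simp only [Hom.comp_θ, ← Tm.subst_subst]
    rw [heq.1, heq.2.1, heq.2.2]
    simp only [subst_succ, subst_atom]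
    refine .prog (b := b) ?_ ?_
    · simpa [Subst.comp] using hb.and_left
    · simpa [Subst.comp] using hb.and_right

theorem SeqView.forces {w : World} {j : Tm w.ctx nt} {l : Tm w.ctx atmlst} {b : Tm w.ctx prp}
    (h : SeqView w j l b) : w ⊩ seq j l b := by
  cases h with
  | init i x' l x h =>
    have h := Forces.def_intro (w := w) (c := ⟨[atm, atmlst, atm, nt], .seq,
      .three v3 (cons v2 v1) (atom v0), element v0 (cons v2 v1)⟩)
      (by simp [clausesAll, clausesIntuit])
      (Subst.cons x (Subst.cons l (Subst.cons x' (Subst.cons j Subst.empty)))) (by simpa using h)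
    simpa [Args.subst, seq] using h
  | tt i l =>
    have h := Forces.def_intro (w := w) (c := ⟨[atmlst, nt], .seq, .three v1 v0 FOLDN.tt, .top⟩)
      (by simp [clausesAll, clausesIntuit])
      (Subst.cons l (Subst.cons j Subst.empty)) .topR
    simpa [Args.subst, seq] using h
  | @conj i l b c h h' =>
    have h := Forces.def_intro (w := w) (c := ⟨[prp, prp, atmlst, nt], .seq,
      .three (succ v3) v2 (FOLDN.conj v1 v0), seq v3 v2 v1 ∧ₘ seq v3 v2 v0⟩)
      (by simp [clausesAll, clausesIntuit])
      (Subst.cons c (Subst.cons b (Subst.cons l (Subst.cons i Subst.empty))))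
      (by simpa [Form.subst] using h.and_intro h')
    simpa [Args.subst, seq] using h
  | @impl i l x b h =>
    have h := Forces.def_intro (w := w) (c := ⟨[prp, atm, atmlst, nt], .seq,
      .three (succ v3) v2 (FOLDN.impl v1 v0), seq v3 (cons v1 v2) v0⟩)
      (by simp [clausesAll, clausesIntuit])
      (Subst.cons b (Subst.cons x (Subst.cons l (Subst.cons i Subst.empty)))) (by simpa using h)
    simpa [Args.subst, seq] using h
  | @forallI i l b h =>
    have h := Forces.def_intro (w := w) (c := ⟨[ι →ₜ prp, atmlst, nt], .seq,
      .three (succ v2) v1 (FOLDN.forallI v0), .all ι (seq v3 v2 (.app v1 v0))⟩)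
      (by simp [clausesAll, clausesIntuit])
      (Subst.cons b (Subst.cons l (Subst.cons i Subst.empty)))
      (Forces.of_sat fun w' e => by simpa using h w' e)
    simpa [Args.subst, seq] using h
  | @prog i l x b h h' =>
    have h := Forces.def_intro (w := w) (c := ⟨[atm, atmlst, nt], .seq,
      .three (succ v2) v1 (atom v0), .ex prp (FOLDN.prog v1 v0 ∧ₘ seq v3 v2 v0)⟩)
      (by simp [clausesAll, clausesIntuit])
      (Subst.cons x (Subst.cons l (Subst.cons i Subst.empty)))
      (Forces.ex_intro b (by simpa [Form.subst] using h.and_intro h'))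
    simpa [Args.subst, seq] using h

/-- The clauses for typing and evaluation. -/
inductive ProgView {Γ : Ctx} : Tm Γ atm → Tm Γ prp → Prop
  | typeof_abs (r : Tm Γ (ι →ₜ ι)) (t u : Tm Γ ι) : ProgView (typeof (abs r) (arr t u))
      (forallI (.lam (impl (typeof v0 t.wk) (atom (typeof (.app r.wk v0) u.wk)))))
  | typeof_app (m n t u : Tm Γ ι) : ProgView (typeof (app m n) t)
      (conj (atom (typeof m (arr u t))) (atom (typeof n u)))
  | natsem_abs (r : Tm Γ (ι →ₜ ι)) : ProgView (natsem (abs r) (abs r)) tt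
  | natsem_app (m n v : Tm Γ ι) (r : Tm Γ (ι →ₜ ι)) : ProgView (natsem (app m n) v)
      (conj (atom (natsem m (abs r))) (atom (natsem (.app r n) v)))
  | transone_beta (r : Tm Γ (ι →ₜ ι)) (m : Tm Γ ι) :
      ProgView (transone (app (abs r) m) (.app r m)) tt
  | transone_app (m n m' : Tm Γ ι) :
      ProgView (transone (app m n) (app m' n)) (atom (transone m m'))
  | transsem_refl (m : Tm Γ ι) : ProgView (transsem m m) tt
  | transsem_step (m n m' : Tm Γ ι) :
      ProgView (transsem m n) (conj (atom (transone m m')) (atom (transsem m' n)))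

theorem Forces.prog_elim {w : World} {x : Tm w.ctx atm} {b : Tm w.ctx prp} {C : Form w.ctx}
    (h : w ⊩ prog x b) (k : ∀ (w' : World) (e : Hom w w'),
      ProgView (x.subst e.θ) (b.subst e.θ) → w' ⊩ C.subst e.θ) : w ⊩ C := by
  refine Forces.def_elim h fun w' e c hc ρ heq hb => k w' e ?_
  simp only [clausesAll, clausesNat, clausesList, clausesIntuit, clausesLambda, clauseSame,
    List.cons_append, List.nil_append, List.mem_cons, List.not_mem_nil, or_false] at hc
  rcases hc with rfl | rfl | rfl | rfl | rfl | rfl | rfl | rfl | rfl | rfl | rfl | rfl | rfl |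
    rfl | rfl | rfl | rfl | rfl | rfl | rfl | rfl | rfl | rfl | rfl | rfl | rfl | rfl | rfl |
    rfl | rfl | rfl | rfl <;> simp [Args.subst] at heq
  all_goals
    rw [heq.1, heq.2]
    constructor

theorem ProgView.forces {w : World} {x : Tm w.ctx atm} {b : Tm w.ctx prp} (h : ProgView x b) :
    w ⊩ prog x b := by
  -- Every clause for typing and evaluation has body `⊤`, so all instances of the heads are forced
  -- outright.
  have key : ∀ (c : Clause) (ρ : Subst c.vars w.ctx), c ∈ clausesLambda →
      w ⊩ Form.pred c.pred (c.args.subst ρ) := by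
    intro c ρ hc
    refine Forces.def_intro (by simp [clausesAll, hc]) ρ ?_
    simp only [clausesLambda, List.mem_cons, List.not_mem_nil, or_false] at hc
    rcases hc with rfl | rfl | rfl | rfl | rfl | rfl | rfl | rfl <;> exact Der.topR
  cases h with
  | typeof_abs r t u =>
    simpa [Args.subst, prog] using key ⟨[ι, ι, ι →ₜ ι], .prog, .two (typeof (abs v2) (arr v1 v0))
      (forallI (.lam (impl (typeof v0 v2) (atom (typeof (.app v3 v0) v1))))), .top⟩
      (Subst.cons u (Subst.cons t (Subst.cons r Subst.empty))) (by simp [clausesLambda])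
  | typeof_app m n t u =>
    simpa [Args.subst, prog] using key ⟨[ι, ι, ι, ι], .prog, .two (typeof (app v3 v2) v1)
      (conj (atom (typeof v3 (arr v0 v1))) (atom (typeof v2 v0))), .top⟩
      (Subst.cons u (Subst.cons t (Subst.cons n (Subst.cons m Subst.empty))))
      (by simp [clausesLambda])
  | natsem_abs r =>
    simpa [Args.subst, prog] using key ⟨[ι →ₜ ι], .prog, .two (natsem (abs v0) (abs v0)) tt, .top⟩
      (Subst.cons r Subst.empty) (by simp [clausesLambda])
  | natsem_app m n v r =>
    simpa [Args.subst, prog] using key ⟨[ι →ₜ ι, ι, ι, ι], .prog, .two (natsem (app v3 v2) v1)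
      (conj (atom (natsem v3 (abs v0))) (atom (natsem (.app v0 v2) v1))), .top⟩
      (Subst.cons r (Subst.cons v (Subst.cons n (Subst.cons m Subst.empty))))
      (by simp [clausesLambda])
  | transone_beta r m =>
    simpa [Args.subst, prog] using key ⟨[ι, ι →ₜ ι], .prog,
      .two (transone (app (abs v1) v0) (.app v1 v0)) tt, .top⟩
      (Subst.cons m (Subst.cons r Subst.empty)) (by simp [clausesLambda])
  | transone_app m n m' =>
    simpa [Args.subst, prog] using key ⟨[ι, ι, ι], .prog,
      .two (transone (app v2 v1) (app v0 v1)) (atom (transone v2 v0)), .top⟩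
      (Subst.cons m' (Subst.cons n (Subst.cons m Subst.empty))) (by simp [clausesLambda])
  | transsem_refl m =>
    simpa [Args.subst, prog] using key ⟨[ι], .prog, .two (transsem v0 v0) tt, .top⟩
      (Subst.cons m Subst.empty) (by simp [clausesLambda])
  | transsem_step m n m' =>
    simpa [Args.subst, prog] using key ⟨[ι, ι, ι], .prog, .two (transsem v2 v1)
      (conj (atom (transone v2 v0)) (atom (transsem v0 v1))), .top⟩
      (Subst.cons m' (Subst.cons n (Subst.cons m Subst.empty))) (by simp [clausesLambda])

/-! ## Structural properties of the object logic -/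

/-- The initial clause applies only to lists of the form `A' :: L`; inverting membership first shows
that the list has this form. -/
theorem seq_of_element {w : World} {x : Tm w.ctx atm} {l : Tm w.ctx atmlst} (j : Tm w.ctx nt)
    (h : w ⊩ element x l) : w ⊩ seq j l (atom x) := by
  refine Forces.element_elim h fun w' e hv => ?_
  obtain ⟨y, l', hl, hx⟩ := hv
  have he := h.mono e
  simp only [subst_element, subst_seq, subst_atom, hl] at he ⊢
  exact (SeqView.init _ _ _ _ he).forces

theorem seq_tt {w : World} (j : Tm w.ctx nt) (l : Tm w.ctx atmlst) : w ⊩ seq j l tt :=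
  (SeqView.tt j l).forces

/-- Simulation of derivations of height `j` by derivations of height `k`, along a relation
between contexts. -/
theorem seq_map {w₀ : World} {j k : Tm w₀.ctx nt}
    (P : ∀ w : World, Hom w₀ w → Tm w.ctx atmlst → Tm w.ctx atmlst → Prop)
    (mono : ∀ {w w' : World} (e : Hom w₀ w) (e' : Hom w w') (l l' : Tm w.ctx atmlst),
      P w e l l' → P w' (e.comp e') (l.subst e'.θ) (l'.subst e'.θ))
    (cons_cons : ∀ {w : World} (e : Hom w₀ w) (x : Tm w.ctx atm) (l l' : Tm w.ctx atmlst),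
      P w e l l' → P w e (cons x l) (cons x l'))
    (elem : ∀ {w : World} (e : Hom w₀ w) (x : Tm w.ctx atm) (l l' : Tm w.ctx atmlst),
      P w e l l' → w ⊩ element x l → w ⊩ seq (k.subst e.θ) l' (atom x))
    (pred : ∀ {w : World} (e : Hom w₀ w) (i : Tm w.ctx nt), j.subst e.θ = succ i →
      ∃ i' : Tm w.ctx nt, k.subst e.θ = succ i' ∧ ∀ (l l' : Tm w.ctx atmlst) (b : Tm w.ctx prp),
        P w e l l' → w ⊩ seq i l b → w ⊩ seq i' l' b)
    {w : World} (e : Hom w₀ w) {l l' : Tm w.ctx atmlst} {b : Tm w.ctx prp} (hP : P w e l l')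
    (h : w ⊩ seq (j.subst e.θ) l b) : w ⊩ seq (k.subst e.θ) l' b := by
  -- There is no induction here: only the last step of the derivation is analysed, and `pred`
  -- supplies the simulation for its premises.
  refine Forces.seq_elim h fun w' e' v => ?_
  replace hP := mono e e' l l' hP
  simp only [subst_seq]
  have hj : j.subst (e.comp e').θ = (j.subst e.θ).subst e'.θ := by
    rw [Hom.comp_θ, Tm.subst_subst]
  have hk : k.subst (e.comp e').θ = (k.subst e.θ).subst e'.θ := by
    rw [Hom.comp_θ, Tm.subst_subst]
  rw [← hk]
  rw [← hj] at v
  generalize e.comp e' = f at *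
  generalize l.subst e'.θ = l, l'.subst e'.θ = l', b.subst e'.θ = b at *
  clear hj hk
  generalize hj : j.subst f.θ = j' at v
  cases v with
  | init i x' l x h => exact elem f x _ l' hP h
  | tt i l => exact seq_tt _ _
  | @conj i l b c h h' =>
    obtain ⟨i', hk, hi⟩ := pred f i hj
    rw [hk]
    exact (SeqView.conj (hi _ _ _ hP h) (hi _ _ _ hP h')).forces
  | @impl i l x b h =>
    obtain ⟨i', hk, hi⟩ := pred f i hj
    rw [hk]
    exact (SeqView.impl (hi _ _ _ (cons_cons f x l l' hP) h)).forces
  | @forallI i l b h =>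
    obtain ⟨i', hk, hi⟩ := pred f i hj
    rw [hk]
    refine (SeqView.forallI fun w'' e'' x => ?_).forces
    -- At the later world `pred` produces a new witness; injectivity of the successor identifies it
    -- with the image of `i'`.
    obtain ⟨i'', hk', hi'⟩ := pred (f.comp e'') (i.subst e''.θ) (by
      rw [Hom.comp_θ, ← Tm.subst_subst, hj, subst_succ])
    rw [Hom.comp_θ, ← Tm.subst_subst, hk, subst_succ, succ_inj] at hk'
    rw [hk']
    exact hi' _ _ _ (mono f e'' l l' hP) (h w'' e'' x)
  | @prog i l x b h h' =>
    obtain ⟨i', hk, hi⟩ := pred f i hj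
    rw [hk]
    exact (SeqView.prog h (hi _ _ _ hP h')).forces

/-- Derivability is monotone in the bound on the height. -/
theorem seq_succ {w : World} {j : Tm w.ctx nt} {l : Tm w.ctx atmlst} {b : Tm w.ctx prp}
    (hj : w ⊩ .nat j) (h : w ⊩ seq j l b) : w ⊩ seq (succ j) l b := by
  have key := Sat.nat_induction₂
    (.all atmlst (.all prp (seq v2 v1 v0 ⊃ₘ seq (succ v2) v1 v0))) (fun w j ih => ?_) hj
  · simp at key
    exact key l b h
  · simp at ih ⊢
    intro l b h
    -- The contexts are related by equality. If `j` is `succ i`, the target height has predecessor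
    -- `succ i`, and the induction hypothesis raises heights from `i` to `succ i`.
    have := seq_map (w₀ := w) (j := j) (k := succ j) (fun _ _ l l' => l = l')
      (fun e e' l l' hl => by rw [hl]) (fun e x l l' hl => by rw [hl])
      (fun e x l l' hl hx => hl ▸ seq_of_element _ hx)
      (fun e i hi => ⟨succ i, by simp [hi], fun l l' b hl hs =>
        hl ▸ (ih _ e i (Or.inl hi)).2 l b hs⟩)
      (Hom.id w) (l := l) (l' := l) (b := b) rfl (by simpa using h)
    simpa using this

/-- Every element of the list `l` is an element of `l'`. -/
def included {Γ : Ctx} (l l' : Tm Γ atmlst) : Form Γ :=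
  .all atm (element v0 l.wk ⊃ₘ element v0 l'.wk)

@[simp] theorem subst_included {Γ Δ : Ctx} (θ : Subst Γ Δ) (l l' : Tm Γ atmlst) :
    (included l l').subst θ = included (l.subst θ) (l'.subst θ) := by
  simp only [included, Form.subst, subst_element, wk_subst_lift, Tm.subst_var, lift_z]

theorem forces_included {w : World} {l l' : Tm w.ctx atmlst} :
    (w ⊩ included l l') ↔ ∀ (w' : World) (e : Hom w w') (x : Tm w'.ctx atm),
      (w' ⊩ element x (l.subst e.θ)) → w' ⊩ element x (l'.subst e.θ) := by
  rw [Forces.iff_sat]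
  simp [included]

theorem Forces.included_elim {w : World} {l l' : Tm w.ctx atmlst} (h : w ⊩ included l l')
    {x : Tm w.ctx atm} (hx : w ⊩ element x l) : w ⊩ element x l' := by
  have := forces_included.1 h w (Hom.id w) x
  simp only [Hom.id_θ, Tm.subst_id] at this
  exact this hx

/-- Weakening of contexts. -/
theorem seq_weaken {w : World} {j : Tm w.ctx nt} {l l' : Tm w.ctx atmlst} {b : Tm w.ctx prp}
    (hj : w ⊩ .nat j) (hl : w ⊩ included l l') (h : w ⊩ seq j l b) : w ⊩ seq j l' b := by
  have key := Sat.nat_induction₂ (.all atmlst (.all atmlst (.all prp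
    (included v2 v1 ⊃ₘ seq v3 v2 v0 ⊃ₘ seq v3 v1 v0)))) (fun w j ih => ?_) hj
  · simp at key
    exact key l l' b hl h
  · simp at ih ⊢
    intro l l' b hl h
    have := seq_map (w₀ := w) (j := j) (k := j) (fun w _ l l' => w ⊩ included l l')
      (fun e e' l l' hl => by simpa using hl.mono e')
      (fun e x l l' hl => forces_included.2 fun w' e' y hy => ?_)
      (fun e x l l' hl hx => seq_of_element _ (hl.included_elim hx))
      (fun e i hi => ⟨i, hi, fun l l' b hl hs => (ih _ e i (Or.inl hi)).2 l l' b hl hs⟩)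
      (Hom.id w) (l := l) (l' := l') (b := b) hl (by simpa using h)
    · simpa using this
    -- Inclusion survives adding one element to both lists: an element is either the new head or
    -- lies in the tail.
    · rw [subst_cons] at hy ⊢
      refine hy.element_elim fun w'' e'' hv => ?_
      obtain ⟨z, k, hk, hx⟩ := hv
      rw [subst_cons, cons_inj] at hk
      rw [subst_element, subst_cons, hk.1]
      rcases hx with rfl | hx
      · exact Forces.element_head _ _
      · rw [← hk.2] at hx
        refine Forces.element_tail _ ?_
        have := forces_included.1 hl w'' (e'.comp e'') (y.subst e''.θ)
        simp only [Hom.comp_θ, ← Tm.subst_subst] at this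
        exact this hx

/-- Every element of the list `l` is derivable from `l'`, with height `k`. -/
def entails {Γ : Ctx} (k : Tm Γ nt) (l l' : Tm Γ atmlst) : Form Γ :=
  .all atm (element v0 l.wk ⊃ₘ seq k.wk l'.wk (atom v0))

@[simp] theorem subst_entails {Γ Δ : Ctx} (θ : Subst Γ Δ) (k : Tm Γ nt) (l l' : Tm Γ atmlst) :
    (entails k l l').subst θ = entails (k.subst θ) (l.subst θ) (l'.subst θ) := by
  simp only [entails, Form.subst, subst_element, subst_seq, subst_atom, wk_subst_lift,
    Tm.subst_var, lift_z]

theorem forces_entails {w : World} {k : Tm w.ctx nt} {l l' : Tm w.ctx atmlst} :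
    (w ⊩ entails k l l') ↔ ∀ (w' : World) (e : Hom w w') (x : Tm w'.ctx atm),
      (w' ⊩ element x (l.subst e.θ)) → w' ⊩ seq (k.subst e.θ) (l'.subst e.θ) (atom x) := by
  rw [Forces.iff_sat]
  simp [entails]

theorem Forces.entails_elim {w : World} {k : Tm w.ctx nt} {l l' : Tm w.ctx atmlst}
    (h : w ⊩ entails k l l') {x : Tm w.ctx atm} (hx : w ⊩ element x l) :
    w ⊩ seq k l' (atom x) := by
  have := forces_entails.1 h w (Hom.id w) x
  simp only [Hom.id_θ, Tm.subst_id] at this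
  exact this hx

theorem entails_self {w : World} (k : Tm w.ctx nt) (l : Tm w.ctx atmlst) : w ⊩ entails k l l :=
  forces_entails.2 fun _ _ _ hx => seq_of_element _ hx

/-- The new head is derivable by the initial clause at any height. The other elements keep their
derivations by weakening, which leaves the height unchanged. -/
theorem Forces.entails_cons {w : World} {k : Tm w.ctx nt} {l l' : Tm w.ctx atmlst}
    (hk : w ⊩ .nat k) (h : w ⊩ entails k l l') (x : Tm w.ctx atm) :
    w ⊩ entails k (cons x l) (cons x l') := by
  refine forces_entails.2 fun w' e y hy => ?_
  rw [subst_cons] at hy ⊢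
  refine hy.element_elim fun w'' e' hv => ?_
  obtain ⟨z, l₁, hl₁, hy⟩ := hv
  rw [subst_cons, cons_inj] at hl₁
  rw [subst_seq, subst_cons, subst_atom, hl₁.1]
  rcases hy with rfl | hy
  · exact seq_of_element _ (Forces.element_head _ _)
  · rw [← hl₁.2] at hy
    have hs := ((h.mono e).mono e')
    simp only [subst_entails] at hs
    refine seq_weaken (by simpa using (hk.mono e).mono e') ?_ (hs.entails_elim hy)
    exact forces_included.2 fun w₃ e₃ u hu => by
      rw [subst_cons]; exact Forces.element_tail _ hu

/-- `k` bounds the heights of the derivations obtained by cutting derivations of height `i`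
into derivations of height `j`. -/
def cutBound {Γ : Ctx} (j i k : Tm Γ nt) : Form Γ :=
  .nat k ∧ₘ
    .all atmlst (.all prp (seq i.wk.wk v1 v0 ⊃ₘ seq k.wk.wk v1 v0)) ∧ₘ
    .all atmlst (.all atmlst (.all prp
      (entails i.wk.wk.wk v2 v1 ⊃ₘ seq j.wk.wk.wk v2 v0 ⊃ₘ seq k.wk.wk.wk v1 v0)))

theorem sat_cutBound {Δ : Ctx} {w : World} (θ : Subst Δ w.ctx) (j i k : Tm Δ nt) :
    Sat (cutBound j i k) w θ ↔ (w ⊩ .nat (k.subst θ)) ∧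
      (∀ (l : Tm w.ctx atmlst) (b : Tm w.ctx prp),
        (w ⊩ seq (i.subst θ) l b) → w ⊩ seq (k.subst θ) l b) ∧
      (∀ (l l' : Tm w.ctx atmlst) (b : Tm w.ctx prp), (w ⊩ entails (i.subst θ) l l') →
        (w ⊩ seq (j.subst θ) l b) → w ⊩ seq (k.subst θ) l' b) := by
  simp [cutBound]

theorem subst_cutBound {Γ Δ : Ctx} (θ : Subst Γ Δ) (j i k : Tm Γ nt) :
    (cutBound j i k).subst θ = cutBound (j.subst θ) (i.subst θ) (k.subst θ) := by
  simp only [cutBound, Form.subst, subst_seq, subst_entails, wk_subst_lift, Tm.subst_var, lift_z,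
    lift_s]
  rfl

/-- A derivation of height zero has no premises to simulate, since zero is not a successor; it is
either initial or proves `tt`. In the initial case the derivation supplied by `entails` takes its
place. -/
theorem cutBound_zero {w : World} {i : Tm w.ctx nt} (hi : w ⊩ .nat i) :
    w ⊩ cutBound zero i i := by
  rw [Forces.iff_sat]
  intro w' e
  rw [sat_cutBound]
  replace hi : w' ⊩ .nat (i.subst e.θ) := hi.mono e
  generalize i.subst e.θ = i at hi
  refine ⟨hi, fun l b h => h, fun l l' b hl h => ?_⟩
  have := seq_map (w₀ := w') (j := zero) (k := i) (fun w e l l' => w ⊩ entails (i.subst e.θ) l l')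
    (fun e e' l l' hl => by simpa [Tm.subst_subst] using hl.mono e')
    (fun e x l l' hl => Forces.entails_cons (by simpa using hi.mono e) hl x)
    (fun e x l l' hl hx => hl.entails_elim hx)
    (fun e i hi => absurd hi.symm (succ_ne_zero _))
    (Hom.id w') (l := l) (l' := l') (b := b) (by simpa using hl) (by simpa using h)
  simpa using this

/-- Premises are simulated by the third part of the given bound. At the leaves the derivations of
height `i` are raised to `k` by the second part and to `succ k` by monotonicity; this is why the
second part belongs to the invariant. -/
theorem cutBound_succ {w : World} {j i k : Tm w.ctx nt} (hi : w ⊩ .nat i)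
    (h : w ⊩ cutBound j i k) : w ⊩ cutBound (succ j) i (succ k) := by
  rw [Forces.iff_sat]
  intro w' e
  rw [sat_cutBound]
  replace hi : w' ⊩ .nat (i.subst e.θ) := hi.mono e
  replace h := h.mono e
  rw [subst_cutBound] at h
  simp only [subst_succ]
  generalize i.subst e.θ = i, j.subst e.θ = j, k.subst e.θ = k at hi h
  have h' := fun w'' e' => (sat_cutBound _ _ _ _).1 (Forces.iff_sat.1 h w'' e')
  have hid := h' w' (Hom.id w')
  simp only [Hom.id_θ, Tm.subst_id] at hid
  refine ⟨Der.natR_succ hid.1, fun l b hs => seq_succ hid.1 (hid.2.1 l b hs),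
    fun l l' b hl hs => ?_⟩
  have := seq_map (w₀ := w') (j := succ j) (k := succ k)
    (fun w e l l' => w ⊩ entails (i.subst e.θ) l l')
    (fun e e' l l' hl => by simpa [Tm.subst_subst] using hl.mono e')
    (fun e x l l' hl => Forces.entails_cons (by simpa using hi.mono e) hl x)
    (fun e x l l' hl hx => by
      rw [subst_succ]
      exact seq_succ (h' _ e).1 ((h' _ e).2.1 _ _ (hl.entails_elim hx)))
    (fun e i hi => ⟨k.subst e.θ, subst_succ _ _, fun l l' b hl hs => by
      rw [subst_succ, succ_inj] at hi
      rw [← hi] at hs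
      exact (h' _ e).2.2 l l' b hl hs⟩)
    (Hom.id w') (l := l) (l' := l') (b := b) (by simpa using hl) (by simpa using hs)
  simpa using this

/-- Induction on `j`: the bound starts at `i` and grows by one at each step, so it amounts to `j +
i`, but its existence suffices and no arithmetic is needed. The number `i` is quantified inside the
invariant, which may have only the induction variable free. -/
theorem ex_cutBound {w : World} {j i : Tm w.ctx nt} (hj : w ⊩ .nat j) (hi : w ⊩ .nat i) :
    w ⊩ .ex nt (cutBound j.wk i.wk v0) := by
  have key := Sat.nat_induction (.all nt (.nat v0 ⊃ₘ .ex nt (cutBound v2 v1 v0)))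
    (fun w => ?_) (fun w j ih => ?_) hj
  · have h := (sat_imp _ _ _ _).1 (key i) (by simpa using hi)
    rw [sat_ex] at h
    simp only [Form.subst, subst_cutBound] at h
    simpa using h
  · intro i hi
    refine Forces.ex_intro i ?_
    simp only [subst_cutBound, subst_nat, Tm.subst_var, Subst.cons_z, Subst.cons_s] at hi ⊢
    exact cutBound_zero hi
  · intro i hi
    have h := ih w (Hom.id w) i hi
    rw [sat_ex] at h
    rw [sat_ex]
    refine Forces.ex_elim h fun w' e k hk => ?_
    rw [Form.subst_subst]
    refine Forces.ex_intro (succ k) ?_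
    replace hi := hi.mono e
    simp only [Hom.id_θ, Tm.subst_id, subst_cutBound, subst_nat, Tm.subst_var, Subst.cons_z,
      Subst.cons_s, lift_z, lift_s, wk_subst_cons, Subst.cons_comp, subst_succ] at hi hk ⊢
    exact cutBound_succ hi hk

theorem Forces.cutBound_elim {w : World} {j i : Tm w.ctx nt} {C : Form w.ctx}
    (hj : w ⊩ .nat j) (hi : w ⊩ .nat i)
    (h : ∀ (w' : World) (e : Hom w w') (k : Tm w'.ctx nt), (w' ⊩ .nat k) →
      (∀ (l : Tm w'.ctx atmlst) (b : Tm w'.ctx prp),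
        (w' ⊩ seq (i.subst e.θ) l b) → w' ⊩ seq k l b) →
      (∀ (l l' : Tm w'.ctx atmlst) (b : Tm w'.ctx prp), (w' ⊩ entails (i.subst e.θ) l l') →
        (w' ⊩ seq (j.subst e.θ) l b) → w' ⊩ seq k l' b) → w' ⊩ C.subst e.θ) : w ⊩ C := by
  refine Forces.ex_elim (ex_cutBound hj hi) fun w' e k hk => ?_
  have hk := (sat_cutBound _ _ _ _).1 hk.sat
  simp only [wk_subst_cons, Tm.subst_var, Subst.cons_z] at hk
  exact h w' e k hk.1 hk.2.1 hk.2.2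

/-! ### Closure properties of provability with the height hidden -/

theorem prvv_tt {w : World} (l : Tm w.ctx atmlst) : w ⊩ prvv l tt :=
  Forces.prvv_intro Der.natR_zero (seq_tt _ _)

/-- The clause for `&` demands equal heights. A cut bound `k` provides them: cutting the identity
entailment into the first derivation raises it to `k`, and the second part of the bound raises the
other. -/
theorem prvv_conj {w : World} {l : Tm w.ctx atmlst} {b c : Tm w.ctx prp} (hb : w ⊩ prvv l b)
    (hc : w ⊩ prvv l c) : w ⊩ prvv l (conj b c) := by
  refine hb.prvv_elim fun w₁ e₁ j hj hb => ?_
  replace hc := hc.mono e₁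
  simp only [subst_prvv, subst_conj] at hc ⊢
  refine hc.prvv_elim fun w₂ e₂ i hi hc => ?_
  replace hj := hj.mono e₂
  replace hb := hb.mono e₂
  simp only [subst_prvv, subst_conj, subst_seq] at hb ⊢
  refine Forces.cutBound_elim hj hi fun w₃ e₃ k hk h h' => ?_
  replace hb := hb.mono e₃
  replace hc := hc.mono e₃
  simp only [subst_prvv, subst_conj, subst_seq] at hb hc ⊢
  exact Forces.prvv_intro (Der.natR_succ hk)
    (SeqView.conj (h' _ _ _ (entails_self _ _) hb) (h _ _ hc)).forces

theorem prv_of_prog {w : World} {x : Tm w.ctx atm} {b : Tm w.ctx prp} (hx : ProgView x b)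
    (h : w ⊩ prvv nil b) : w ⊩ prv x := by
  replace hx : w ⊩ prog x b := hx.forces
  refine h.prvv_elim fun w' e j hj h => ?_
  replace hx := hx.mono e
  simp only [subst_prv, subst_prog, subst_nil] at hx h ⊢
  exact Forces.prv_intro (Der.natR_succ hj) (SeqView.prog hx h).forces

/-- The only element of the one-element context is `x`, which is derivable from the empty context,
so the context is entailed by `nil` and the cut bound applies. -/
theorem prv_cut {w : World} {x y : Tm w.ctx atm} (h : w ⊩ prvv (cons x nil) (atom y))
    (hx : w ⊩ prv x) : w ⊩ prv y := by
  refine h.prvv_elim fun w₁ e₁ j hj h => ?_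
  replace hx := hx.mono e₁
  simp only [subst_prv, subst_cons, subst_nil, subst_atom] at h hx ⊢
  refine hx.prv_elim fun w₂ e₂ i hi hx => ?_
  replace hj := hj.mono e₂
  replace h := h.mono e₂
  simp only [subst_prv, subst_cons, subst_nil, subst_atom, subst_seq] at h ⊢
  refine Forces.cutBound_elim hj hi fun w₃ e₃ k hk _ h' => ?_
  replace hx := hx.mono e₃
  replace h := h.mono e₃
  simp only [subst_prv, subst_cons, subst_nil, subst_atom, subst_seq] at h hx ⊢
  refine Forces.prv_intro hk (h' _ _ _ (forces_entails.2 fun w₄ e₄ u hu => ?_) h)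
  replace hx := hx.mono e₄
  simp only [subst_cons, subst_nil, subst_atom, subst_seq] at hu hx ⊢
  refine hu.element_elim fun w₅ e₅ hv => ?_
  obtain ⟨z, l, hl, hz⟩ := hv
  replace hx := hx.mono e₅
  simp only [subst_cons, subst_nil, subst_atom, subst_seq, cons_inj] at hl hx ⊢
  rcases hz with hz | hz
  · rwa [hz, ← hl.1]
  · rw [← hl.2] at hz
    refine hz.element_elim fun w₆ e₆ hv => ?_
    obtain ⟨_, _, hl, _⟩ := hv
    exact absurd hl.symm (cons_ne_nil _ _)

/-! ## Inversion of typing and evaluation -/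

theorem Forces.eq_refl {w : World} (j : Tm w.ctx nt) : w ⊩ .pred .eq (.two j j) := by
  have h := Forces.def_intro (w := w) (c := ⟨[nt], .eq, .two v0 v0, .top⟩)
    (by simp [clausesAll, clausesNat]) (Subst.cons j Subst.empty) .topR
  simpa [Args.subst] using h

theorem Forces.eq_elim {w : World} {i j : Tm w.ctx nt} {C : Form w.ctx}
    (h : w ⊩ .pred .eq (.two i j))
    (k : ∀ (w' : World) (e : Hom w w'), i.subst e.θ = j.subst e.θ → w' ⊩ C.subst e.θ) :
    w ⊩ C := by
  refine Forces.def_elim h fun w' e c hc ρ heq _ => k w' e ?_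
  simp only [clausesAll, clausesNat, clausesList, clausesIntuit, clausesLambda, clauseSame,
    List.cons_append, List.nil_append, List.mem_cons, List.not_mem_nil, or_false] at hc
  rcases hc with rfl | rfl | rfl | rfl | rfl | rfl | rfl | rfl | rfl | rfl | rfl | rfl | rfl |
    rfl | rfl | rfl | rfl | rfl | rfl | rfl | rfl | rfl | rfl | rfl | rfl | rfl | rfl | rfl |
    rfl | rfl | rfl | rfl <;> simp [Args.subst] at heq
  exact heq.1.trans heq.2.symm

/-- The calculus inverts `nat` only by induction. The invariant carries an equation with a
successor, and the induction principle provides `nat` for the predecessor that it names. -/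
theorem nat_pred {w : World} {j : Tm w.ctx nt} (h : w ⊩ .nat (succ j)) : w ⊩ .nat j := by
  have key := Sat.nat_induction₂ (.all nt (.pred .eq (.two v1 (succ v0)) ⊃ₘ .nat v0))
    (fun w j ih => ?_) h
  · have h := key j (by simpa [Form.subst, Args.subst] using Forces.eq_refl (succ j))
    simpa using h
  · intro i hi
    simp only [Form.subst, Args.subst, Tm.subst_var, Subst.cons_z, Subst.cons_s, subst_succ] at hi
    refine hi.eq_elim fun w' e he => ?_
    have := (ih w' e (i.subst e.θ) (Or.inl (by simpa using he))).1
    simpa using this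

/-- With the empty context the initial clause cannot apply, so an atom can only come from a program
clause. -/
theorem Forces.seq_atom_elim {w : World} {j : Tm w.ctx nt} {x : Tm w.ctx atm} {C : Form w.ctx}
    (h : w ⊩ seq j nil (atom x))
    (k : ∀ (w' : World) (e : Hom w w') (i : Tm w'.ctx nt) (b : Tm w'.ctx prp),
      j.subst e.θ = succ i → ProgView (x.subst e.θ) b → (w' ⊩ seq i nil b) → w' ⊩ C.subst e.θ) :
    w ⊩ C := by
  refine h.seq_elim fun w₁ e₁ v => ?_
  rw [subst_nil, subst_atom] at v
  generalize hj : j.subst e₁.θ = j', hl : nil = l', hb : atom (x.subst e₁.θ) = b' at v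
  cases v with
  | init i x' l x h => exact absurd hl.symm (cons_ne_nil _ _)
  | @prog i l y b h h' =>
    subst hl
    rw [atom_inj] at hb
    subst hb
    refine h.prog_elim fun w₂ e₂ v => ?_
    replace h' := h'.mono e₂
    have := k w₂ (e₁.comp e₂) (i.subst e₂.θ) (b.subst e₂.θ)
    simp only [Hom.comp_θ, ← Tm.subst_subst, ← Form.subst_subst, hj, subst_succ] at this
    exact this trivial v (by simpa using h')
  | _ => exact absurd (congrArg Tm.code hb) (by simp)

/-- The head constant of the goal determines the clause; all other views are excluded by the codes
of the constants. -/
theorem Forces.seq_conj_elim {w : World} {j : Tm w.ctx nt} {l : Tm w.ctx atmlst}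
    {b c : Tm w.ctx prp} {C : Form w.ctx} (h : w ⊩ seq j l (conj b c))
    (k : ∀ (w' : World) (e : Hom w w') (i : Tm w'.ctx nt), j.subst e.θ = succ i →
      (w' ⊩ seq i (l.subst e.θ) (b.subst e.θ)) → (w' ⊩ seq i (l.subst e.θ) (c.subst e.θ)) →
      w' ⊩ C.subst e.θ) : w ⊩ C := by
  refine h.seq_elim fun w₁ e₁ v => ?_
  replace k := k w₁ e₁
  generalize l.subst e₁.θ = l at v k
  rw [subst_conj] at v
  generalize hj : j.subst e₁.θ = j', hb : conj (b.subst e₁.θ) (c.subst e₁.θ) = b' at v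
  cases v with
  | @conj i l b c h h' =>
    rw [conj_inj] at hb
    rw [hb.1, hb.2] at k
    exact k i hj h h'
  | _ => exact absurd (congrArg Tm.code hb) (by simp)

theorem Forces.seq_impl_elim {w : World} {j : Tm w.ctx nt} {l : Tm w.ctx atmlst}
    {x : Tm w.ctx atm} {b : Tm w.ctx prp} {C : Form w.ctx} (h : w ⊩ seq j l (impl x b))
    (k : ∀ (w' : World) (e : Hom w w') (i : Tm w'.ctx nt), j.subst e.θ = succ i →
      (w' ⊩ seq i (cons (x.subst e.θ) (l.subst e.θ)) (b.subst e.θ)) → w' ⊩ C.subst e.θ) :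
    w ⊩ C := by
  refine h.seq_elim fun w₁ e₁ v => ?_
  replace k := k w₁ e₁
  generalize l.subst e₁.θ = l at v k
  rw [subst_impl] at v
  generalize hj : j.subst e₁.θ = j', hb : impl (x.subst e₁.θ) (b.subst e₁.θ) = b' at v
  cases v with
  | @impl i l x b h =>
    rw [impl_inj] at hb
    rw [hb.1, hb.2] at k
    exact k i hj h
  | _ => exact absurd (congrArg Tm.code hb) (by simp)

theorem Forces.seq_forallI_elim {w : World} {j : Tm w.ctx nt} {l : Tm w.ctx atmlst}
    {b : Tm w.ctx (ι →ₜ prp)} {C : Form w.ctx} (h : w ⊩ seq j l (forallI b))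
    (k : ∀ (w' : World) (e : Hom w w') (i : Tm w'.ctx nt), j.subst e.θ = succ i →
      (∀ x : Tm w'.ctx ι, w' ⊩ seq i (l.subst e.θ) (.app (b.subst e.θ) x)) → w' ⊩ C.subst e.θ) :
    w ⊩ C := by
  refine h.seq_elim fun w₁ e₁ v => ?_
  replace k := k w₁ e₁
  generalize l.subst e₁.θ = l at v k
  rw [subst_forallI] at v
  generalize hj : j.subst e₁.θ = j', hb : forallI (b.subst e₁.θ) = b' at v
  cases v with
  | @forallI i l b h =>
    rw [forallI_inj] at hb
    rw [hb] at k
    refine k i hj fun x => ?_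
    simpa using h w₁ (Hom.id w₁) x
  | _ => exact absurd (congrArg Tm.code hb) (by simp)

/-- The possible last steps of an evaluation `m ⇓ n`; subderivations satisfy `Q`. -/
def NatsemView {Γ : Ctx} (Q : Tm Γ atm → Prop) (m n : Tm Γ ι) : Prop :=
  (∃ r, m = abs r ∧ n = abs r) ∨
    ∃ m' n' r, m = app m' n' ∧ Q (natsem m' (abs r)) ∧ Q (natsem (.app r n') n)

/-- The possible last steps of a derivation of `m ⇝ n`; subderivations satisfy `Q`. -/
def TransoneView {Γ : Ctx} (Q : Tm Γ atm → Prop) (m n : Tm Γ ι) : Prop :=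
  (∃ r n', m = app (abs r) n' ∧ n = .app r n') ∨
    ∃ m' n' p, m = app m' n' ∧ n = app p n' ∧ Q (transone m' p)

/-- The possible last steps of a derivation of `m ⇝* n`; subderivations satisfy `Q`. -/
def TranssemView {Γ : Ctx} (Q : Tm Γ atm → Prop) (m n : Tm Γ ι) : Prop :=
  m = n ∨ ∃ m', Q (transone m m') ∧ Q (transsem m' n)

/-- The atom `x` is derivable with a height that precedes `j`. -/
def SeqBelow (w : World) (j : Tm w.ctx nt) (x : Tm w.ctx atm) : Prop :=
  ∃ i : Tm w.ctx nt, (j = succ i ∨ j = succ (succ i)) ∧ (w ⊩ seq i nil (atom x))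

theorem SeqBelow.prv {w : World} {j : Tm w.ctx nt} {x : Tm w.ctx atm} (h : SeqBelow w j x)
    (hj : w ⊩ .nat j) : w ⊩ prv x := by
  obtain ⟨i, rfl | rfl, h⟩ := h
  · exact Forces.prv_intro (nat_pred hj) h
  · exact Forces.prv_intro (nat_pred (nat_pred hj)) h

section
variable {w : World} {j : Tm w.ctx nt} {m n : Tm w.ctx ι} {C : Form w.ctx}

theorem Forces.seq_natsem_elim (h : w ⊩ seq j nil (atom (natsem m n)))
    (k : ∀ (w' : World) (e : Hom w w'),
      NatsemView (SeqBelow w' (j.subst e.θ)) (m.subst e.θ) (n.subst e.θ) → w' ⊩ C.subst e.θ) :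
    w ⊩ C := by
  refine h.seq_atom_elim fun w₁ e₁ i b hj v hs => ?_
  generalize hx : (natsem m n).subst e₁.θ = x at v
  rw [subst_natsem] at hx
  cases v with
  | natsem_abs r =>
    rw [natsem_inj] at hx
    exact k w₁ e₁ (Or.inl ⟨r, hx⟩)
  | natsem_app m' n' v r =>
    rw [natsem_inj] at hx
    refine hs.seq_conj_elim fun w₂ e₂ i' hi h₁ h₂ => ?_
    have := k w₂ (e₁.comp e₂)
    simp only [Hom.comp_θ, ← Tm.subst_subst, ← Form.subst_subst, hj, hx.1, hx.2, subst_succ, hi,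
      subst_app] at this
    simp only [subst_nil, subst_atom, subst_natsem, subst_abs, Tm.subst_app] at h₁ h₂
    -- The premises lie two levels below `j`: one level for the program clause, one for the
    -- conjunction.
    exact this (Or.inr ⟨_, _, _, rfl, ⟨_, Or.inr rfl, h₁⟩, ⟨_, Or.inr rfl, h₂⟩⟩)
  | _ => exact absurd (congrArg Tm.code hx) (by simp)

theorem Forces.seq_transone_elim (h : w ⊩ seq j nil (atom (transone m n)))
    (k : ∀ (w' : World) (e : Hom w w'),
      TransoneView (SeqBelow w' (j.subst e.θ)) (m.subst e.θ) (n.subst e.θ) → w' ⊩ C.subst e.θ) :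
    w ⊩ C := by
  refine h.seq_atom_elim fun w₁ e₁ i b hj v hs => k w₁ e₁ ?_
  generalize hx : (transone m n).subst e₁.θ = x at v
  rw [subst_transone] at hx
  cases v with
  | transone_beta r m' =>
    rw [transone_inj] at hx
    exact Or.inl ⟨_, _, hx⟩
  | transone_app m' n' m'' =>
    rw [transone_inj] at hx
    -- The clause body is a single atom, so only one level is spent.
    exact Or.inr ⟨_, _, _, hx.1, hx.2, _, Or.inl hj, hs⟩
  | _ => exact absurd (congrArg Tm.code hx) (by simp)

theorem Forces.seq_transsem_elim (h : w ⊩ seq j nil (atom (transsem m n)))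
    (k : ∀ (w' : World) (e : Hom w w'),
      TranssemView (SeqBelow w' (j.subst e.θ)) (m.subst e.θ) (n.subst e.θ) → w' ⊩ C.subst e.θ) :
    w ⊩ C := by
  refine h.seq_atom_elim fun w₁ e₁ i b hj v hs => ?_
  generalize hx : (transsem m n).subst e₁.θ = x at v
  rw [subst_transsem] at hx
  cases v with
  | transsem_refl m' =>
    rw [transsem_inj] at hx
    exact k w₁ e₁ (Or.inl (hx.1.trans hx.2.symm))
  | transsem_step m' n' m'' =>
    rw [transsem_inj] at hx
    refine hs.seq_conj_elim fun w₂ e₂ i' hi h₁ h₂ => ?_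
    have := k w₂ (e₁.comp e₂)
    simp only [Hom.comp_θ, ← Tm.subst_subst, ← Form.subst_subst, hj, hx.1, hx.2, subst_succ,
      hi] at this
    simp only [subst_nil, subst_atom, subst_transone, subst_transsem] at h₁ h₂
    exact this (Or.inr ⟨_, ⟨_, Or.inr rfl, h₁⟩, ⟨_, Or.inr rfl, h₂⟩⟩)
  | _ => exact absurd (congrArg Tm.code hx) (by simp)

/-- The version without heights, for derivations on which no induction is performed. -/
theorem Forces.prv_natsem_elim (h : w ⊩ prv (natsem m n))
    (k : ∀ (w' : World) (e : Hom w w'),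
      NatsemView (fun x => w' ⊩ prv x) (m.subst e.θ) (n.subst e.θ) → w' ⊩ C.subst e.θ) :
    w ⊩ C := by
  refine h.prv_elim fun w₁ e₁ j hj hs => ?_
  rw [subst_natsem] at hs
  refine hs.seq_natsem_elim fun w₂ e₂ v => ?_
  have := k w₂ (e₁.comp e₂)
  simp only [Hom.comp_θ, ← Tm.subst_subst, ← Form.subst_subst] at this
  replace hj := hj.mono e₂
  refine this (v.imp_right ?_)
  rintro ⟨m', n', r, hm, h₁, h₂⟩
  exact ⟨m', n', r, hm, h₁.prv hj, h₂.prv hj⟩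

theorem Forces.prv_transone_elim (h : w ⊩ prv (transone m n))
    (k : ∀ (w' : World) (e : Hom w w'),
      TransoneView (fun x => w' ⊩ prv x) (m.subst e.θ) (n.subst e.θ) → w' ⊩ C.subst e.θ) :
    w ⊩ C := by
  refine h.prv_elim fun w₁ e₁ j hj hs => ?_
  rw [subst_transone] at hs
  refine hs.seq_transone_elim fun w₂ e₂ v => ?_
  have := k w₂ (e₁.comp e₂)
  simp only [Hom.comp_θ, ← Tm.subst_subst, ← Form.subst_subst] at this
  replace hj := hj.mono e₂
  refine this (v.imp_right ?_)
  rintro ⟨m', n', m'', hm, hn, h₁⟩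
  exact ⟨m', n', m'', hm, hn, h₁.prv hj⟩

theorem Forces.prv_transsem_elim (h : w ⊩ prv (transsem m n))
    (k : ∀ (w' : World) (e : Hom w w'),
      TranssemView (fun x => w' ⊩ prv x) (m.subst e.θ) (n.subst e.θ) → w' ⊩ C.subst e.θ) :
    w ⊩ C := by
  refine h.prv_elim fun w₁ e₁ j hj hs => ?_
  rw [subst_transsem] at hs
  refine hs.seq_transsem_elim fun w₂ e₂ v => ?_
  have := k w₂ (e₁.comp e₂)
  simp only [Hom.comp_θ, ← Tm.subst_subst, ← Form.subst_subst] at this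
  replace hj := hj.mono e₂
  refine this (v.imp_right ?_)
  rintro ⟨m', h₁, h₂⟩
  exact ⟨m', h₁.prv hj, h₂.prv hj⟩

theorem Forces.prv_typeof_app_elim {t : Tm w.ctx ι} (h : w ⊩ prv (typeof (app m n) t))
    (k : ∀ (w' : World) (e : Hom w w') (u : Tm w'.ctx ι),
      (w' ⊩ prv (typeof (m.subst e.θ) (arr u (t.subst e.θ)))) →
      (w' ⊩ prv (typeof (n.subst e.θ) u)) → w' ⊩ C.subst e.θ) :
    w ⊩ C := by
  refine h.prv_elim fun w₀ e₀ j hj hs => ?_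
  refine hs.seq_atom_elim fun w₁ e₁ i b hi v hs => ?_
  generalize hx : ((typeof (app m n) t).subst e₀.θ).subst e₁.θ = x at v
  simp only [subst_typeof, subst_app] at hx
  cases v with
  | typeof_app m' n' t u =>
    simp only [typeof_inj, app_inj] at hx
    refine hs.seq_conj_elim fun w₂ e₂ i' hi' h₁ h₂ => ?_
    have := k w₂ ((e₀.comp e₁).comp e₂) (u.subst e₂.θ)
    simp only [Hom.comp_θ, ← Tm.subst_subst, ← Form.subst_subst, hx.1.1, hx.1.2, hx.2] at this
    simp only [subst_nil, subst_atom, subst_typeof, subst_arr] at h₁ h₂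
    replace hj := (hj.mono e₁).mono e₂
    simp only [subst_nat, hi, subst_succ, hi'] at hj
    replace hj := nat_pred (nat_pred hj)
    exact this (Forces.prv_intro hj h₁) (Forces.prv_intro hj h₂)
  | typeof_abs r t u =>
    rw [typeof_inj] at hx
    exact absurd hx.1 (app_ne_abs _ _ _)
  | _ => exact absurd (congrArg Tm.code hx) (by simp)

/-- Functions map arguments of the right type to results of the right type. -/
theorem prv_typeof_beta {r : Tm w.ctx (ι →ₜ ι)} {t u : Tm w.ctx ι}
    (h : w ⊩ prv (typeof (abs r) (arr t u))) (hn : w ⊩ prv (typeof n t)) :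
    w ⊩ prv (typeof (.app r n) u) := by
  refine h.prv_elim fun w₀ e₀ j hj hs => ?_
  refine hs.seq_atom_elim fun w₁ e₁ i b hi v hs => ?_
  replace hn := (hn.mono e₀).mono e₁
  replace hj := hj.mono e₁
  simp only [subst_typeof, subst_abs, subst_arr, subst_prv, Tm.subst_app, subst_nat] at v hn hj ⊢
  generalize (r.subst e₀.θ).subst e₁.θ = r, (t.subst e₀.θ).subst e₁.θ = t,
    (u.subst e₀.θ).subst e₁.θ = u, (n.subst e₀.θ).subst e₁.θ = n at v hn
  generalize hx : typeof (abs r) (arr t u) = x at v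
  cases v with
  | typeof_abs r' t' u' =>
    simp only [typeof_inj, abs_inj, arr_inj] at hx
    obtain ⟨rfl, rfl, rfl⟩ := hx
    refine hs.seq_forallI_elim fun w₂ e₂ i₂ hi₂ h => ?_
    -- The quantified object variable is instantiated with the argument itself, so substitution in
    -- the typing derivation is just instantiation.
    replace h := h (n.subst e₂.θ)
    simp only [Tm.subst_lam, Tm.app_lam, subst_impl, subst_typeof, subst_atom, wk_subst_lift,
      Tm.subst_app, Tm.subst_var, lift_z, wk_subst_cons, Tm.subst_id, Subst.cons_z,
      subst_nil] at h
    refine h.seq_impl_elim fun w₃ e₃ i₃ hi₃ h => ?_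
    replace hn := (hn.mono e₂).mono e₃
    replace hj := (hj.mono e₂).mono e₃
    simp only [subst_nat, hi, subst_succ, hi₂, hi₃] at hj
    simp only [subst_typeof, subst_atom, subst_prv, Tm.subst_app, subst_nil] at h hn ⊢
    -- Cut removes the remaining assumption on the type of the argument. Three levels have been
    -- spent: on the clause, the object quantifier and the implication.
    exact prv_cut (Forces.prvv_intro (nat_pred (nat_pred (nat_pred hj))) h) hn
  | typeof_app m' n' t u =>
    rw [typeof_inj] at hx
    exact absurd hx.1.symm (app_ne_abs _ _ _)
  | _ => exact absurd (congrArg Tm.code hx) (by simp)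

end

section
variable {w : World}

/-! ## Determinacy -/

/-- Both clauses for a step start from an application, so no case survives and any goal follows. -/
theorem prv_transone_abs_absurd {r : Tm w.ctx (ι →ₜ ι)} {n : Tm w.ctx ι} {C : Form w.ctx}
    (h : w ⊩ prv (transone (abs r) n)) : w ⊩ C := by
  refine h.prv_transone_elim fun w' e v => ?_
  rw [subst_abs] at v
  rcases v with ⟨_, _, h, _⟩ | ⟨_, _, _, h, _⟩ <;> exact absurd h.symm (app_ne_abs _ _ _)

/-- If one step is a β-step and the other reduces the function part, then that part is an
abstraction and cannot step. Two β-steps agree by injectivity of the constructors, two steps of the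
function part by induction. -/
theorem transone_det {m m₁ m₂ : Tm w.ctx ι} (h₁ : w ⊩ prv (transone m m₁))
    (h₂ : w ⊩ prv (transone m m₂)) : w ⊩ same m₁ m₂ := by
  refine h₁.prv_elim fun w' e j hj h₁ => ?_
  replace h₂ := h₂.mono e
  simp only [subst_prv, subst_transone, subst_same] at h₁ h₂ ⊢
  generalize m.subst e.θ = m, m₁.subst e.θ = m₁, m₂.subst e.θ = m₂ at h₁ h₂
  -- Only the first derivation has its height exposed. The terms are quantified inside the
  -- invariant, because only the induction variable may be free there.
  have key := Sat.nat_induction₂ (.all ι (.all ι (.all ι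
    (seq v3 nil (atom (transone v2 v1)) ⊃ₘ prv (transone v2 v0) ⊃ₘ same v1 v0))))
    (fun w j ih => ?_) hj
  · simp at key
    exact key m m₁ m₂ h₁ h₂
  · simp at ih ⊢
    intro m m₁ m₂ h₁ h₂
    refine h₁.seq_transone_elim fun w₁ e₁ v₁ => ?_
    replace h₂ := h₂.mono e₁
    simp only [subst_prv, subst_transone, subst_same] at h₂ ⊢
    refine h₂.prv_transone_elim fun w₂ e₂ v₂ => ?_
    rw [subst_same]
    rcases v₁ with ⟨r, n, hm, hm₁⟩ | ⟨m', n, m'', hm, hm₁, i, hi, h₁⟩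
    · rcases v₂ with ⟨r', n', hm', hm₂⟩ | ⟨m', n', m'', hm', hm₂, h₂⟩
      · simp only [hm, subst_app, subst_abs, app_inj, abs_inj] at hm'
        rw [hm₁, hm₂, ← hm'.1, ← hm'.2, Tm.subst_app]
        exact Forces.same_refl _
      · simp only [hm, subst_app, subst_abs, app_inj] at hm'
        rw [← hm'.1] at h₂
        exact prv_transone_abs_absurd h₂
    · rcases v₂ with ⟨r', n', hm', hm₂⟩ | ⟨m₃, n', m₄, hm', hm₂, h₂⟩
      · simp only [hm, subst_app, app_inj] at hm'
        replace hi := ih w₁ e₁ i hi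
        replace h₁ := (Forces.prv_intro hi.1 h₁).mono e₂
        rw [subst_prv, subst_transone, hm'.1] at h₁
        exact prv_transone_abs_absurd h₁
      · simp only [hm, subst_app, app_inj] at hm'
        rw [← hm'.1] at h₂
        -- The induction hypothesis is used at the world reached after inverting the second
        -- derivation, with the predecessor transported there.
        have hi₂ := ih w₂ (e₁.comp e₂) (i.subst e₂.θ) (by
          rw [Hom.comp_θ, ← Tm.subst_subst]
          rcases hi with hi | hi <;> simp [hi])
        have h := hi₂.2 _ _ _ (by simpa using h₁.mono e₂) h₂
        refine h.same_elim fun w₃ e₃ heq => ?_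
        rw [hm₁, hm₂, ← hm'.2, subst_same, subst_app, subst_app, subst_app, heq]
        exact Forces.same_refl _

/-- For an application the induction hypothesis is used twice: first it identifies the two values of
the function part, and only then do the two second premises evaluate the same term. -/
theorem natsem_det {m m₁ m₂ : Tm w.ctx ι} (h₁ : w ⊩ prv (natsem m m₁))
    (h₂ : w ⊩ prv (natsem m m₂)) : w ⊩ same m₁ m₂ := by
  refine h₁.prv_elim fun w' e j hj h₁ => ?_
  replace h₂ := h₂.mono e
  simp only [subst_prv, subst_natsem, subst_same] at h₁ h₂ ⊢
  generalize m.subst e.θ = m, m₁.subst e.θ = m₁, m₂.subst e.θ = m₂ at h₁ h₂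
  have key := Sat.nat_induction₂ (.all ι (.all ι (.all ι
    (seq v3 nil (atom (natsem v2 v1)) ⊃ₘ prv (natsem v2 v0) ⊃ₘ same v1 v0))))
    (fun w j ih => ?_) hj
  · simp at key
    exact key m m₁ m₂ h₁ h₂
  · simp at ih ⊢
    intro m m₁ m₂ h₁ h₂
    refine h₁.seq_natsem_elim fun w₁ e₁ v₁ => ?_
    replace h₂ := h₂.mono e₁
    simp only [subst_prv, subst_natsem, subst_same] at h₂ ⊢
    refine h₂.prv_natsem_elim fun w₂ e₂ v₂ => ?_
    rw [subst_same]
    rcases v₁ with ⟨r, hm, hm₁⟩ | ⟨m', n, r, hm, ⟨i, hi, h₁⟩, ⟨i', hi', h₁'⟩⟩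
    · rcases v₂ with ⟨r', hm', hm₂⟩ | ⟨m', n', r', hm', h₂, h₂'⟩
      · rw [hm₁, hm₂, ← hm', ← hm]
        exact Forces.same_refl _
      · rw [hm, subst_abs] at hm'
        exact absurd hm'.symm (app_ne_abs _ _ _)
    · rcases v₂ with ⟨r', hm', hm₂⟩ | ⟨m₃, n', r', hm', h₂, h₂'⟩
      · rw [hm, subst_app] at hm'
        exact absurd hm' (app_ne_abs _ _ _)
      · simp only [hm, subst_app, app_inj] at hm'
        rw [← hm'.1] at h₂
        rw [← hm'.2] at h₂'
        have hi₂ := ih w₂ (e₁.comp e₂) (i.subst e₂.θ) (by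
          rw [Hom.comp_θ, ← Tm.subst_subst]
          rcases hi with hi | hi <;> simp [hi])
        have h := hi₂.2 _ _ _ (by simpa using h₁.mono e₂) h₂
        refine h.same_elim fun w₃ e₃ heq => ?_
        rw [subst_abs, subst_abs, abs_inj] at heq
        replace h₂' := h₂'.mono e₃
        replace h₁' := (h₁'.mono e₂).mono e₃
        have hi₃ := ih w₃ ((e₁.comp e₂).comp e₃) ((i'.subst e₂.θ).subst e₃.θ) (by
          simp only [Hom.comp_θ, ← Tm.subst_subst]
          rcases hi' with hi' | hi' <;> simp [hi'])
        simp only [subst_prv, subst_seq, subst_nil, subst_atom, subst_natsem, Tm.subst_app,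
          ← heq] at h₁' h₂'
        rw [subst_same]
        exact hi₃.2 _ _ _ h₁' h₂'

/-- As both end points are abstractions, which cannot step, either both reductions stop at once or
both make a step; by `transone_det` these steps agree, and induction applies. -/
theorem transsem_det {m : Tm w.ctx ι} {r₁ r₂ : Tm w.ctx (ι →ₜ ι)}
    (h₁ : w ⊩ prv (transsem m (abs r₁))) (h₂ : w ⊩ prv (transsem m (abs r₂))) :
    w ⊩ same (abs r₁) (abs r₂) := by
  refine h₁.prv_elim fun w' e j hj h₁ => ?_
  replace h₂ := h₂.mono e
  simp only [subst_prv, subst_transsem, subst_same, subst_abs] at h₁ h₂ ⊢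
  generalize m.subst e.θ = m, r₁.subst e.θ = r₁, r₂.subst e.θ = r₂ at h₁ h₂
  have key := Sat.nat_induction₂ (.all ι (.all (ι →ₜ ι) (.all (ι →ₜ ι)
    (seq v3 nil (atom (transsem v2 (abs v1))) ⊃ₘ prv (transsem v2 (abs v0)) ⊃ₘ
      same (abs v1) (abs v0))))) (fun w j ih => ?_) hj
  · simp at key
    exact key m r₁ r₂ h₁ h₂
  · simp at ih ⊢
    intro m r₁ r₂ h₁ h₂
    refine h₁.seq_transsem_elim fun w₁ e₁ v₁ => ?_
    replace h₂ := h₂.mono e₁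
    simp only [subst_prv, subst_transsem, subst_same, subst_abs] at h₂ v₁ ⊢
    refine h₂.prv_transsem_elim fun w₂ e₂ v₂ => ?_
    simp only [subst_same, subst_abs] at v₂ ⊢
    rcases v₁ with hm | ⟨m', ⟨i, hi, h₁⟩, ⟨i', hi', hs₁⟩⟩
    · rw [hm, subst_abs] at v₂
      rcases v₂ with hm' | ⟨m', h, _⟩
      · rw [hm']
        exact Forces.same_refl _
      · exact prv_transone_abs_absurd h
    · replace h₁ := (Forces.prv_intro (ih w₁ e₁ i hi).1 h₁).mono e₂
      rw [subst_prv, subst_transone] at h₁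
      rcases v₂ with hm | ⟨m'', h₂, hs₂⟩
      · rw [hm] at h₁
        exact prv_transone_abs_absurd h₁
      · refine (transone_det h₁ h₂).same_elim fun w₃ e₃ heq => ?_
        replace hs₂ := hs₂.mono e₃
        replace hs₁ := (hs₁.mono e₂).mono e₃
        have hi₃ := ih w₃ ((e₁.comp e₂).comp e₃) ((i'.subst e₂.θ).subst e₃.θ) (by
          simp only [Hom.comp_θ, ← Tm.subst_subst]
          rcases hi' with hi' | hi' <;> simp [hi'])
        simp only [subst_prv, subst_seq, subst_nil, subst_atom, subst_transsem, subst_abs,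
          ← heq] at hs₁ hs₂
        simp only [subst_same, subst_abs]
        exact hi₃.2 _ _ _ hs₁ hs₂

/-! ## Equivalence of the two semantics -/

theorem prv_transsem_step {m m' n : Tm w.ctx ι} (h : w ⊩ prv (transone m m'))
    (h' : w ⊩ prv (transsem m' n)) : w ⊩ prv (transsem m n) :=
  prv_of_prog (.transsem_step m n m') (prvv_conj h h')

theorem prv_natsem_app {m n v : Tm w.ctx ι} {r : Tm w.ctx (ι →ₜ ι)}
    (h : w ⊩ prv (natsem m (abs r))) (h' : w ⊩ prv (natsem (.app r n) v)) :
    w ⊩ prv (natsem (app m n) v) :=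
  prv_of_prog (.natsem_app m n v r) (prvv_conj h h')

/-- Induction on the reduction of the function part: each of its steps is a step of the application,
and when it has reached the abstraction a β-step leads to the second reduction. -/
theorem prv_transsem_app {m n v : Tm w.ctx ι} {r : Tm w.ctx (ι →ₜ ι)}
    (h : w ⊩ prv (transsem m (abs r))) (h' : w ⊩ prv (transsem (.app r n) v)) :
    w ⊩ prv (transsem (app m n) v) := by
  refine h.prv_elim fun w' e j hj h => ?_
  replace h' := h'.mono e
  simp only [subst_prv, subst_transsem, subst_app, subst_abs, Tm.subst_app] at h h' ⊢
  generalize m.subst e.θ = m, n.subst e.θ = n, v.subst e.θ = v, r.subst e.θ = r at h h'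
  have key := Sat.nat_induction₂ (.all (ι →ₜ ι) (.all ι (.all ι (.all ι
    (seq (.var (.s (.s (.s (.s .z))))) nil (atom (transsem v0 (abs v3))) ⊃ₘ
      prv (transsem (.app v3 v2) v1) ⊃ₘ prv (transsem (app v0 v2) v1))))))
    (fun w j ih => ?_) hj
  · simp at key
    exact key r n v m h h'
  · simp at ih ⊢
    intro r n v m h h'
    refine h.seq_transsem_elim fun w₁ e₁ view => ?_
    replace h' := h'.mono e₁
    simp only [subst_prv, subst_transsem, subst_app, subst_abs, Tm.subst_app] at h' view ⊢
    rcases view with hm | ⟨m', ⟨i, hi, h₁⟩, ⟨i', hi', h₂⟩⟩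
    · rw [hm]
      exact prv_transsem_step (prv_of_prog (.transone_beta _ _) (prvv_tt _)) h'
    · exact prv_transsem_step
        (prv_of_prog (.transone_app _ _ m') (Forces.prv_intro (ih w₁ e₁ i hi).1 h₁))
        ((ih w₁ e₁ i' hi').2 _ _ _ _ h₂ h')

theorem natsem_transsem {m : Tm w.ctx ι} {r : Tm w.ctx (ι →ₜ ι)}
    (h : w ⊩ prv (natsem m (abs r))) : w ⊩ prv (transsem m (abs r)) := by
  refine h.prv_elim fun w' e j hj h => ?_
  simp only [subst_prv, subst_transsem, subst_natsem, subst_abs] at h ⊢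
  generalize m.subst e.θ = m, r.subst e.θ = r at h
  have key := Sat.nat_induction₂ (.all ι (.all (ι →ₜ ι)
    (seq v2 nil (atom (natsem v1 (abs v0))) ⊃ₘ prv (transsem v1 (abs v0)))))
    (fun w j ih => ?_) hj
  · simp at key
    exact key m r h
  · simp at ih ⊢
    intro m r h
    refine h.seq_natsem_elim fun w₁ e₁ view => ?_
    simp only [subst_prv, subst_transsem, subst_abs] at view ⊢
    rcases view with ⟨r', hm, hr⟩ | ⟨m', n, r', hm, ⟨i, hi, h₁⟩, ⟨i', hi', h₂⟩⟩
    · rw [hm, hr]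
      exact prv_of_prog (.transsem_refl _) (prvv_tt _)
    · rw [hm]
      exact prv_transsem_app ((ih w₁ e₁ i hi).2 _ _ h₁) ((ih w₁ e₁ i' hi').2 _ _ h₂)

/-- Induction on the step. Before a β-step the function part is its own value, so the evaluation of
the contractum completes that of the redex. For a step in the function part, the given evaluation is
inverted and the induction hypothesis applies to its first premise. -/
theorem natsem_of_transone {m m' v : Tm w.ctx ι} (h : w ⊩ prv (transone m m'))
    (h' : w ⊩ prv (natsem m' v)) : w ⊩ prv (natsem m v) := by
  refine h.prv_elim fun w' e j hj h => ?_
  replace h' := h'.mono e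
  simp only [subst_prv, subst_transone, subst_natsem] at h h' ⊢
  generalize m.subst e.θ = m, m'.subst e.θ = m', v.subst e.θ = v at h h'
  have key := Sat.nat_induction₂ (.all ι (.all ι (.all ι
    (seq v3 nil (atom (transone v2 v1)) ⊃ₘ prv (natsem v1 v0) ⊃ₘ prv (natsem v2 v0)))))
    (fun w j ih => ?_) hj
  · simp at key
    exact key m m' v h h'
  · simp at ih ⊢
    intro m m' v h h'
    refine h.seq_transone_elim fun w₁ e₁ view => ?_
    replace h' := h'.mono e₁
    simp only [subst_prv, subst_natsem] at h' ⊢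
    rcases view with ⟨r, n, hm, hm'⟩ | ⟨m₁, n, m₂, hm, hm', i, hi, h₁⟩
    · rw [hm'] at h'
      rw [hm]
      exact prv_natsem_app (prv_of_prog (.natsem_abs r) (prvv_tt _)) h'
    · rw [hm'] at h'
      rw [hm]
      refine h'.prv_natsem_elim fun w₂ e₂ view => ?_
      simp only [subst_prv, subst_natsem, subst_app] at view ⊢
      rcases view with ⟨r, hr, _⟩ | ⟨m₃, n', r, hm₃, h₂, h₃⟩
      · exact absurd hr (app_ne_abs _ _ _)
      · rw [app_inj] at hm₃
        rw [← hm₃.1] at h₂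
        rw [← hm₃.2] at h₃
        have hi₂ := ih w₂ (e₁.comp e₂) (i.subst e₂.θ) (by
          rw [Hom.comp_θ, ← Tm.subst_subst]
          rcases hi with hi | hi <;> simp [hi])
        exact prv_natsem_app (hi₂.2 _ _ _ (by simpa using h₁.mono e₂) h₂) h₃

/-- Evaluation is pulled back along the reduction one step at a time. It starts from the end point,
which evaluates to itself because it is an abstraction. -/
theorem transsem_natsem {m : Tm w.ctx ι} {r : Tm w.ctx (ι →ₜ ι)}
    (h : w ⊩ prv (transsem m (abs r))) : w ⊩ prv (natsem m (abs r)) := by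
  refine h.prv_elim fun w' e j hj h => ?_
  simp only [subst_prv, subst_transsem, subst_natsem, subst_abs] at h ⊢
  generalize m.subst e.θ = m, r.subst e.θ = r at h
  have key := Sat.nat_induction₂ (.all ι (.all (ι →ₜ ι)
    (seq v2 nil (atom (transsem v1 (abs v0))) ⊃ₘ prv (natsem v1 (abs v0)))))
    (fun w j ih => ?_) hj
  · simp at key
    exact key m r h
  · simp at ih ⊢
    intro m r h
    refine h.seq_transsem_elim fun w₁ e₁ view => ?_
    simp only [subst_prv, subst_natsem, subst_abs] at view ⊢
    rcases view with hm | ⟨m', ⟨i, hi, h₁⟩, ⟨i', hi', h₂⟩⟩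
    · rw [hm]
      exact prv_of_prog (.natsem_abs _) (prvv_tt _)
    · exact natsem_of_transone (Forces.prv_intro (ih w₁ e₁ i hi).1 h₁)
        ((ih w₁ e₁ i' hi').2 _ _ h₂)

/-! ## Subject reduction -/

/-- For an application, inversion of typing types both parts, induction types the abstraction
reached by the function part, `prv_typeof_beta` types its instance, and induction on the second
premise types the value. -/
theorem natsem_typeof {m n t : Tm w.ctx ι} (h : w ⊩ prv (natsem m n))
    (ht : w ⊩ prv (typeof m t)) : w ⊩ prv (typeof n t) := by
  refine h.prv_elim fun w' e j hj h => ?_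
  replace ht := ht.mono e
  simp only [subst_prv, subst_typeof, subst_natsem] at h ht ⊢
  generalize m.subst e.θ = m, n.subst e.θ = n, t.subst e.θ = t at h ht
  have key := Sat.nat_induction₂ (.all ι (.all ι (.all ι
    (seq v3 nil (atom (natsem v2 v1)) ⊃ₘ prv (typeof v2 v0) ⊃ₘ prv (typeof v1 v0)))))
    (fun w j ih => ?_) hj
  · simp at key
    exact key m n t h ht
  · simp at ih ⊢
    intro m n t h ht
    refine h.seq_natsem_elim fun w₁ e₁ view => ?_
    replace ht := ht.mono e₁
    simp only [subst_prv, subst_typeof] at ht ⊢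
    rcases view with ⟨r, hm, hn⟩ | ⟨m', n', r, hm, ⟨i, hi, h₁⟩, ⟨i', hi', h₂⟩⟩
    · rwa [hn, ← hm]
    · rw [hm] at ht
      refine ht.prv_typeof_app_elim fun w₂ e₂ u h₃ h₄ => ?_
      replace h₁ := h₁.mono e₂
      replace h₂ := h₂.mono e₂
      have hi₂ := ih w₂ (e₁.comp e₂) (i.subst e₂.θ) (by
        rw [Hom.comp_θ, ← Tm.subst_subst]
        rcases hi with hi | hi <;> simp [hi])
      have hi₂' := ih w₂ (e₁.comp e₂) (i'.subst e₂.θ) (by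
        rw [Hom.comp_θ, ← Tm.subst_subst]
        rcases hi' with hi | hi <;> simp [hi])
      simp only [subst_prv, subst_typeof, subst_seq, subst_nil, subst_atom, subst_natsem,
        subst_abs, Tm.subst_app] at h₁ h₂ ⊢
      exact hi₂'.2 _ _ _ h₂ (prv_typeof_beta (hi₂.2 _ _ _ h₁ h₃) h₄)

/-- A β-step is covered by `prv_typeof_beta`; a step in the function part keeps its type by
induction, and the application is typed anew with the same argument type. -/
theorem transone_typeof {m n t : Tm w.ctx ι} (h : w ⊩ prv (transone m n))
    (ht : w ⊩ prv (typeof m t)) : w ⊩ prv (typeof n t) := by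
  refine h.prv_elim fun w' e j hj h => ?_
  replace ht := ht.mono e
  simp only [subst_prv, subst_typeof, subst_transone] at h ht ⊢
  generalize m.subst e.θ = m, n.subst e.θ = n, t.subst e.θ = t at h ht
  have key := Sat.nat_induction₂ (.all ι (.all ι (.all ι
    (seq v3 nil (atom (transone v2 v1)) ⊃ₘ prv (typeof v2 v0) ⊃ₘ prv (typeof v1 v0)))))
    (fun w j ih => ?_) hj
  · simp at key
    exact key m n t h ht
  · simp at ih ⊢
    intro m n t h ht
    refine h.seq_transone_elim fun w₁ e₁ view => ?_
    replace ht := ht.mono e₁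
    simp only [subst_prv, subst_typeof] at ht ⊢
    rcases view with ⟨r, n', hm, hn⟩ | ⟨m', n', m'', hm, hn, i, hi, h₁⟩
    · rw [hm] at ht
      rw [hn]
      refine ht.prv_typeof_app_elim fun w₂ e₂ u h₃ h₄ => ?_
      simp only [subst_prv, subst_typeof, subst_abs, Tm.subst_app] at h₃ ⊢
      exact prv_typeof_beta h₃ h₄
    · rw [hm] at ht
      rw [hn]
      refine ht.prv_typeof_app_elim fun w₂ e₂ u h₃ h₄ => ?_
      have hi₂ := ih w₂ (e₁.comp e₂) (i.subst e₂.θ) (by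
        rw [Hom.comp_θ, ← Tm.subst_subst]
        rcases hi with hi | hi <;> simp [hi])
      simp only [subst_prv, subst_typeof, subst_app]
      exact prv_of_prog (.typeof_app _ _ _ u)
        (prvv_conj (hi₂.2 _ _ _ (by simpa using h₁.mono e₂) h₃) h₄)

theorem transsem_typeof {m n t : Tm w.ctx ι} (h : w ⊩ prv (transsem m n))
    (ht : w ⊩ prv (typeof m t)) : w ⊩ prv (typeof n t) := by
  refine h.prv_elim fun w' e j hj h => ?_
  replace ht := ht.mono e
  simp only [subst_prv, subst_typeof, subst_transsem] at h ht ⊢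
  generalize m.subst e.θ = m, n.subst e.θ = n, t.subst e.θ = t at h ht
  have key := Sat.nat_induction₂ (.all ι (.all ι (.all ι
    (seq v3 nil (atom (transsem v2 v1)) ⊃ₘ prv (typeof v2 v0) ⊃ₘ prv (typeof v1 v0)))))
    (fun w j ih => ?_) hj
  · simp at key
    exact key m n t h ht
  · simp at ih ⊢
    intro m n t h ht
    refine h.seq_transsem_elim fun w₁ e₁ view => ?_
    replace ht := ht.mono e₁
    simp only [subst_prv, subst_typeof] at ht ⊢
    rcases view with hm | ⟨m', ⟨i, hi, h₁⟩, ⟨i', hi', h₂⟩⟩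
    · rwa [← hm]
    · exact (ih w₁ e₁ i' hi').2 _ _ _ h₂
        (transone_typeof (Forces.prv_intro (ih w₁ e₁ i hi).1 h₁) ht)

end

end FOLDN

theorem mainTheorem5 :
    -- determinacy of semantics
    (FOLDN.Derivable FOLDN.lambdaDefinition FOLDN.natsemDet ∧
      FOLDN.Derivable FOLDN.lambdaDefinition FOLDN.transoneDet ∧
      FOLDN.Derivable FOLDN.lambdaDefinition FOLDN.transsemDet) ∧
    -- equivalence of semantics
    (FOLDN.Derivable FOLDN.lambdaDefinition FOLDN.natsemToTranssem ∧
      FOLDN.Derivable FOLDN.lambdaDefinition FOLDN.transsemToNatsem) ∧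
    -- subject reduction
    (FOLDN.Derivable FOLDN.lambdaDefinition FOLDN.natsemSubjRed ∧
      FOLDN.Derivable FOLDN.lambdaDefinition FOLDN.transoneSubjRed ∧
      FOLDN.Derivable FOLDN.lambdaDefinition FOLDN.transsemSubjRed) := by
  -- The formulas are closed, so it suffices that their content holds at every world; unfolding it
  -- leaves exactly the statements proved above.
  refine ⟨⟨?_, ?_, ?_⟩, ⟨?_, ?_⟩, ?_, ?_, ?_⟩ <;> refine FOLDN.derivable_of_sat fun w => ?_
  · simpa [FOLDN.natsemDet] using fun m m₁ m₂ => FOLDN.natsem_det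
  · simpa [FOLDN.transoneDet] using fun m m₁ m₂ => FOLDN.transone_det
  · simpa [FOLDN.transsemDet] using fun m r₁ r₂ => FOLDN.transsem_det
  · simpa [FOLDN.natsemToTranssem] using fun m r => FOLDN.natsem_transsem
  · simpa [FOLDN.transsemToNatsem] using fun m r => FOLDN.transsem_natsem
  · simpa [FOLDN.natsemSubjRed] using fun m n h t => FOLDN.natsem_typeof h
  · simpa [FOLDN.transoneSubjRed] using fun m n h t => FOLDN.transone_typeof h
  · simpa [FOLDN.transsemSubjRed] using fun m n h t => FOLDN.transsem_typeof h
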